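/- **Theorem (central charge is equal to the solid torus partition function).** *Conventions.* Let $\operatorname{Im}\tau>0$, $q^x=e^{2\pi i\tau x}$ for $x\in\mathbb Q$, $q=q^1$, $E=\mathbb C^*/q^{\mathbb Z}$, $\phi(x)=\prod_{k\ge0}(1-q^kx)$, $\theta(x)=\phi(x)\phi(q/x)$. Let $G=\mathbb C^*$ with coordinate $s$ act on $V=\bigoplus_{i=1}^N a_is^{D_i}w^{q_i/2}$, where $D_i\in\mathbb Z\setminus\{0\}$, the R-charges satisfy $q_i/2\in\mathbb Z$, and both $V_+$ (the coordinates with $D_i>0$) and $V_-$ (those with $D_i<0$) are nonzero. Put $U_i=a_is^{D_i}$ and $d_i(\beta)=D_i\beta-q_i/2$. Fix generic equivariant parameters $a_i\in\mathbb C^*$: for $k\in V_+$ and $j\ne k$, $\theta(U_k^{-1})$ and $\theta(U_j^{-1})$ have no common zero $s\in\mathbb C^*$. *Sectors.* A sector of the inertia stack of $X_+$ is $v\in\mathbb Q\cap[0,1)$, with $g(v)=e^{2\pi iv}\in G$; let $P_v$ be the set of $i\in V_+$ with $g(v)^{D_i}=1$. Its Euler characteristic is $$\chi(X_v,F)=\sum_{k\in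 P_v}\frac1{D_k}\sum_{s^{D_k}=a_k^{-1}}\frac{F(s)}{\prod_{j\in P_v,\,j\neq k}(1-U_j^{-1})}.$$ *Central charge.* Let $\mathrm{Eff}=\{\beta\in\mathbb Q: d_k(\beta)\in\mathbb Z_{\ge0}\text{ for some }k\in V_+\}$. The level $V_+^\vee$ contribution in degree $\beta$ is $\Lambda_\beta(s)=(-1)^{\sum_{i\in V_+}\lfloor d_i(\beta)\rfloor}\prod_{i\in V_+}\det\big(U_i^{-1}\chi(\mathbb P^1,\mathcal O(d_i(\beta)))\big)$, where $\chi(\mathbb P^1,\mathcal O(x))=\sum_{k=0}^{\lfloor x\rfloor}q^{-\{x\}-k}-\sum_{k=0}^{-\lfloor x\rfloor-2}q^{k+1-\{x\}}$. The degree $\beta$ term of the I-function and the Gamma class in the sector $v$ are $$I_\beta=\frac{\theta(z^{-1})}{\theta(q^{-\{\beta\}}s^{-1}z^{-1})}\,z^{\lfloor\beta\rfloor}\Lambda_\beta(s)\prod_{i=1}^N\frac{\phi(U_i^{-1}q^{\{-d_i(\beta)\}})}{\phi(U_i^{-1}q^{-d_i(\beta)})},\qquad \hat\Gamma_v=\frac{1}{\Lambda_v(s)}\,\frac{\prod_{i\in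 P_v}(1-U_i^{-1})}{\prod_{i=1}^N\phi(U_i^{-1}q^{\{-D_iv\}})}.$$ Let $\mathcal H_\beta=I_\beta\hat\Gamma_{\{\beta\}}$, a class on the sector $\{\beta\}$; its values at the points $s$ above are taken after removing removable singularities. Let $\mathcal E_+$ be an elliptic class over $a$, i.e. a function on the finite set $\mathrm{Ell}_T(X_+)=\{\prod_{i\in V_+}\theta(U_i^{-1})=0\}\subset\mathbb C^*/q^{\mathbb Z}$. Its orbifold elliptic Chern character in the sector $v$ is $s\mapsto\mathcal E_+(q^vs)$, and $$Z^K(\mathcal E_+,V_+^\vee)=\sum_{\beta\in\mathrm{Eff}}Z_\beta,\qquad Z_\beta=\chi\big(X_{\{\beta\}},\ \mathcal H_\beta(s)\,\mathcal E_+(q^{\{\beta\}}s)\big).$$ *Interpolation.* Call $z\in\mathbb C^*$ generic if $z\notin q^{\mathbb Z}$ and $\theta(s^{-1}z^{-1})\ne0$ for all $s$ in $\mathrm{Ell}_T(X_+)$. Sections of $\mathcal L=\mathcal U\otimes\Theta(V_+)$ over $E_G$ are the holomorphic functions on $\mathbb C^*$ with the same factor of automorphy under $s\mapsto qs$ as $\frac{\theta(sz^{-1})}{\theta(s)\theta(z^{-1})}\prod_{i\in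 V_+}\theta(U_i^{-1}q^{q_i/2})$. Points of $\mathrm{Ell}_T(X_+)$ are represented in $\mathbb C^*$ by $q^vs_0$ with $0\le v<1$, $k\in P_v$, $s_0^{D_k}=a_k^{-1}$. An interpolation is a section $\mathcal E_z$ of $\mathcal L$ equal to $\mathcal E_+(s)\,\theta(z^{-1})/\theta(s^{-1}z^{-1})$ at all these representatives. *Statement.* For generic $z$ the interpolation $\mathcal E_z$ exists and is unique. Let $\Gamma_q=\prod_{i=1}^N\phi(a_i^{-1}s^{-D_i}q^{q_i/2})^{-1}$ and let $\mathcal C_\delta=\{|s|=\delta\}$ be a circle such that all poles in $\mathbb C^*$ of the factors of $\Gamma_q$ with $i\in V_+$ lie in $|s|<\delta$ and all poles of the factors with $i\in V_-$ lie in $|s|>\delta$. Then: 1. for every generic $z$ at which the series $Z^K(\mathcal E_+,V_+^\vee)$ converges, $$Z^K(\mathcal E_+,V_+^\vee)=\frac1{2\pi i}\oint_{\mathcal C_\delta}\frac{ds}{s}\,\Gamma_q\cdot\mathcal E_z=\mathrm{tr}(\Gamma_q\otimes\mathcal E_z),$$ where $\mathrm{tr}$ is the integral over the compact torus $\mathcal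 C_\delta$ (the maximal compact subgroup of $G$, shifted) against its Haar measure of mass one; the second equality holds for every generic $z$; 2. regardless of convergence, the series $\sum_\beta Z_\beta$ is an asymptotic expansion of the integral as $z\to0$: for every $\varepsilon>0$ and every $M\in\mathbb N$, for all sufficiently large $B$, $$\frac1{2\pi i}\oint_{\mathcal C_\delta}\frac{ds}{s}\,\Gamma_q\cdot\mathcal E_z-\sum_{\beta\in\mathrm{Eff},\ \beta<B}Z_\beta=O(|z|^M)$$ as $z\to0$ through the generic $z$ with $|z-s^{-1}|\ge\varepsilon|z|$ for all $s\in\mathbb C^*$ in $\mathrm{Ell}_T(X_+)$. -/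

import Mathlib

open Filter Topology

noncomputable section

/-! ### Theta functions

The elliptic curve is `E = ℂˣ / q^ℤ` with `q = exp (2πiτ)`, `0 < Im τ`. Fixing `τ` fixes all
the fractional powers `q ^ x`. -/

/-- `q ^ x = exp (2πiτx)`. -/
def qpow (τ : ℂ) (x : ℚ) : ℂ := Complex.exp (2 * Real.pi * Complex.I * τ * (x : ℂ))

/-- `q = exp (2πiτ)`. -/
def nomeQ (τ : ℂ) : ℂ := qpow τ 1

/-- `φ(x) = ∏_{k ≥ 0} (1 - q^k x)`. -/
def qphi (τ x : ℂ) : ℂ := ∏' k : ℕ, (1 - nomeQ τ ^ k * x)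

/-- `θ(x) = φ(x) φ(q/x)`. -/
def qtheta (τ x : ℂ) : ℂ := qphi τ x * qphi τ (nomeQ τ / x)

/-- `θ(z⁻¹) / θ(y⁻¹ z⁻¹)`, the elliptic replacement of `y ^ (- log z / log q)`. -/
def kahlerFactor (τ z y : ℂ) : ℂ := qtheta τ z⁻¹ / qtheta τ (y⁻¹ * z⁻¹)

/-- The determinant of the virtual `ℂ^*_q`-representation
`u ⊗ χ(ℙ¹, 𝒪(x)) = u ⊗ (H⁰ - H¹)`, where
`H⁰ = ∑_{0 ≤ k ≤ ⌊x⌋} q^{-{x}-k}` and `H¹ = ∑_{0 ≤ k ≤ -⌊x⌋-2} q^{k+1-{x}}`. -/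
def detChi (τ u : ℂ) (x : ℚ) : ℂ :=
  (∏ k ∈ Finset.range (⌊x⌋ + 1).toNat, u * qpow τ (-Int.fract x - k)) /
    (∏ k ∈ Finset.range (-⌊x⌋ - 1).toNat, u * qpow τ (k + 1 - Int.fract x))

/-! ### The model -/

/-- The weights of a gauged linear sigma model with gauge group `G = ℂˣ`: the space
`V = ⨁ᵢ aᵢ s^{Dᵢ} w^{rᵢ}`, where `s` is the coordinate of `G`, the `aᵢ` are the coordinates of the
torus `T` and `rᵢ = qᵢ / 2` are the halves of the R-charges `qᵢ`. Both `V₊` (the coordinates with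
`0 < Dᵢ`) and `V₋` (those with `Dᵢ < 0`) are nonzero. -/
structure GLSMData (N : ℕ) where
  /-- gauge charges -/
  D : Fin N → ℤ
  /-- halves of the R-charges, the weights of the `w`-action -/
  r : Fin N → ℤ
  D_ne_zero : ∀ i, D i ≠ 0
  exists_pos : ∃ i, 0 < D i
  exists_neg : ∃ i, D i < 0

namespace GLSMData

variable {N : ℕ} (X : GLSMData N) (τ : ℂ) (a : Fin N → ℂ)

/-- The coordinates of `V₊`. -/
def pos : Finset (Fin N) := Finset.univ.filter fun i => 0 < X.D i

/-- `Uᵢ = aᵢ s^{Dᵢ}`. -/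
def U (i : Fin N) (s : ℂ) : ℂ := a i * s ^ X.D i

/-- `dᵢ(β) = Dᵢ β - qᵢ / 2`. -/
def deg (i : Fin N) (β : ℚ) : ℚ := X.D i * β - X.r i

/-- The effective degrees: those for which a quasimap to the phase `X₊`, constant up to the
`ℂ^*_q`-action, exists, i.e. `dₖ(β) ∈ ℤ_{≥ 0}` for some coordinate `k` of `V₊`.
(If the R-charges of `V₊` are zero, this is the union of the sets `ℤ_{≥ 0} / Dₖ`.) -/
def Eff : Set ℚ := {β | ∃ k ∈ X.pos, ∃ n : ℕ, X.deg k β = n}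

/-! ### Sectors of the inertia stack

A twisted sector is given by `v ∈ ℚ ∩ [0, 1)`, with group element `g(v) = exp (2πi v) ∈ G`, so
that `v = log g(v) / 2πi`. The sector of a degree `β` is the fractional part of `β`. -/

/-- The age of the character `s^m` in the sector `v`: `g(v)^m = exp (2πi age)`, `0 ≤ age < 1`. -/
def age (v : ℚ) (m : ℤ) : ℚ := Int.fract (m * v)

/-- The coordinates of `V₊` that are fixed by `g(v)`. -/
def posFixed (v : ℚ) : Finset (Fin N) := X.pos.filter fun i => age v (X.D i) = 0

/-- The Euler characteristic of the sector `v` of the inertia stack of `X₊`, by localization at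
the torus fixed points. The fixed points of the sector are `[pt / μ_{Dₖ}]` for `k` in
`posFixed v`; the spectrum of `K([pt / μ_{Dₖ}])` is the set of roots of `s^{Dₖ} = aₖ⁻¹`, and the
invariants under `μ_{Dₖ}` are the average over this set. A class is given by its values on the
spectrum. -/
def eulerChar (v : ℚ) (F : ℂ → ℂ) : ℂ :=
  ∑ k ∈ X.posFixed v, (1 / (X.D k : ℂ)) *
    ∑ s ∈ Polynomial.nthRootsFinset (X.D k).toNat (a k)⁻¹,
      F s / ∏ j ∈ (X.posFixed v).erase k, (1 - (X.U a j s)⁻¹)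

/-! ### The level `V₊^∨` I-function, the Gamma class and the H-function -/

/-- The level contribution `(-1)^σ det(V₊^∨)` in degree `β`: the determinant of
`∑_{i ∈ V₊} Uᵢ⁻¹ χ(ℙ¹, 𝒪(dᵢ(β)))`. As everywhere, the dual inverts the characters of `T × G` and
keeps the loop variable `q`. -/
def levelDet (β : ℚ) (s : ℂ) : ℂ :=
  (-1 : ℂ) ^ (∑ i ∈ X.pos, ⌊X.deg i β⌋) * ∏ i ∈ X.pos, detChi τ (X.U a i s)⁻¹ (X.deg i β)

/-- The degree `β` term of the level `V₊^∨` K-theoretic I-function, a meromorphic function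
of `s`. -/
def ITerm (z : ℂ) (β : ℚ) (s : ℂ) : ℂ :=
  kahlerFactor τ z (qpow τ (Int.fract β) * s) * z ^ ⌊β⌋ * X.levelDet τ a β s *
    ∏ i, qphi τ ((X.U a i s)⁻¹ * qpow τ (Int.fract (-X.deg i β))) /
      qphi τ ((X.U a i s)⁻¹ * qpow τ (-X.deg i β))

/-- The component in the sector `v` of the level `V₊^∨` K-theoretic Gamma class, a meromorphic
function of `s`. The level part is normalized by the level contribution of the degree
`v = log g(v) / 2πi` in `[0, 1)`. -/
def gammaClass (v : ℚ) (s : ℂ) : ℂ :=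
  (X.levelDet τ a v s)⁻¹ *
    ((∏ i ∈ X.posFixed v, (1 - (X.U a i s)⁻¹)) /
      ∏ i, qphi τ ((X.U a i s)⁻¹ * qpow τ (age v (-X.D i))))

/-- The degree `β` term of the level `V₊^∨` H-function `ℋ = I · Γ̂`, a class in the sector of `β`;
`s` is a point of the spectrum of its K-theory. The product `I · Γ̂` is a meromorphic function with
a removable singularity there, and its value is the limit. -/
def HTerm (z : ℂ) (β : ℚ) (s : ℂ) : ℂ :=
  limUnder (𝓝[≠] s) fun t => X.ITerm τ a z β t * X.gammaClass τ a (Int.fract β) t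

/-! ### Elliptic classes and central charges -/

/-- The elliptic cohomology `Ell_T(X₊) = {∏_{i ∈ V₊} θ(Uᵢ⁻¹) = 0}` over the point `a`, as a
`q`-periodic subset of `G = ℂˣ`. -/
def ellLocus : Set ℂ := {s | s ≠ 0 ∧ ∏ i ∈ X.pos, qtheta τ (X.U a i s)⁻¹ = 0}

/-- An elliptic class: a function on the finite set `Ell_T(X₊) ⊆ ℂˣ / q^ℤ` over `a`. -/
def IsEllClass (E : ℂ → ℂ) : Prop := ∀ s ∈ X.ellLocus τ a, E (nomeQ τ * s) = E s

/-- The component in the sector `v` of the orbifold elliptic Chern character. -/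
def chOrb (E : ℂ → ℂ) (v : ℚ) (s : ℂ) : ℂ := E (qpow τ v * s)

/-- The degree `β` term of the elliptic central charge, `χ(ℋ_β ⊗ ch_orb(E))`. -/
def chargeTerm (E : ℂ → ℂ) (z : ℂ) (β : ℚ) : ℂ :=
  X.eulerChar a (Int.fract β) fun s => X.HTerm τ a z β s * chOrb τ E (Int.fract β) s

/-- Convergence of the level `V₊^∨` elliptic central charge. -/
def ChargeConverges (E : ℂ → ℂ) (z : ℂ) : Prop :=
  Summable fun β : X.Eff => X.chargeTerm τ a E z β

/-- The level `V₊^∨` elliptic central charge `Z(E, V₊^∨) = χ(ℋ ⊗ ch_orb(E))`. -/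
def centralCharge (E : ℂ → ℂ) (z : ℂ) : ℂ := ∑' β : X.Eff, X.chargeTerm τ a E z β

/-- The part of the central charge in degrees less than `B`, a finite sum. -/
def partialCharge (E : ℂ → ℂ) (B : ℚ) (z : ℂ) : ℂ :=
  ∑ᶠ β ∈ {β : ℚ | β ∈ X.Eff ∧ β < B}, X.chargeTerm τ a E z β

/-! ### The interpolation problem -/

/-- The standard meromorphic section, in the coordinate `s` of `G`, of the line bundle
`𝓛 = 𝓤 ⊗ Θ(V₊)`: the section `θ(s z⁻¹) / (θ(s) θ(z⁻¹))` of the Poincaré bundle times the elliptic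
Euler class of `V₊`. -/
def refSection (z s : ℂ) : ℂ :=
  qtheta τ (s * z⁻¹) / (qtheta τ s * qtheta τ z⁻¹) *
    ∏ i ∈ X.pos, qtheta τ ((X.U a i s)⁻¹ * qpow τ (X.r i))

/-- Holomorphic sections of `𝓛` over `E_G`: holomorphic functions on `ℂˣ` with the
quasi-periodicity of `refSection`. -/
structure IsSection (z : ℂ) (F : ℂ → ℂ) : Prop where
  holo : DifferentiableOn ℂ F {0}ᶜ
  quasi : ∀ s : ℂ, s ≠ 0 →
    F (nomeQ τ * s) * X.refSection τ a z s = X.refSection τ a z (nomeQ τ * s) * F s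

/-- The representatives in `ℂˣ` of the points of `Ell_T(X₊)` over `a`: the point given by a sector
`v` and a point `s₀` of the spectrum of the K-theory of a fixed point in this sector is represented
by `q^v s₀`, with `0 ≤ v < 1`. -/
def lifts : Set ℂ :=
  {s | ∃ v : ℚ, 0 ≤ v ∧ v < 1 ∧ ∃ k ∈ X.posFixed v, ∃ s₀ : ℂ,
    s₀ ^ X.D k = (a k)⁻¹ ∧ s = qpow τ v * s₀}

/-- `F` is an interpolation of `E · θ(z⁻¹) / θ(s⁻¹ z⁻¹)` from `Ell_T(X₊)` to `E_G`. -/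
structure IsInterpolation (E : ℂ → ℂ) (z : ℂ) (F : ℂ → ℂ) : Prop where
  isSection : X.IsSection τ a z F
  interp : ∀ s ∈ X.lifts τ a, F s = E s * kahlerFactor τ z s

/-! ### The solid torus partition function -/

/-- `Γ_q = 1 / ∏ᵢ φ(aᵢ⁻¹ s^{-Dᵢ} q^{qᵢ/2})`. -/
def gammaQ (s : ℂ) : ℂ := 1 / ∏ i, qphi τ ((X.U a i s)⁻¹ * qpow τ (X.r i))

/-- `(1 / 2πi) ∮_{|s| = δ} (ds / s) Γ_q · F`. -/
def contourIntegral (δ : ℝ) (F : ℂ → ℂ) : ℂ :=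
  (2 * Real.pi * Complex.I)⁻¹ * ∮ s in C(0, δ), s⁻¹ * (X.gammaQ τ a s * F s)

/-- `tr(Γ_q ⊗ F)`: the integral over the maximal compact subgroup of `G`, shifted to radius `δ`,
for the Haar measure of total mass one. -/
def torusTrace (δ : ℝ) (F : ℂ → ℂ) : ℂ :=
  ∫ u : UnitAddCircle, X.gammaQ τ a (δ * (AddCircle.toCircle u : ℂ)) *
    F (δ * (AddCircle.toCircle u : ℂ)) ∂AddCircle.haarAddCircle

/-- The circle of radius `δ` separates the poles of `1 / φ(V₊^∨)` from those of `1 / φ(V₋^∨)`. -/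
def Separates (δ : ℝ) : Prop :=
  ∀ (i : Fin N) (s : ℂ), s ≠ 0 → qphi τ ((X.U a i s)⁻¹ * qpow τ (X.r i)) = 0 →
    (0 < X.D i → ‖s‖ < δ) ∧ (X.D i < 0 → δ < ‖s‖)

/-! ### Genericity -/

/-- Generic equivariant parameters: the divisor `θ(Uₖ⁻¹) = 0` of a coordinate of `V₊` does not
meet, over `a`, the divisor of another coordinate of `V`. -/
def GenericParam : Prop :=
  (∀ i, a i ≠ 0) ∧ ∀ k j : Fin N, 0 < X.D k → j ≠ k → ∀ s : ℂ, s ≠ 0 →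
    ¬ (qtheta τ (X.U a k s)⁻¹ = 0 ∧ qtheta τ (X.U a j s)⁻¹ = 0)

/-- Generic Kähler variable: the Poincaré bundle is nontrivial at `z`, and `z` is not a pole of
`θ(z⁻¹) / θ(s⁻¹ z⁻¹)` for `s` in `Ell_T(X₊)`. -/
def GenericKahler (z : ℂ) : Prop :=
  z ≠ 0 ∧ (∀ n : ℤ, z ≠ nomeQ τ ^ n) ∧ ∀ s ∈ X.ellLocus τ a, z ≠ s⁻¹

/-- The generic `z` whose relative distance to the poles of `θ(z⁻¹) / θ(s⁻¹ z⁻¹)`, `s` in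
`Ell_T(X₊)`, is at least `ε`. -/
def awayFromPoles (ε : ℝ) : Set ℂ :=
  {z | X.GenericKahler τ a z ∧ ∀ s ∈ X.ellLocus τ a, ε * ‖z‖ ≤ ‖z - s⁻¹‖}

end GLSMData

end

/-!
The sections of `𝓛` are interpolated by the method of Lagrange. The elliptic Euler class
`thetaPos = ∏_{i ∈ V₊} θ(Uᵢ⁻¹ q^{rᵢ})` of `V₊` has simple zeros, by genericity of the equivariant
parameters, and modulo `q ^ ℤ` they are the lifts `p` of the torus fixed points of the inertia stack
of `X₊`. Its product with the Kronecker function `θ(s / (p z)) / (θ(s / p) θ(1 / z))`, which has a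
simple pole at `p`, is a section of `𝓛` that vanishes at all the lifts but `p` (`elemSection`). The
interpolation is a combination of these sections. It is unique because the difference of two
interpolations, divided by `thetaPos`, is a section of the line bundle of degree zero with
multiplier `z ∉ q ^ ℤ`, and the residue theorem in a fundamental annulus shows that such a section
is zero (`eq_zero_of_nomeQ_mul_eq`).

The product of `gammaQ` and `elemSection` is a Kronecker function times a function `gammaTheta` that
is holomorphic in the disc `|s| ≤ δ`, the origin included. Hence its poles in this disc are among
the points `q ^ n p`, and they are simple. The residue at `q ^ n p` is the contribution of the fixed
point to the central charge in the degree `n + v`, where `v` is its sector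
(`chargeSummand_eq_residue`): the level contribution and `thetaPos` have the same factor of
automorphy (`levelDet_add_mul_thetaPos`), so that the I-function times the Gamma class is the
integrand with `s` replaced by `q ^ (n + v) s`, up to the Koszul factor, which cancels the pole, and
the normalization of the interpolation. Shrinking the contour to a circle between two consecutive
points `q ^ n p` therefore expresses the difference of the contour integral and a truncation of the
central charge by integrals over small circles (`contourIntegral_sub_partialCharge`).

On a circle of radius at most `|q| ^ M` the Kronecker function is `O(|z| ^ M)`, relative to the
coefficients of the interpolation (`exists_norm_qtheta_mul_div_le`). This is the asymptotic
expansion. If the series converges, the integrals over the small circles of radius `|q| ^ m ρ` tend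
to a limit as `m → ∞`. By the quasiperiodicity of the Kronecker function and the Taylor expansion of
`gammaTheta` at the origin they are also asymptotic to a sum of geometric progressions with the
ratios `z q ^ j` (`tendsto_remainder_sub_geometric`). None of these ratios is one, so the limit is
zero (`eq_zero_of_tendsto_of_sub_geometric`).
-/

noncomputable section

/-! ### Powers of the nome and theta functions -/

theorem qpow_ne_zero (τ : ℂ) (x : ℚ) : qpow τ x ≠ 0 := Complex.exp_ne_zero _

theorem qpow_add (τ : ℂ) (x y : ℚ) : qpow τ (x + y) = qpow τ x * qpow τ y := by
  simp only [qpow, ← Complex.exp_add]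
  congr 1
  push_cast
  ring

theorem qpow_zero (τ : ℂ) : qpow τ 0 = 1 := by simp [qpow]

theorem qpow_neg (τ : ℂ) (x : ℚ) : qpow τ (-x) = (qpow τ x)⁻¹ := by
  refine eq_inv_of_mul_eq_one_left ?_
  rw [← qpow_add, neg_add_cancel, qpow_zero]

theorem qpow_sub (τ : ℂ) (x y : ℚ) : qpow τ (x - y) = qpow τ x / qpow τ y := by
  rw [sub_eq_add_neg, qpow_add, qpow_neg, div_eq_mul_inv]

theorem qpow_intCast_mul (τ : ℂ) (n : ℤ) (x : ℚ) : qpow τ (n * x) = qpow τ x ^ n := by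
  simp only [qpow, ← Complex.exp_int_mul]
  congr 1
  push_cast
  ring

theorem qpow_intCast (τ : ℂ) (n : ℤ) : qpow τ n = nomeQ τ ^ n := by
  rw [nomeQ, ← qpow_intCast_mul, mul_one]

theorem nomeQ_ne_zero (τ : ℂ) : nomeQ τ ≠ 0 := qpow_ne_zero τ 1

theorem norm_qpow (τ : ℂ) (x : ℚ) : ‖qpow τ x‖ = Real.exp (-(2 * Real.pi * τ.im * x)) := by
  rw [qpow, Complex.norm_exp]
  congr 1
  simp

theorem norm_nomeQ_pos (τ : ℂ) : 0 < ‖nomeQ τ‖ := norm_pos_iff.2 (nomeQ_ne_zero τ)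

theorem norm_nomeQ_lt_one {τ : ℂ} (hτ : 0 < τ.im) : ‖nomeQ τ‖ < 1 := by
  rw [nomeQ, norm_qpow, Real.exp_lt_one_iff]
  have := Real.pi_pos
  simp only [Rat.cast_one, mul_one, Left.neg_neg_iff]
  positivity

theorem nomeQ_zpow_injective {τ : ℂ} (hτ : 0 < τ.im) :
    Function.Injective fun n : ℤ => nomeQ τ ^ n := by
  intro m n h
  have h' : ‖nomeQ τ‖ ^ m = ‖nomeQ τ‖ ^ n := by
    simpa only [norm_zpow] using congrArg norm h
  exact zpow_right_injective₀ (norm_nomeQ_pos τ) (norm_nomeQ_lt_one hτ).ne h'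

theorem summable_norm_nomeQ_pow_mul {τ : ℂ} (hτ : 0 < τ.im) (x : ℂ) :
    Summable fun k : ℕ => ‖-(nomeQ τ ^ k * x)‖ := by
  simp only [norm_neg, norm_mul, norm_pow]
  exact (summable_geometric_of_lt_one (norm_nonneg _) (norm_nomeQ_lt_one hτ)).mul_right _

theorem multipliable_qphi {τ : ℂ} (hτ : 0 < τ.im) (x : ℂ) :
    Multipliable fun k : ℕ => 1 - nomeQ τ ^ k * x := by
  simpa only [sub_eq_add_neg] using
    multipliable_one_add_of_summable (summable_norm_nomeQ_pow_mul hτ x)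

theorem differentiable_qphi {τ : ℂ} (hτ : 0 < τ.im) : Differentiable ℂ (qphi τ) := by
  intro x
  have hx : x ∈ Metric.ball (0 : ℂ) (‖x‖ + 1) := by simp
  have hU : Summable fun k : ℕ => ‖nomeQ τ‖ ^ k * (‖x‖ + 1) :=
    (summable_geometric_of_lt_one (norm_nonneg _) (norm_nomeQ_lt_one hτ)).mul_right _
  have h := hU.hasProdLocallyUniformlyOn_nat_one_add (f := fun k y => -(nomeQ τ ^ k * y))
    (K := Metric.ball (0 : ℂ) (‖x‖ + 1)) Metric.isOpen_ball
    (.of_forall fun k y hy => by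
      rw [norm_neg, norm_mul, norm_pow]
      gcongr
      simpa using (mem_ball_zero_iff.1 hy).le) (fun k => by fun_prop)
  have h2 := h.differentiableOn (.of_forall fun s => by
    simpa [Finset.prod_fn] using DifferentiableOn.finsetProd (fun _ _ => by fun_prop))
    Metric.isOpen_ball
  have h3 := h2.differentiableAt (Metric.isOpen_ball.mem_nhds hx)
  simp only [← sub_eq_add_neg] at h3
  exact h3

theorem qphi_eq_mul {τ : ℂ} (hτ : 0 < τ.im) (x : ℂ) :
    qphi τ x = (1 - x) * qphi τ (nomeQ τ * x) := by
  have h := tprod_eq_zero_mul' (f := fun k : ℕ => 1 - nomeQ τ ^ k * x)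
    (by simpa only [pow_succ, mul_assoc] using multipliable_qphi hτ (nomeQ τ * x))
  simpa only [qphi, pow_zero, one_mul, pow_succ, mul_assoc] using h

theorem qphi_ne_zero {τ : ℂ} (hτ : 0 < τ.im) {x : ℂ} (hx : ∀ n : ℕ, nomeQ τ ^ n * x ≠ 1) :
    qphi τ x ≠ 0 := by
  have h := tprod_one_add_ne_zero_of_summable (f := fun k : ℕ => -(nomeQ τ ^ k * x))
    (fun k => by
      rw [← sub_eq_add_neg]
      exact sub_ne_zero.2 (hx k).symm) (summable_norm_nomeQ_pow_mul hτ x)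
  simp only [← sub_eq_add_neg] at h
  exact h

theorem qphi_eq_zero_iff {τ : ℂ} (hτ : 0 < τ.im) {x : ℂ} :
    qphi τ x = 0 ↔ ∃ n : ℕ, nomeQ τ ^ n * x = 1 := by
  refine ⟨fun h => by_contra fun hn => qphi_ne_zero hτ (by simpa using hn) h, ?_⟩
  rintro ⟨n, hn⟩
  induction n generalizing x with
  | zero => rw [qphi_eq_mul hτ, show x = 1 by simpa using hn]; simp
  | succ n ih => rw [qphi_eq_mul hτ, ih (by rw [← hn]; ring), mul_zero]

theorem qphi_zero {τ : ℂ} : qphi τ 0 = 1 := by simp [qphi]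

theorem qphi_nomeQ_zpow_eq_zero_iff {τ : ℂ} (hτ : 0 < τ.im) {n : ℤ} :
    qphi τ (nomeQ τ ^ n) = 0 ↔ n ≤ 0 := by
  rw [qphi_eq_zero_iff hτ]
  have key : ∀ m : ℕ, nomeQ τ ^ m * nomeQ τ ^ n = 1 ↔ (m : ℤ) + n = 0 := fun m => by
    rw [← zpow_natCast, ← zpow_add₀ (nomeQ_ne_zero τ)]
    exact ⟨fun h => nomeQ_zpow_injective hτ (by simpa using h), fun h => by rw [h, zpow_zero]⟩
  simp only [key]
  exact ⟨fun ⟨m, hm⟩ => by omega, fun h => ⟨(-n).toNat, by omega⟩⟩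

theorem qtheta_eq_zero_iff {τ : ℂ} (hτ : 0 < τ.im) {x : ℂ} (hx : x ≠ 0) :
    qtheta τ x = 0 ↔ ∃ n : ℤ, x = nomeQ τ ^ n := by
  have hq := nomeQ_ne_zero τ
  rw [qtheta, mul_eq_zero, qphi_eq_zero_iff hτ, qphi_eq_zero_iff hτ]
  constructor
  · rintro (⟨n, hn⟩ | ⟨n, hn⟩)
    · refine ⟨-n, ?_⟩
      rw [zpow_neg, zpow_natCast]
      exact eq_inv_of_mul_eq_one_right hn
    · refine ⟨n + 1, ?_⟩
      rw [zpow_add₀ hq, zpow_natCast, zpow_one]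
      field_simp at hn
      linear_combination -hn
  · rintro ⟨n, rfl⟩
    rcases le_or_gt n 0 with h | h
    · left
      refine ⟨(-n).toNat, ?_⟩
      rw [← zpow_natCast, ← zpow_add₀ hq, Int.toNat_of_nonneg (by omega)]
      simp
    · right
      refine ⟨(n - 1).toNat, ?_⟩
      rw [← zpow_natCast, Int.toNat_of_nonneg (by omega), zpow_sub₀ hq]
      field_simp

theorem qtheta_nomeQ_mul {τ : ℂ} (hτ : 0 < τ.im) {x : ℂ} (hx : x ≠ 0) :
    qtheta τ (nomeQ τ * x) = -x⁻¹ * qtheta τ x := by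
  have hq := nomeQ_ne_zero τ
  have h1 : nomeQ τ / (nomeQ τ * x) = 1 / x := by field_simp
  rw [qtheta, qtheta, h1, qphi_eq_mul hτ x, qphi_eq_mul hτ (1 / x), mul_one_div]
  field_simp
  ring

theorem qtheta_div_nomeQ {τ : ℂ} (hτ : 0 < τ.im) {x : ℂ} (hx : x ≠ 0) :
    qtheta τ (x / nomeQ τ) = -(x / nomeQ τ) * qtheta τ x := by
  have hq := nomeQ_ne_zero τ
  have h := qtheta_nomeQ_mul hτ (div_ne_zero hx hq)
  rw [mul_div_cancel₀ _ hq] at h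
  rw [h]
  field_simp

/-- The factor of automorphy of `θ` for the translation by `n` periods. Only the exponent of `x`
matters, so the constant is left implicit. -/
theorem exists_qtheta_zpow_mul {τ : ℂ} (hτ : 0 < τ.im) (n : ℤ) :
    ∃ c : ℂ, c ≠ 0 ∧ ∀ x : ℂ, x ≠ 0 → qtheta τ (nomeQ τ ^ n * x) = c * x ^ (-n) * qtheta τ x := by
  have hq := nomeQ_ne_zero τ
  induction n using Int.induction_on with
  | zero => exact ⟨1, one_ne_zero, fun x _ => by simp⟩
  | succ n ih =>
    obtain ⟨c, hc, h⟩ := ih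
    refine ⟨-c * (nomeQ τ ^ (n : ℤ))⁻¹, by simp [hc, hq], fun x hx => ?_⟩
    rw [zpow_add_one₀ hq, mul_comm _ (nomeQ τ), mul_assoc,
      qtheta_nomeQ_mul hτ (mul_ne_zero (zpow_ne_zero _ hq) hx), h x hx, neg_add, zpow_add₀ hx]
    field_simp
  | pred n ih =>
    obtain ⟨c, hc, h⟩ := ih
    refine ⟨-c * nomeQ τ ^ (-(n : ℤ) - 1), by simp [hc, hq, zpow_ne_zero], fun x hx => ?_⟩
    rw [zpow_sub_one₀ hq, mul_right_comm, ← div_eq_mul_inv,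
      qtheta_div_nomeQ hτ (mul_ne_zero (zpow_ne_zero _ hq) hx), h x hx, neg_sub, sub_neg_eq_add,
      add_comm, zpow_add₀ hx, neg_neg, zpow_one]
    field_simp

theorem differentiableAt_qtheta {τ : ℂ} (hτ : 0 < τ.im) {x : ℂ} (hx : x ≠ 0) :
    DifferentiableAt ℂ (qtheta τ) x := by
  have h := differentiable_qphi hτ
  unfold qtheta
  exact (h x).mul ((h _).comp x ((differentiableAt_const _).div differentiableAt_id hx))

theorem qphi_nomeQ_ne_zero {τ : ℂ} (hτ : 0 < τ.im) : qphi τ (nomeQ τ) ≠ 0 := by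
  have h := (qphi_nomeQ_zpow_eq_zero_iff hτ (n := 1)).not.2 (by norm_num)
  simpa using h

/-- The derivative at the zero `x = 1` is read off from `θ(x) = (1 - x) φ(q x) φ(q / x)`. -/
theorem hasDerivAt_qtheta_one {τ : ℂ} (hτ : 0 < τ.im) :
    HasDerivAt (qtheta τ) (-(qphi τ (nomeQ τ)) ^ 2) 1 := by
  have hg : DifferentiableAt ℂ (fun x : ℂ => qphi τ (nomeQ τ * x) * qphi τ (nomeQ τ / x)) 1 := by
    have h := differentiable_qphi hτ
    exact ((h _).comp (1 : ℂ) (by fun_prop)).mul ((h _).comp (1 : ℂ)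
      ((differentiableAt_const _).div differentiableAt_id one_ne_zero))
  have h1 : HasDerivAt (fun x : ℂ => 1 - x) (-1) 1 := by
    simpa using (hasDerivAt_id (1 : ℂ)).const_sub 1
  have h := h1.mul hg.hasDerivAt
  refine (h.congr_deriv ?_).congr_of_eventuallyEq (.of_forall fun x => ?_)
  · simp; ring
  · simp only [qtheta, Pi.mul_apply]
    rw [qphi_eq_mul hτ x]
    ring

/-- The zeros of `θ` are simple. -/
theorem deriv_qtheta_ne_zero {τ : ℂ} (hτ : 0 < τ.im) {x : ℂ} (hx : x ≠ 0) (h0 : qtheta τ x = 0) :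
    deriv (qtheta τ) x ≠ 0 := by
  obtain ⟨n, rfl⟩ := (qtheta_eq_zero_iff hτ hx).1 h0
  intro hd
  have h1 : HasDerivAt (qtheta τ) 0 (nomeQ τ ^ n) :=
    hd ▸ (differentiableAt_qtheta hτ hx).hasDerivAt
  -- transport along `x ↦ q ^ n x` to the zero at `1`
  have h2 : HasDerivAt (fun y => qtheta τ (nomeQ τ ^ n * y)) 0 1 := by
    have := HasDerivAt.comp (1 : ℂ) (h₂ := qtheta τ) (h := fun y => nomeQ τ ^ n * y)
      (by simpa using h1) (((hasDerivAt_id (1 : ℂ)).const_mul (nomeQ τ ^ n)))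
    simpa [Function.comp_def] using this
  obtain ⟨c, hc, h⟩ := exists_qtheta_zpow_mul hτ n
  have h3 : HasDerivAt (fun y => c * y ^ (-n) * qtheta τ y) (c * -(qphi τ (nomeQ τ)) ^ 2) 1 := by
    have hz : DifferentiableAt ℂ (fun y : ℂ => c * y ^ (-n)) 1 :=
      (differentiableAt_zpow.2 (Or.inl one_ne_zero)).const_mul c
    have := hz.hasDerivAt.mul (hasDerivAt_qtheta_one hτ)
    have h0 : qtheta τ 1 = 0 := (qtheta_eq_zero_iff hτ one_ne_zero).2 ⟨0, by simp⟩
    refine this.congr_deriv ?_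
    rw [h0]
    simp
  have h4 : HasDerivAt (fun y => qtheta τ (nomeQ τ ^ n * y)) (c * -(qphi τ (nomeQ τ)) ^ 2) 1 :=
    h3.congr_of_eventuallyEq ((eventually_ne_nhds one_ne_zero).mono fun y hy => h y hy)
  have := h2.unique h4
  simp [hc, qphi_nomeQ_ne_zero hτ] at this

theorem qphi_ne_zero_of_qtheta_ne_zero {τ x : ℂ} (h : qtheta τ x ≠ 0) : qphi τ x ≠ 0 :=
  left_ne_zero_of_mul h

/-! ### Zeros, division and residues of functions of one complex variable -/

theorem eventually_ne_zero_of_simple_zero {g : ℂ → ℂ} {x : ℂ} (hg : DifferentiableAt ℂ g x)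
    (h : g x = 0 → deriv g x ≠ 0) : ∀ᶠ t in 𝓝[≠] x, g t ≠ 0 := by
  by_cases h0 : g x = 0
  · exact hg.hasDerivAt.eventually_ne (h h0)
  · exact (hg.continuousAt.eventually_ne h0).filter_mono nhdsWithin_le_nhds

/-- If exactly one factor of a product vanishes at `x`, to first order, so does the product. -/
theorem deriv_prod_ne_zero {ι : Type*} [DecidableEq ι] {s : Finset ι} {g : ι → ℂ → ℂ} {x : ℂ}
    {k : ι} (hk : k ∈ s) (hd : ∀ i ∈ s, DifferentiableAt ℂ (g i) x) (h0 : g k x = 0)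
    (h1 : deriv (g k) x ≠ 0) (h2 : ∀ i ∈ s, i ≠ k → g i x ≠ 0) :
    deriv (fun t => ∏ i ∈ s, g i t) x ≠ 0 := by
  have he : DifferentiableAt ℂ (fun t => ∏ i ∈ s.erase k, g i t) x :=
    DifferentiableAt.fun_finsetProd fun i hi => hd i (Finset.mem_of_mem_erase hi)
  have hfun : (fun t => ∏ i ∈ s, g i t) = fun t => g k t * ∏ i ∈ s.erase k, g i t :=
    funext fun t => (Finset.mul_prod_erase s (fun i => g i t) hk).symm
  rw [hfun, ((hd k hk).hasDerivAt.fun_mul he.hasDerivAt).deriv, h0, zero_mul, add_zero]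
  exact mul_ne_zero h1 (Finset.prod_ne_zero_iff.2 fun i hi =>
    h2 i (Finset.mem_of_mem_erase hi) (Finset.ne_of_mem_erase hi))

/-- A holomorphic function that vanishes at the zeros of another one, all of them simple, is
divisible by it. -/
theorem exists_differentiableOn_mul_eq {U : Set ℂ} (hU : IsOpen U) {f g : ℂ → ℂ}
    (hf : DifferentiableOn ℂ f U) (hg : DifferentiableOn ℂ g U)
    (h : ∀ x ∈ U, g x = 0 → f x = 0 ∧ deriv g x ≠ 0) :
    ∃ W : ℂ → ℂ, DifferentiableOn ℂ W U ∧ ∀ x ∈ U, W x * g x = f x := by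
  classical
  refine ⟨fun x => if g x = 0 then deriv f x / deriv g x else f x / g x, fun x hx => ?_,
    fun x hx => ?_⟩
  · have hUx := hU.mem_nhds hx
    by_cases h0 : g x = 0
    · have hdf := ((Complex.differentiableOn_dslope hUx).2 hf).differentiableAt hUx
      have hdg := ((Complex.differentiableOn_dslope hUx).2 hg).differentiableAt hUx
      have hne : dslope g x x ≠ 0 := by rw [dslope_same]; exact (h x hx h0).2
      refine (((hdf.div hdg hne).congr_of_eventuallyEq ?_)).differentiableWithinAt
      have hev : ∀ᶠ t in 𝓝 x, t ≠ x → g t ≠ 0 := eventually_nhdsWithin_iff.1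
        (eventually_ne_zero_of_simple_zero (hg.differentiableAt hUx) fun _ => (h x hx h0).2)
      filter_upwards [hev] with t ht
      by_cases htx : t = x
      · subst htx
        simp [h0, dslope_same]
      · have h1 : (t - x) * dslope f x t = f t := by
          simpa [(h x hx h0).1] using sub_smul_dslope f x t
        have h2 : (t - x) * dslope g x t = g t := by
          simpa [h0] using sub_smul_dslope g x t
        rw [if_neg (ht htx), ← h1, ← h2, Pi.div_apply,
          mul_div_mul_left _ _ (sub_ne_zero.2 htx)]
    · have hdf := hf.differentiableAt hUx
      have hdg := hg.differentiableAt hUx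
      refine (((hdf.div hdg h0).congr_of_eventuallyEq ?_)).differentiableWithinAt
      filter_upwards [hdg.continuousAt.eventually_ne h0] with t ht
      simp [ht]
  · by_cases h0 : g x = 0
    · simp [h0, (h x hx h0).1]
    · simp [h0]

theorem circleIntegral_sub_inv_of_lt_norm {r : ℝ} (hr : 0 ≤ r) {p : ℂ} (hp : r < ‖p‖) :
    (∮ s in C(0, r), (s - p)⁻¹) = 0 := by
  refine Complex.circleIntegral_eq_zero_of_differentiable_on_off_countable hr
    Set.countable_empty ?_ ?_
  · intro s hs
    refine ((continuousAt_id.sub continuousAt_const).inv₀ (sub_ne_zero.2 ?_)).continuousWithinAt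
    rintro rfl
    exact absurd (mem_closedBall_zero_iff.1 hs) (not_le.2 hp)
  · intro s hs
    refine (differentiableAt_id.sub_const _).inv (sub_ne_zero.2 ?_)
    rintro rfl
    exact absurd (mem_ball_zero_iff.1 hs.1) (not_lt.2 hp.le)

/-- The residue theorem in an annulus, for simple poles. -/
theorem circleIntegral_sub_circleIntegral_eq_sum {r R : ℝ} (hr : 0 < r) (hrR : r ≤ R)
    (S : Finset ℂ) (c : ℂ → ℂ) (f : ℂ → ℂ) (hS : ∀ p ∈ S, r < ‖p‖ ∧ ‖p‖ < R)
    (hd : ∀ s : ℂ, r ≤ ‖s‖ → ‖s‖ ≤ R → s ∉ S → DifferentiableAt ℂ f s)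
    (hc : ∀ p ∈ S, Tendsto (fun s => (s - p) * f s) (𝓝[≠] p) (𝓝 (c p))) :
    (∮ s in C(0, R), f s) - (∮ s in C(0, r), f s) = 2 * Real.pi * Complex.I * ∑ p ∈ S, c p := by
  classical
  induction S using Finset.induction_on generalizing f with
  | empty =>
    simp only [Finset.sum_empty, mul_zero]
    rw [sub_eq_zero]
    refine Complex.circleIntegral_eq_of_differentiable_on_annulus_off_countable hr hrR
      Set.countable_empty (fun s hs => ?_) (fun s hs => ?_)
    · simp only [Set.mem_sdiff, mem_closedBall_zero_iff, mem_ball_zero_iff, not_lt] at hs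
      exact (hd s hs.2 hs.1 (by simp)).continuousAt.continuousWithinAt
    · simp only [Set.mem_sdiff, mem_closedBall_zero_iff, mem_ball_zero_iff, not_le] at hs
      exact hd s hs.1.2.le hs.1.1.le (by simp)
  | insert p S hp ih =>
    obtain ⟨hp1, hp2⟩ := hS p (Finset.mem_insert_self _ _)
    -- subtract the principal part at `p` and remove the singularity
    set g : ℂ → ℂ := fun s => f s - c p * (s - p)⁻¹ with hg
    set F : ℂ → ℂ := Function.update g p (limUnder (𝓝[≠] p) g) with hF
    have hFg : ∀ s, s ≠ p → F =ᶠ[𝓝 s] g := fun s hs =>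
      (eventually_ne_nhds hs).mono fun t ht => Function.update_of_ne ht _ _
    have hinv : ∀ s, s ≠ p → DifferentiableAt ℂ (fun s => c p * (s - p)⁻¹) s := fun s hs =>
      (DifferentiableAt.fun_inv (h := fun s => s - p) (by fun_prop) (sub_ne_zero.2 hs)).const_mul _
    -- near `p` the function `f` is holomorphic: the annulus is open there and `S` is finite
    have hev : ∀ᶠ s in 𝓝 p, r ≤ ‖s‖ ∧ ‖s‖ ≤ R ∧ s ∉ S := by
      have h1 := continuous_norm.continuousAt.eventually (lt_mem_nhds hp1)
      have h2 := continuous_norm.continuousAt.eventually (gt_mem_nhds hp2)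
      have h3 : ∀ᶠ s in 𝓝 p, s ∉ S :=
        (S.finite_toSet.isClosed.isOpen_compl.mem_nhds (by simpa using hp) :)
      filter_upwards [h1, h2, h3] with s a b d using ⟨a.le, b.le, d⟩
    have hFp : DifferentiableAt ℂ F p := by
      refine (Complex.differentiableOn_update_limUnder_of_isLittleO hev
        (fun s hs => ?_) ?_).differentiableAt hev
      · have hsp : s ≠ p := hs.2
        refine DifferentiableAt.differentiableWithinAt ?_
        exact (hd s hs.1.1 hs.1.2.1 (by simp [hsp, hs.1.2.2])).sub (hinv s hsp)
      · rw [Asymptotics.isLittleO_iff_tendsto']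
        · have h1 := hc p (Finset.mem_insert_self _ _)
          have h2 : Tendsto (fun s => (s - p) * f s - c p - (s - p) * g p) (𝓝[≠] p)
              (𝓝 (c p - c p - (p - p) * g p)) := by
            refine (h1.sub_const _).sub (Tendsto.mul_const _ ?_)
            exact tendsto_nhdsWithin_of_tendsto_nhds (tendsto_id.sub_const p)
          simp only [sub_self, zero_mul] at h2
          refine h2.congr' (eventually_mem_nhdsWithin.mono fun s hs => ?_)
          have hsp : s - p ≠ 0 := sub_ne_zero.2 hs
          simp only [div_inv_eq_mul, hg]
          field_simp
        · refine eventually_mem_nhdsWithin.mono fun s hs h0 => ?_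
          exact absurd (inv_eq_zero.1 h0) (sub_ne_zero.2 hs)
    have key := ih F (fun s hs => hS s (Finset.mem_insert_of_mem hs))
      (fun s h1 h2 h3 => by
        by_cases hsp : s = p
        · exact hsp ▸ hFp
        · exact ((hd s h1 h2 (by simp [hsp, h3])).sub (hinv s hsp)).congr_of_eventuallyEq
            (hFg s hsp))
      (fun p' hp' => by
        have hne : p' ≠ p := fun h => hp (h ▸ hp')
        have h1 := hc p' (Finset.mem_insert_of_mem hp')
        have h2 : Tendsto (fun s => (s - p') * (c p * (s - p)⁻¹)) (𝓝[≠] p')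
            (𝓝 ((p' - p') * (c p * (p' - p)⁻¹))) :=
          tendsto_nhdsWithin_of_tendsto_nhds
            ((tendsto_id.sub_const p').mul (hinv p' hne).continuousAt)
        have h3 := h1.sub h2
        rw [sub_self, zero_mul, sub_zero] at h3
        refine h3.congr' (((hFg p' hne).filter_mono nhdsWithin_le_nhds).mono fun s hs => ?_)
        simp only [hs, hg]
        ring)
    have hint : ∀ ρ : ℝ, 0 < ρ → r ≤ ρ → ρ ≤ R → ρ ≠ ‖p‖ → (∀ p' ∈ S, ρ ≠ ‖p'‖) →
        (∮ s in C(0, ρ), F s) = (∮ s in C(0, ρ), f s) - c p * ∮ s in C(0, ρ), (s - p)⁻¹ := by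
      intro ρ h0 h1 h2 h3 h4
      have hmem : ∀ s ∈ Metric.sphere (0 : ℂ) ρ, s ≠ p ∧ s ∉ S := fun s hs => by
        rw [mem_sphere_zero_iff_norm] at hs
        exact ⟨fun h => h3 (by rw [← h, hs]), fun h => h4 s h hs.symm⟩
      have hcf : ContinuousOn f (Metric.sphere (0 : ℂ) ρ) := fun s hs => by
        have hs' := mem_sphere_zero_iff_norm.1 hs
        exact (hd s (by rw [hs']; exact h1) (by rw [hs']; exact h2)
          (by simp [hmem s hs])).continuousAt.continuousWithinAt
      have hci : ContinuousOn (fun s => c p * (s - p)⁻¹) (Metric.sphere (0 : ℂ) ρ) := fun s hs =>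
        (hinv s (hmem s hs).1).continuousAt.continuousWithinAt
      rw [← circleIntegral.integral_const_mul, ← circleIntegral.integral_sub
        (hcf.circleIntegrable h0.le) (hci.circleIntegrable h0.le)]
      exact circleIntegral.integral_congr h0.le fun s hs => Function.update_of_ne (hmem s hs).1 _ _
    have hSr := fun p' hp' => (hS p' (Finset.mem_insert_of_mem hp'))
    rw [hint R (hr.trans_le hrR) hrR le_rfl hp2.ne' fun p' hp' => (hSr p' hp').2.ne',
      hint r hr le_rfl hrR hp1.ne fun p' hp' => (hSr p' hp').1.ne,
      circleIntegral.integral_sub_inv_of_mem_ball (by simpa using hp2),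
      circleIntegral_sub_inv_of_lt_norm hr.le hp1] at key
    rw [Finset.sum_insert hp]
    linear_combination key

/-- The measure `ds / s` on circles about the origin is invariant under homotheties. -/
theorem circleIntegral_inv_mul_comp_mul {c : ℂ} (hc : c ≠ 0) {ρ : ℝ} (hρ : 0 < ρ) (f : ℂ → ℂ) :
    (∮ s in C(0, ‖c‖ * ρ), s⁻¹ * f s) = ∮ s in C(0, ρ), s⁻¹ * f (c * s) := by
  have key : ∀ (R : ℝ) (g : ℂ → ℂ), 0 < R → (∮ s in C(0, R), s⁻¹ * g s) =
      ∫ t in (0 : ℝ)..2 * Real.pi, Complex.I * g (circleMap 0 R t) := fun R g hR => by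
    refine intervalIntegral.integral_congr fun t _ => ?_
    have : circleMap 0 R t ≠ 0 := by simp [hR.ne']
    simp only [deriv_circleMap, smul_eq_mul]
    field_simp
  rw [key _ _ (mul_pos (norm_pos_iff.2 hc) hρ), key _ _ hρ]
  have hmap : ∀ t, c * circleMap 0 ρ t = circleMap 0 (‖c‖ * ρ) (t + c.arg) := fun t => by
    nth_rewrite 1 [← Complex.norm_mul_exp_arg_mul_I c]
    simp only [circleMap_zero]
    push_cast
    rw [add_mul, Complex.exp_add]
    ring
  simp only [hmap]
  have hper : Function.Periodic (fun t => Complex.I * f (circleMap 0 (‖c‖ * ρ) t))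
      (2 * Real.pi) := fun t => by simp only [periodic_circleMap 0 (‖c‖ * ρ) t]
  rw [intervalIntegral.integral_comp_add_right
    (fun t => Complex.I * f (circleMap 0 (‖c‖ * ρ) t)), zero_add, add_comm,
    hper.intervalIntegral_add_eq c.arg 0, zero_add]

/-- A convergent sequence that is asymptotic to a sum of geometric progressions, none of them
constant, tends to zero. -/
theorem eq_zero_of_tendsto_of_sub_geometric (J : ℕ) (l t : ℕ → ℂ) (hl : ∀ j, l j ≠ 1) :
    ∀ (x : ℕ → ℂ) (L : ℂ), Tendsto x atTop (𝓝 L) →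
      Tendsto (fun m => x m - ∑ j ∈ Finset.range J, l j ^ m * t j) atTop (𝓝 0) → L = 0 := by
  induction J generalizing t with
  | zero =>
    intro x L hx h0
    exact tendsto_nhds_unique hx (by simpa using h0)
  | succ J ih =>
    intro x L hx h0
    -- the difference operator `x ↦ x (· + 1) - l J • x` kills the last progression
    have h1 : Tendsto (fun m => x (m + 1) - l J * x m) atTop (𝓝 (L - l J * L)) :=
      (hx.comp (tendsto_add_atTop_nat 1)).sub (hx.const_mul _)
    have h2 := (h0.comp (tendsto_add_atTop_nat 1)).sub (h0.const_mul (l J))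
    rw [mul_zero, sub_zero] at h2
    have h3 := ih (fun j => (l j - l J) * t j) _ _ h1 (h2.congr fun m => by
      simp only [Function.comp_apply, Finset.sum_range_succ]
      have : ∑ j ∈ Finset.range J, l j ^ m * ((l j - l J) * t j) =
          ∑ j ∈ Finset.range J, l j ^ (m + 1) * t j -
            l J * ∑ j ∈ Finset.range J, l j ^ m * t j := by
        rw [Finset.mul_sum, ← Finset.sum_sub_distrib]
        exact Finset.sum_congr rfl fun j _ => by ring
      rw [this]
      ring)
    have h4 : (1 - l J) * L = 0 := by linear_combination h3
    exact (mul_eq_zero.1 h4).resolve_left (sub_ne_zero.2 (hl J).symm)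

theorem tendsto_sub_div_of_simple_zero {g : ℂ → ℂ} {g' p : ℂ} (hg : HasDerivAt g g' p)
    (h0 : g p = 0) (h1 : g' ≠ 0) : Tendsto (fun s => (s - p) / g s) (𝓝[≠] p) (𝓝 g'⁻¹) := by
  have h := (hasDerivAt_iff_tendsto_slope.1 hg).inv₀ h1
  refine h.congr fun s => ?_
  rw [slope_def_field, h0, sub_zero, inv_div]

theorem eq_of_eventually_eq_punctured {f g : ℂ → ℂ} {s : ℂ} (hf : ContinuousAt f s)
    (hg : ContinuousAt g s) (h : ∀ᶠ t in 𝓝[≠] s, f t = g t) : f s = g s :=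
  tendsto_nhds_unique (hf.tendsto.mono_left nhdsWithin_le_nhds)
    ((hg.tendsto.mono_left nhdsWithin_le_nhds).congr' (h.mono fun _ ht => ht.symm))

/-! ### The elliptic Euler class of `V₊` and its zeros -/

theorem qtheta_mul_zpow_eq_zero_iff {τ : ℂ} (hτ : 0 < τ.im) (n : ℤ) {x : ℂ} (hx : x ≠ 0) :
    qtheta τ (x * nomeQ τ ^ n) = 0 ↔ qtheta τ x = 0 := by
  obtain ⟨c, hc, h⟩ := exists_qtheta_zpow_mul hτ n
  rw [mul_comm, h x hx]
  simp [hc, zpow_ne_zero _ hx]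

theorem qtheta_inv_eq_zero_iff {τ : ℂ} (hτ : 0 < τ.im) {x : ℂ} (hx : x ≠ 0) :
    qtheta τ x⁻¹ = 0 ↔ ∃ n : ℤ, x = nomeQ τ ^ n := by
  rw [qtheta_eq_zero_iff hτ (inv_ne_zero hx)]
  exact ⟨fun ⟨n, h⟩ => ⟨-n, by rw [zpow_neg, ← h, inv_inv]⟩,
    fun ⟨n, h⟩ => ⟨-n, by rw [zpow_neg, ← h]⟩⟩

namespace GLSMData

variable {N : ℕ} (X : GLSMData N) (τ : ℂ) (a : Fin N → ℂ)

/-- The elliptic Euler class `∏_{i ∈ V₊} θ(Uᵢ⁻¹ q^{rᵢ})` of `V₊`, as a function of `s`. -/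
def thetaPos (s : ℂ) : ℂ := ∏ i ∈ X.pos, qtheta τ ((X.U a i s)⁻¹ * qpow τ (X.r i))

/-- The index set of the torus fixed points of the inertia stack of `X₊`: triples `(k, i, s₀)`
with `k` in `V₊`, `0 ≤ i < Dₖ` and `s₀ ^ Dₖ = aₖ⁻¹`, standing for the point `s₀` of the `k`-th
fixed point in the sector `i / Dₖ`. -/
def fixedIndex : Finset (Σ _ : Fin N, ℕ × ℂ) :=
  X.pos.sigma fun k =>
    Finset.range (X.D k).toNat ×ˢ Polynomial.nthRootsFinset (X.D k).toNat (a k)⁻¹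

/-- The sector `i / Dₖ` of a fixed point `(k, i, s₀)`. -/
def sector (e : Σ _ : Fin N, ℕ × ℂ) : ℚ := e.2.1 / X.D e.1

/-- The point `q ^ (i / Dₖ) s₀` of `ℂˣ` attached to a fixed point `(k, i, s₀)`. -/
def lift (e : Σ _ : Fin N, ℕ × ℂ) : ℂ := qpow τ (X.sector e) * e.2.2

variable {X τ a}

theorem mem_pos {k : Fin N} : k ∈ X.pos ↔ 0 < X.D k := by simp [pos]

theorem U_mul (i : Fin N) (c s : ℂ) : X.U a i (c * s) = c ^ X.D i * X.U a i s := by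
  simp only [U, mul_zpow]
  ring

theorem U_qpow_mul (i : Fin N) (x : ℚ) (s : ℂ) :
    X.U a i (qpow τ x * s) = qpow τ (X.D i * x) * X.U a i s := by
  rw [U_mul, qpow_intCast_mul]

theorem U_ne_zero (ha : X.GenericParam τ a) (i : Fin N) {s : ℂ} (hs : s ≠ 0) : X.U a i s ≠ 0 :=
  mul_ne_zero (ha.1 i) (zpow_ne_zero _ hs)

theorem hasDerivAt_inv_U (i : Fin N) {s : ℂ} (hs : s ≠ 0) :
    HasDerivAt (fun t => (X.U a i t)⁻¹) (-(X.D i : ℂ) / s * (X.U a i s)⁻¹) s := by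
  have h := (hasDerivAt_zpow (-X.D i) s (Or.inl hs)).const_mul (a i)⁻¹
  refine (h.congr_deriv ?_).congr_of_eventuallyEq (.of_forall fun t => ?_)
  · rw [zpow_sub_one₀ hs, zpow_neg, U, mul_inv]
    push_cast
    ring
  · simp only [U, mul_inv, zpow_neg]

theorem differentiableAt_inv_U (i : Fin N) {s : ℂ} (hs : s ≠ 0) :
    DifferentiableAt ℂ (fun t => (X.U a i t)⁻¹) s := (hasDerivAt_inv_U i hs).differentiableAt

theorem deriv_inv_U_ne_zero (ha : X.GenericParam τ a) (i : Fin N) {s : ℂ} (hs : s ≠ 0) :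
    -(X.D i : ℂ) / s * (X.U a i s)⁻¹ ≠ 0 := by
  have := X.D_ne_zero i
  have := U_ne_zero ha i hs
  simp_all

theorem inv_U_mul_qpow_ne_zero (ha : X.GenericParam τ a) (i : Fin N) {s : ℂ} (hs : s ≠ 0)
    (x : ℚ) : (X.U a i s)⁻¹ * qpow τ x ≠ 0 :=
  mul_ne_zero (inv_ne_zero (U_ne_zero ha i hs)) (qpow_ne_zero τ x)

theorem differentiableAt_qtheta_U (hτ : 0 < τ.im) (ha : X.GenericParam τ a) (i : Fin N) {s : ℂ}
    (hs : s ≠ 0) (x : ℚ) :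
    DifferentiableAt ℂ (fun t => qtheta τ ((X.U a i t)⁻¹ * qpow τ x)) s :=
  DifferentiableAt.comp s (differentiableAt_qtheta hτ (inv_U_mul_qpow_ne_zero ha i hs x))
    ((differentiableAt_inv_U i hs).mul_const _)

theorem deriv_qtheta_U_ne_zero (hτ : 0 < τ.im) (ha : X.GenericParam τ a) (i : Fin N) {s : ℂ}
    (hs : s ≠ 0) (x : ℚ) (h0 : qtheta τ ((X.U a i s)⁻¹ * qpow τ x) = 0) :
    deriv (fun t => qtheta τ ((X.U a i t)⁻¹ * qpow τ x)) s ≠ 0 := by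
  have hx := inv_U_mul_qpow_ne_zero ha i hs x
  have h := HasDerivAt.comp s (differentiableAt_qtheta hτ hx).hasDerivAt
    ((hasDerivAt_inv_U (X := X) (a := a) i hs).mul_const (qpow τ x))
  have h' := h.deriv
  simp only [Function.comp_def] at h'
  rw [h']
  exact mul_ne_zero (deriv_qtheta_ne_zero hτ hx h0)
    (mul_ne_zero (deriv_inv_U_ne_zero ha i hs) (qpow_ne_zero τ x))

theorem qtheta_U_shift_eq_zero_iff (hτ : 0 < τ.im) (ha : X.GenericParam τ a) (i : Fin N) {s : ℂ}
    (hs : s ≠ 0) (n : ℤ) :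
    qtheta τ ((X.U a i s)⁻¹ * qpow τ n) = 0 ↔ qtheta τ (X.U a i s)⁻¹ = 0 := by
  rw [qpow_intCast, qtheta_mul_zpow_eq_zero_iff hτ _ (inv_ne_zero (U_ne_zero ha i hs))]

theorem thetaPos_eq_zero_iff (hτ : 0 < τ.im) (ha : X.GenericParam τ a) {s : ℂ} (hs : s ≠ 0) :
    X.thetaPos τ a s = 0 ↔ s ∈ X.ellLocus τ a := by
  simp only [thetaPos, ellLocus, Set.mem_ofPred_eq, Finset.prod_eq_zero_iff,
    qtheta_U_shift_eq_zero_iff hτ ha _ hs, hs, ne_eq, not_false_eq_true, true_and]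

/-- The elliptic locus is where `U_k` is in `q ^ ℤ` for some `k` in `V₊`. -/
theorem mem_ellLocus_iff (hτ : 0 < τ.im) (ha : X.GenericParam τ a) {s : ℂ} (hs : s ≠ 0) :
    s ∈ X.ellLocus τ a ↔ ∃ k ∈ X.pos, ∃ n : ℤ, X.U a k s = nomeQ τ ^ n := by
  simp only [ellLocus, Set.mem_ofPred_eq, Finset.prod_eq_zero_iff, hs, ne_eq, not_false_eq_true,
    true_and]
  exact exists_congr fun k => and_congr_right fun _ =>
    qtheta_inv_eq_zero_iff hτ (U_ne_zero ha k hs)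

/-- Genericity of the equivariant parameters: if `U_k(s)` is in `q ^ ℤ` for a `k` in `V₊`, then no
other `U_j(s)` is. -/
theorem GenericParam.U_ne (hτ : 0 < τ.im) (ha : X.GenericParam τ a) {k j : Fin N} (hk : k ∈ X.pos)
    (hj : j ≠ k) {s : ℂ} (hs : s ≠ 0) {n : ℤ} (h : X.U a k s = nomeQ τ ^ n) (m : ℤ) :
    X.U a j s ≠ nomeQ τ ^ m := fun h' =>
  ha.2 k j (mem_pos.1 hk) hj s hs ⟨(qtheta_inv_eq_zero_iff hτ (U_ne_zero ha k hs)).2 ⟨n, h⟩,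
    (qtheta_inv_eq_zero_iff hτ (U_ne_zero ha j hs)).2 ⟨m, h'⟩⟩

theorem differentiableOn_thetaPos (hτ : 0 < τ.im) (ha : X.GenericParam τ a) :
    DifferentiableOn ℂ (X.thetaPos τ a) {0}ᶜ := fun _ hs =>
  (DifferentiableAt.fun_finsetProd fun i _ =>
    differentiableAt_qtheta_U hτ ha i hs _).differentiableWithinAt

/-- By genericity of the equivariant parameters, the zeros of `thetaPos` are simple. -/
theorem deriv_thetaPos_ne_zero (hτ : 0 < τ.im) (ha : X.GenericParam τ a) {s : ℂ} (hs : s ≠ 0)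
    (h0 : X.thetaPos τ a s = 0) : deriv (X.thetaPos τ a) s ≠ 0 := by
  obtain ⟨k, hk, hk0⟩ := Finset.prod_eq_zero_iff.1 h0
  refine deriv_prod_ne_zero hk (fun i _ => differentiableAt_qtheta_U hτ ha i hs _) hk0
    (deriv_qtheta_U_ne_zero hτ ha k hs _ hk0) fun i _ hik hi0 => ?_
  rw [qtheta_U_shift_eq_zero_iff hτ ha _ hs] at hk0 hi0
  exact ha.2 k i (mem_pos.1 hk) hik s hs ⟨hk0, hi0⟩

theorem mem_fixedIndex {e : Σ _ : Fin N, ℕ × ℂ} :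
    e ∈ X.fixedIndex a ↔
      e.1 ∈ X.pos ∧ (e.2.1 : ℤ) < X.D e.1 ∧ e.2.2 ^ X.D e.1 = (a e.1)⁻¹ := by
  simp only [fixedIndex, Finset.mem_sigma, Finset.mem_product, Finset.mem_range]
  refine and_congr_right fun hk => ?_
  have hD := mem_pos.1 hk
  obtain ⟨d, hd⟩ := Int.eq_ofNat_of_zero_le hD.le
  have hd0 : 0 < d := by omega
  rw [hd, Int.toNat_natCast, Polynomial.mem_nthRootsFinset hd0, zpow_natCast]
  simp

theorem ne_zero_of_mem_fixedIndex (ha : X.GenericParam τ a) {e : Σ _ : Fin N, ℕ × ℂ}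
    (he : e ∈ X.fixedIndex a) : e.2.2 ≠ 0 := by
  obtain ⟨hk, -, h⟩ := mem_fixedIndex.1 he
  intro h0
  rw [h0, zero_zpow _ (X.D_ne_zero _)] at h
  exact inv_ne_zero (ha.1 _) h.symm

theorem lift_ne_zero (ha : X.GenericParam τ a) {e : Σ _ : Fin N, ℕ × ℂ}
    (he : e ∈ X.fixedIndex a) : X.lift τ e ≠ 0 :=
  mul_ne_zero (qpow_ne_zero _ _) (ne_zero_of_mem_fixedIndex ha he)

theorem D_mul_sector (e : Σ _ : Fin N, ℕ × ℂ) : (X.D e.1 : ℚ) * X.sector e = e.2.1 := by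
  have : (X.D e.1 : ℚ) ≠ 0 := by exact_mod_cast X.D_ne_zero _
  rw [sector]
  field_simp

theorem sector_nonneg {e : Σ _ : Fin N, ℕ × ℂ} (he : e ∈ X.fixedIndex a) : 0 ≤ X.sector e := by
  have h : (0 : ℚ) < X.D e.1 := by exact_mod_cast mem_pos.1 (mem_fixedIndex.1 he).1
  exact div_nonneg (Nat.cast_nonneg _) h.le

theorem sector_lt_one {e : Σ _ : Fin N, ℕ × ℂ} (he : e ∈ X.fixedIndex a) : X.sector e < 1 := by
  obtain ⟨hk, hi, -⟩ := mem_fixedIndex.1 he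
  have h : (0 : ℚ) < X.D e.1 := by exact_mod_cast mem_pos.1 hk
  rw [sector, div_lt_one h]
  exact_mod_cast hi

theorem U_point (ha : X.GenericParam τ a) {e : Σ _ : Fin N, ℕ × ℂ} (he : e ∈ X.fixedIndex a) :
    X.U a e.1 e.2.2 = 1 := by
  rw [U, (mem_fixedIndex.1 he).2.2, mul_inv_cancel₀ (ha.1 _)]

theorem U_lift (ha : X.GenericParam τ a) {e : Σ _ : Fin N, ℕ × ℂ} (he : e ∈ X.fixedIndex a) :
    X.U a e.1 (X.lift τ e) = nomeQ τ ^ (e.2.1 : ℤ) := by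
  have h : ((e.2.1 : ℕ) : ℚ) = ((e.2.1 : ℤ) : ℚ) := by simp
  rw [lift, U_qpow_mul, D_mul_sector, U_point ha he, mul_one, h, qpow_intCast]

theorem U_zpow_mul_lift (ha : X.GenericParam τ a) {e : Σ _ : Fin N, ℕ × ℂ}
    (he : e ∈ X.fixedIndex a) (n : ℤ) :
    X.U a e.1 (nomeQ τ ^ n * X.lift τ e) = nomeQ τ ^ (X.D e.1 * n + e.2.1) := by
  rw [U_mul, U_lift ha he, zpow_add₀ (nomeQ_ne_zero τ), ← zpow_mul, mul_comm n]

theorem zpow_mul_lift_ne_zero (ha : X.GenericParam τ a) {e : Σ _ : Fin N, ℕ × ℂ}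
    (he : e ∈ X.fixedIndex a) (n : ℤ) : nomeQ τ ^ n * X.lift τ e ≠ 0 :=
  mul_ne_zero (zpow_ne_zero _ (nomeQ_ne_zero τ)) (lift_ne_zero ha he)

theorem zpow_mul_lift_mem_ellLocus (hτ : 0 < τ.im) (ha : X.GenericParam τ a)
    {e : Σ _ : Fin N, ℕ × ℂ} (he : e ∈ X.fixedIndex a) (n : ℤ) :
    nomeQ τ ^ n * X.lift τ e ∈ X.ellLocus τ a :=
  (mem_ellLocus_iff hτ ha (zpow_mul_lift_ne_zero ha he n)).2
    ⟨e.1, (mem_fixedIndex.1 he).1, _, U_zpow_mul_lift ha he n⟩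

theorem lift_mem_ellLocus (hτ : 0 < τ.im) (ha : X.GenericParam τ a)
    {e : Σ _ : Fin N, ℕ × ℂ} (he : e ∈ X.fixedIndex a) : X.lift τ e ∈ X.ellLocus τ a := by
  simpa using zpow_mul_lift_mem_ellLocus hτ ha he 0

/-- If `q ^ n` times the lift of a fixed point has `U_k` in `q ^ ℤ`, `k` in `V₊`, then `k` is the
coordinate of the fixed point. -/
theorem eq_fst_of_U_zpow_mul_lift (hτ : 0 < τ.im) (ha : X.GenericParam τ a)
    {e : Σ _ : Fin N, ℕ × ℂ} (he : e ∈ X.fixedIndex a) {n m : ℤ} {k : Fin N}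
    (h : X.U a k (nomeQ τ ^ n * X.lift τ e) = nomeQ τ ^ m) : k = e.1 := by
  by_contra hk
  exact ha.U_ne hτ (mem_fixedIndex.1 he).1 hk (zpow_mul_lift_ne_zero ha he n)
    (U_zpow_mul_lift ha he n) m h

/-- The lifts of distinct fixed points are distinct in `ℂˣ / q ^ ℤ`. -/
theorem eq_of_lift_eq_zpow_mul_lift (hτ : 0 < τ.im) (ha : X.GenericParam τ a)
    {e e' : Σ _ : Fin N, ℕ × ℂ} (he : e ∈ X.fixedIndex a) (he' : e' ∈ X.fixedIndex a) {n : ℤ}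
    (h : X.lift τ e = nomeQ τ ^ n * X.lift τ e') : e = e' ∧ n = 0 := by
  have h1 := U_lift (τ := τ) ha he
  rw [h] at h1
  obtain ⟨k, i, s⟩ := e
  obtain ⟨k', i', s'⟩ := e'
  obtain rfl : k = k' := eq_fst_of_U_zpow_mul_lift hτ ha he' h1
  rw [U_zpow_mul_lift ha he'] at h1
  have h2 := nomeQ_zpow_injective hτ h1
  obtain ⟨-, hi, -⟩ := mem_fixedIndex.1 he
  obtain ⟨-, hi', -⟩ := mem_fixedIndex.1 he'
  simp only at h2 hi hi'
  have hn : n = 0 := by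
    have hlt : |X.D k * n| < X.D k := by
      rw [abs_lt]; constructor <;> omega
    by_contra hn
    have h3 : 1 ≤ |n| := Int.one_le_abs hn
    rw [abs_mul, abs_of_pos (by omega : 0 < X.D k)] at hlt
    nlinarith
  subst hn
  have hii : i = i' := by omega
  subst hii
  refine ⟨?_, rfl⟩
  simp only [lift, sector, zpow_zero, one_mul] at h
  rw [mul_right_inj' (qpow_ne_zero _ _)] at h
  rw [h]

/-- Every point of the elliptic locus is, in `ℂˣ / q ^ ℤ`, the lift of a fixed point: if
`U_k(s) = q ^ m`, the sector is `i / D_k` with `i = m mod D_k`, and the quotient of `m` by `D_k` is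
the number of periods. -/
theorem exists_eq_zpow_mul_lift (hτ : 0 < τ.im) (ha : X.GenericParam τ a) {s : ℂ}
    (hs : s ∈ X.ellLocus τ a) :
    ∃ e ∈ X.fixedIndex a, ∃ n : ℤ, s = nomeQ τ ^ n * X.lift τ e := by
  obtain ⟨k, hk, m, hm⟩ := (mem_ellLocus_iff hτ ha hs.1).1 hs
  have hD := mem_pos.1 hk
  have h1 := Int.emod_nonneg m hD.ne'
  have h2 := Int.emod_lt_of_pos m hD
  have h3 := Int.emod_add_mul_ediv m (X.D k)
  have hDQ : (X.D k : ℚ) ≠ 0 := by exact_mod_cast hD.ne'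
  set v : ℚ := ((m % X.D k).toNat : ℚ) / X.D k with hv
  have hvD : (X.D k : ℚ) * v = ((m % X.D k : ℤ) : ℚ) := by
    rw [hv, mul_div_cancel₀ _ hDQ]
    exact_mod_cast congrArg (Int.cast : ℤ → ℚ) (Int.toNat_of_nonneg h1)
  have hw : qpow τ (m / X.D k : ℤ) * qpow τ v ≠ 0 :=
    mul_ne_zero (qpow_ne_zero _ _) (qpow_ne_zero _ _)
  refine ⟨⟨k, (m % X.D k).toNat, s / (qpow τ (m / X.D k : ℤ) * qpow τ v)⟩,
    mem_fixedIndex.2 ⟨hk, by simpa [Int.toNat_of_nonneg h1] using h2, ?_⟩, m / X.D k, ?_⟩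
  · have h4 : (qpow τ (m / X.D k : ℤ) * qpow τ v) ^ X.D k = nomeQ τ ^ m := by
      rw [← qpow_add, ← qpow_intCast_mul, mul_add, hvD, ← qpow_intCast]
      congr 1
      rw [add_comm]
      exact_mod_cast h3
    simp only
    rw [div_zpow, h4, ← hm, U]
    have := ha.1 k
    have := zpow_ne_zero (X.D k) hs.1
    field_simp
  · simp only [lift, sector]
    rw [← hv, ← qpow_intCast, ← mul_assoc, mul_div_cancel₀ _ hw]

theorem exists_natCast_eq_of_mem_posFixed {v : ℚ} (hv0 : 0 ≤ v) (hv1 : v < 1) {k : Fin N}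
    (hk : k ∈ X.posFixed v) : ∃ i : ℕ, (i : ℚ) = X.D k * v ∧ (i : ℤ) < X.D k := by
  obtain ⟨hk, hage⟩ := Finset.mem_filter.1 hk
  have hD : (0 : ℚ) < X.D k := by exact_mod_cast mem_pos.1 hk
  obtain ⟨m, hm⟩ := Int.fract_eq_zero_iff.1 hage
  have hm0 : 0 ≤ m := by
    have : (0 : ℚ) ≤ m := by rw [hm]; positivity
    exact_mod_cast this
  have hm1 : m < X.D k := by
    have : (m : ℚ) < X.D k := by rw [hm]; nlinarith
    exact_mod_cast this
  lift m to ℕ using hm0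
  exact ⟨m, by simpa using hm, hm1⟩

theorem mem_lifts_iff {s : ℂ} :
    s ∈ X.lifts τ a ↔ ∃ e ∈ X.fixedIndex a, s = X.lift τ e := by
  constructor
  · rintro ⟨v, hv0, hv1, k, hk, s₀, hs₀, rfl⟩
    have hpos := (Finset.mem_filter.1 hk).1
    have hD : (X.D k : ℚ) ≠ 0 := by exact_mod_cast X.D_ne_zero k
    obtain ⟨m, hm, hm1⟩ := exists_natCast_eq_of_mem_posFixed hv0 hv1 hk
    refine ⟨⟨k, m, s₀⟩, mem_fixedIndex.2 ⟨hpos, hm1, hs₀⟩, ?_⟩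
    simp only [GLSMData.lift, sector]
    congr 2
    rw [eq_div_iff hD, mul_comm, ← hm]
  · rintro ⟨e, he, rfl⟩
    refine ⟨X.sector e, sector_nonneg he, sector_lt_one he, e.1, ?_, e.2.2,
      (mem_fixedIndex.1 he).2.2, rfl⟩
    rw [posFixed, Finset.mem_filter, age, D_mul_sector]
    exact ⟨(mem_fixedIndex.1 he).1, Int.fract_natCast _⟩

theorem qtheta_inv_ne_zero_of_genericKahler (hτ : 0 < τ.im) {z : ℂ} (hz : X.GenericKahler τ a z) :
    qtheta τ z⁻¹ ≠ 0 := fun h => by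
  obtain ⟨n, hn⟩ := (qtheta_inv_eq_zero_iff hτ hz.1).1 h
  exact hz.2.1 n hn

theorem zpow_mul_mem_ellLocus (hτ : 0 < τ.im) (ha : X.GenericParam τ a) {s : ℂ}
    (hs : s ∈ X.ellLocus τ a) (n : ℤ) : nomeQ τ ^ n * s ∈ X.ellLocus τ a := by
  obtain ⟨k, hk, m, hm⟩ := (mem_ellLocus_iff hτ ha hs.1).1 hs
  refine (mem_ellLocus_iff hτ ha (mul_ne_zero (zpow_ne_zero _ (nomeQ_ne_zero τ)) hs.1)).2
    ⟨k, hk, n * X.D k + m, ?_⟩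
  rw [U_mul, hm, ← zpow_mul, zpow_add₀ (nomeQ_ne_zero τ)]

theorem qtheta_inv_mul_inv_ne_zero_of_genericKahler (hτ : 0 < τ.im) (ha : X.GenericParam τ a)
    {z : ℂ} (hz : X.GenericKahler τ a z) {s : ℂ} (hs : s ∈ X.ellLocus τ a) :
    qtheta τ (s⁻¹ * z⁻¹) ≠ 0 := fun h => by
  rw [← mul_inv] at h
  obtain ⟨n, hn⟩ := (qtheta_inv_eq_zero_iff hτ (mul_ne_zero hs.1 hz.1)).1 h
  refine hz.2.2 _ (zpow_mul_mem_ellLocus hτ ha hs (-n)) ?_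
  rw [mul_inv, zpow_neg, inv_inv, ← hn]
  field_simp [hs.1]

end GLSMData

/-! ### The interpolation problem -/

/-- The Kronecker function `θ(x z⁻¹) / (θ(x) θ(z⁻¹))`. -/
def kronecker (τ z x : ℂ) : ℂ := qtheta τ (x * z⁻¹) / (qtheta τ x * qtheta τ z⁻¹)

/-- The Kronecker function has the multiplier `z`. This also holds at its poles, where both sides
have the junk value zero. -/
theorem kronecker_zpow_mul {τ : ℂ} (hτ : 0 < τ.im) {z x : ℂ} (hz : z ≠ 0) (hx : x ≠ 0) (n : ℤ) :
    kronecker τ z (nomeQ τ ^ n * x) = z ^ n * kronecker τ z x := by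
  obtain ⟨c, hc, h⟩ := exists_qtheta_zpow_mul hτ n
  have hxz : x * z⁻¹ ≠ 0 := mul_ne_zero hx (inv_ne_zero hz)
  rw [kronecker, kronecker, mul_assoc, h _ hxz, h _ hx, mul_zpow, inv_zpow', neg_neg]
  have := zpow_ne_zero (-n) hx
  by_cases h0 : qtheta τ x = 0
  · simp [h0]
  · field_simp

theorem hasDerivAt_qtheta_mul {τ : ℂ} (hτ : 0 < τ.im) {c s : ℂ} (hc : c ≠ 0) (hs : s ≠ 0) :
    HasDerivAt (fun t => qtheta τ (t * c)) (deriv (qtheta τ) (s * c) * c) s := by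
  have h := HasDerivAt.comp s (h₂ := qtheta τ) (h := fun t => t * c)
    (differentiableAt_qtheta hτ (mul_ne_zero hs hc)).hasDerivAt ((hasDerivAt_id s).mul_const c)
  rw [one_mul] at h
  exact h

theorem differentiableAt_qtheta_mul {τ : ℂ} (hτ : 0 < τ.im) {c s : ℂ} (hc : c ≠ 0) (hs : s ≠ 0) :
    DifferentiableAt ℂ (fun t => qtheta τ (t * c)) s :=
  (hasDerivAt_qtheta_mul hτ hc hs).differentiableAt

theorem eventually_qtheta_mul_ne_zero {τ : ℂ} (hτ : 0 < τ.im) {c s : ℂ} (hc : c ≠ 0) (hs : s ≠ 0) :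
    ∀ᶠ t in 𝓝[≠] s, qtheta τ (t * c) ≠ 0 := by
  have hsc := mul_ne_zero hs hc
  have hd := hasDerivAt_qtheta_mul hτ hc hs
  refine eventually_ne_zero_of_simple_zero hd.differentiableAt fun h0 => ?_
  rw [hd.deriv]
  exact mul_ne_zero (deriv_qtheta_ne_zero hτ hsc h0) hc

/-- The line bundle of degree zero on `ℂˣ / q^ℤ` with multiplier `z ∉ q^ℤ` has no section: the
product of a section with the section `θ(s z / p) / θ(s / p)` of the inverse bundle has a single
pole in a fundamental annulus, so that its residue vanishes. -/
theorem eq_zero_of_nomeQ_mul_eq {τ : ℂ} (hτ : 0 < τ.im) {z : ℂ} (hz : z ≠ 0)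
    (hzq : ∀ n : ℤ, z ≠ nomeQ τ ^ n) {f : ℂ → ℂ} (hf : DifferentiableOn ℂ f {0}ᶜ)
    (hfq : ∀ s, s ≠ 0 → f (nomeQ τ * s) = z * f s) {p : ℂ} (hp : p ≠ 0) : f p = 0 := by
  have hq := nomeQ_ne_zero τ
  have hq0 := norm_nomeQ_pos τ
  have hq1 := norm_nomeQ_lt_one hτ
  -- the fundamental annulus is centred at `|p|`, so that `p` is its only zero of `θ(s / p)`
  set b : ℝ := √‖nomeQ τ‖ with hb
  have hb0 : 0 < b := Real.sqrt_pos.2 hq0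
  have hbb : b * b = ‖nomeQ τ‖ := Real.mul_self_sqrt hq0.le
  have hb1 : b < 1 := by nlinarith
  have hp0 : 0 < ‖p‖ := norm_pos_iff.2 hp
  set R : ℝ := ‖p‖ / b with hR
  have hR0 : 0 < R := div_pos hp0 hb0
  have hRb : R * b = ‖p‖ := div_mul_cancel₀ _ hb0.ne'
  have hpi := inv_ne_zero hp
  have hzp : z * p⁻¹ ≠ 0 := mul_ne_zero hz hpi
  set κ : ℂ → ℂ := fun s => qtheta τ (s * (z * p⁻¹)) / qtheta τ (s * p⁻¹) with hκ
  have hκq : ∀ s, s ≠ 0 → κ (nomeQ τ * s) = z⁻¹ * κ s := fun s hs => by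
    simp only [hκ, mul_assoc]
    rw [qtheta_nomeQ_mul hτ (mul_ne_zero hs hzp), qtheta_nomeQ_mul hτ (mul_ne_zero hs hpi)]
    field_simp
  -- the zeros of `θ(s / p)` in the annulus
  have hzero : ∀ s, ‖nomeQ τ‖ * R ≤ ‖s‖ → ‖s‖ ≤ R → s ≠ p → s ≠ 0 ∧ qtheta τ (s * p⁻¹) ≠ 0 := by
    intro s h1 h2 hsp
    have hs : s ≠ 0 := norm_pos_iff.1 (lt_of_lt_of_le (by positivity) h1)
    refine ⟨hs, fun h0 => ?_⟩
    obtain ⟨n, hn⟩ := (qtheta_eq_zero_iff hτ (mul_ne_zero hs hpi)).1 h0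
    have hsn : s = nomeQ τ ^ n * p := by rw [← hn]; field_simp
    have hnorm : ‖s‖ = ‖nomeQ τ‖ ^ n * (R * b) := by rw [hsn, norm_mul, norm_zpow, hRb]
    rw [hnorm] at h1 h2
    -- `|q| R ≤ |s| ≤ R` says that `b ≤ |q| ^ n ≤ 1 / b`, where `b = |q| ^ (1 / 2)`
    have hnn : n = 0 := by
      have h3 : ‖nomeQ τ‖ ^ n * b ≤ 1 := by nlinarith
      have h4 : b ≤ ‖nomeQ τ‖ ^ n := by nlinarith
      rcases lt_trichotomy n 0 with h | h | h
      · exfalso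
        have h5 : ‖nomeQ τ‖ ^ (-1 : ℤ) ≤ ‖nomeQ τ‖ ^ n :=
          zpow_le_zpow_right_of_le_one₀ hq0 hq1.le (by omega)
        have h7 : ‖nomeQ τ‖⁻¹ = b⁻¹ * b⁻¹ := by rw [← hbb, mul_inv]
        rw [zpow_neg_one, h7] at h5
        have h6 : b⁻¹ * b⁻¹ * b ≤ 1 := by nlinarith
        rw [mul_assoc, inv_mul_cancel₀ hb0.ne', mul_one] at h6
        exact absurd h6 (not_le.2 ((one_lt_inv₀ hb0).2 hb1))
      · exact h
      · exfalso
        have h5 : ‖nomeQ τ‖ ^ n ≤ ‖nomeQ τ‖ ^ (1 : ℤ) :=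
          zpow_le_zpow_right_of_le_one₀ hq0 hq1.le (by omega)
        rw [zpow_one] at h5
        nlinarith
    rw [hnn] at hsn
    exact hsp (by simpa using hsn)
  have hθ1 : HasDerivAt (fun s => qtheta τ (s * p⁻¹)) (-(qphi τ (nomeQ τ)) ^ 2 * p⁻¹) p := by
    refine HasDerivAt.comp p (h₂ := qtheta τ) ?_
      (by simpa using (hasDerivAt_id p).mul_const p⁻¹)
    simpa [hp] using hasDerivAt_qtheta_one hτ
  have hθ1ne : -(qphi τ (nomeQ τ)) ^ 2 * p⁻¹ ≠ 0 := by simp [qphi_nomeQ_ne_zero hτ, hp]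
  have hθ0 : qtheta τ (p * p⁻¹) = 0 := by
    rw [mul_inv_cancel₀ hp]
    exact (qtheta_eq_zero_iff hτ one_ne_zero).2 ⟨0, by simp⟩
  have hfd : ∀ s, s ≠ 0 → DifferentiableAt ℂ f s := fun s hs =>
    hf.differentiableAt (isOpen_compl_singleton.mem_nhds hs)
  have hres := circleIntegral_sub_circleIntegral_eq_sum (r := ‖nomeQ τ‖ * R) (R := R)
    (by positivity) (by nlinarith) {p}
    (fun _ => p⁻¹ * (f p * qtheta τ (p * (z * p⁻¹))) * (-(qphi τ (nomeQ τ)) ^ 2 * p⁻¹)⁻¹)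
    (fun s => s⁻¹ * (f s * κ s))
    (by
      intro s hs
      obtain rfl := Finset.mem_singleton.1 hs
      constructor <;> nlinarith)
    (fun s h1 h2 h3 => by
      obtain ⟨hs, hθ⟩ := hzero s h1 h2 (by simpa using h3)
      exact (differentiableAt_inv hs).mul ((hfd s hs).mul
        ((differentiableAt_qtheta_mul hτ hzp hs).div (differentiableAt_qtheta_mul hτ hpi hs) hθ)))
    (fun s hs => by
      obtain rfl := Finset.mem_singleton.1 hs
      have h1 : Tendsto (fun t => t⁻¹ * (f t * qtheta τ (t * (z * s⁻¹)))) (𝓝[≠] s)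
          (𝓝 (s⁻¹ * (f s * qtheta τ (s * (z * s⁻¹))))) :=
        ((differentiableAt_inv hp).mul ((hfd s hp).mul
          (differentiableAt_qtheta_mul hτ hzp hp))).continuousAt.tendsto.mono_left
            nhdsWithin_le_nhds
      refine (h1.mul (tendsto_sub_div_of_simple_zero hθ1 hθ0 hθ1ne)).congr fun t => ?_
      simp only [hκ]
      ring)
  rw [circleIntegral_inv_mul_comp_mul hq hR0, Finset.sum_singleton] at hres
  have hint : (∮ s in C(0, R), s⁻¹ * (f (nomeQ τ * s) * κ (nomeQ τ * s))) =
      ∮ s in C(0, R), s⁻¹ * (f s * κ s) := by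
    refine circleIntegral.integral_congr hR0.le fun s hs => ?_
    have hs0 : s ≠ 0 := norm_pos_iff.1 (by rw [mem_sphere_zero_iff_norm.1 hs]; exact hR0)
    rw [hfq s hs0, hκq s hs0]
    field_simp
  rw [hint, sub_self] at hres
  have hθz : qtheta τ (p * (z * p⁻¹)) ≠ 0 := by
    rw [mul_comm, inv_mul_cancel_right₀ hp]
    exact fun h => let ⟨n, hn⟩ := (qtheta_eq_zero_iff hτ hz).1 h; hzq n hn
  have hpi2 := Complex.two_pi_I_ne_zero
  rw [eq_comm, mul_eq_zero, or_iff_right hpi2, mul_eq_zero, or_iff_left (inv_ne_zero hθ1ne),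
    mul_eq_zero, or_iff_right hpi, mul_eq_zero, or_iff_left hθz] at hres
  exact hres

namespace GLSMData

variable {N : ℕ} (X : GLSMData N) (τ : ℂ) (a : Fin N → ℂ)

/-- The quotient of the elliptic Euler class `thetaPos` by `θ(s / p)`, a holomorphic function of
`s ∈ ℂˣ`; here `p` is the lift of a fixed point. -/
def thetaQuot (e : Σ _ : Fin N, ℕ × ℂ) : ℂ → ℂ :=
  Classical.epsilon fun W : ℂ → ℂ => DifferentiableOn ℂ W {0}ᶜ ∧
    ∀ s ∈ ({0}ᶜ : Set ℂ), W s * qtheta τ (s * (X.lift τ e)⁻¹) = X.thetaPos τ a s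

/-- The section `θ(s / (p z)) / (θ(s / p) θ(z⁻¹)) · thetaPos` of `𝓛`, which vanishes at all the
lifts of fixed points but `p`. -/
def elemSection (z : ℂ) (e : Σ _ : Fin N, ℕ × ℂ) (s : ℂ) : ℂ :=
  qtheta τ (s * (X.lift τ e)⁻¹ * z⁻¹) / qtheta τ z⁻¹ * X.thetaQuot τ a e s

variable {X τ a}

theorem refSection_eq (z s : ℂ) :
    X.refSection τ a z s = kronecker τ z s * X.thetaPos τ a s := rfl

theorem qtheta_mul_inv_lift_eq_zero_iff (hτ : 0 < τ.im) (ha : X.GenericParam τ a)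
    {e : Σ _ : Fin N, ℕ × ℂ} (he : e ∈ X.fixedIndex a) {s : ℂ} (hs : s ≠ 0) :
    qtheta τ (s * (X.lift τ e)⁻¹) = 0 ↔ ∃ n : ℤ, s = nomeQ τ ^ n * X.lift τ e := by
  have hp := lift_ne_zero (τ := τ) ha he
  rw [qtheta_eq_zero_iff hτ (mul_ne_zero hs (inv_ne_zero hp))]
  simp only [mul_inv_eq_iff_eq_mul₀ hp]

theorem thetaQuot_spec (hτ : 0 < τ.im) (ha : X.GenericParam τ a)
    {e : Σ _ : Fin N, ℕ × ℂ} (he : e ∈ X.fixedIndex a) :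
    DifferentiableOn ℂ (X.thetaQuot τ a e) {0}ᶜ ∧ ∀ s ∈ ({0}ᶜ : Set ℂ),
      X.thetaQuot τ a e s * qtheta τ (s * (X.lift τ e)⁻¹) = X.thetaPos τ a s := by
  have hp := lift_ne_zero (τ := τ) ha he
  refine Classical.epsilon_spec (p := fun W : ℂ → ℂ => DifferentiableOn ℂ W {0}ᶜ ∧
    ∀ s ∈ ({0}ᶜ : Set ℂ), W s * qtheta τ (s * (X.lift τ e)⁻¹) = X.thetaPos τ a s)
    (exists_differentiableOn_mul_eq isOpen_compl_singleton (differentiableOn_thetaPos hτ ha)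
      (fun s hs => (differentiableAt_qtheta_mul hτ (inv_ne_zero hp) hs).differentiableWithinAt)
      fun s hs h0 => ?_)
  obtain ⟨n, hn⟩ := (qtheta_mul_inv_lift_eq_zero_iff hτ ha he hs).1 h0
  refine ⟨(thetaPos_eq_zero_iff hτ ha hs).2 (hn ▸ zpow_mul_lift_mem_ellLocus hτ ha he n), ?_⟩
  rw [(hasDerivAt_qtheta_mul hτ (inv_ne_zero hp) hs).deriv]
  exact mul_ne_zero (deriv_qtheta_ne_zero hτ (mul_ne_zero hs (inv_ne_zero hp)) h0)
    (inv_ne_zero hp)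

theorem differentiableAt_thetaQuot (hτ : 0 < τ.im) (ha : X.GenericParam τ a)
    {e : Σ _ : Fin N, ℕ × ℂ} (he : e ∈ X.fixedIndex a) {s : ℂ} (hs : s ≠ 0) :
    DifferentiableAt ℂ (X.thetaQuot τ a e) s :=
  (thetaQuot_spec hτ ha he).1.differentiableAt (isOpen_compl_singleton.mem_nhds hs)

theorem differentiableAt_thetaPos (hτ : 0 < τ.im) (ha : X.GenericParam τ a) {s : ℂ}
    (hs : s ≠ 0) : DifferentiableAt ℂ (X.thetaPos τ a) s :=
  (differentiableOn_thetaPos hτ ha).differentiableAt (isOpen_compl_singleton.mem_nhds hs)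

/-- Since the zeros of `thetaPos` are simple, none is left at `p` after division by `θ(s / p)`. -/
theorem thetaQuot_lift_ne_zero (hτ : 0 < τ.im) (ha : X.GenericParam τ a)
    {e : Σ _ : Fin N, ℕ × ℂ} (he : e ∈ X.fixedIndex a) : X.thetaQuot τ a e (X.lift τ e) ≠ 0 := by
  have hp := lift_ne_zero (τ := τ) ha he
  intro h0
  have hθ : qtheta τ (X.lift τ e * (X.lift τ e)⁻¹) = 0 :=
    (qtheta_mul_inv_lift_eq_zero_iff hτ ha he hp).2 ⟨0, by simp⟩
  have h1 := (differentiableAt_thetaQuot hτ ha he hp).hasDerivAt.mul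
    (differentiableAt_qtheta_mul hτ (inv_ne_zero hp) hp).hasDerivAt
  rw [h0, zero_mul, hθ, mul_zero, add_zero] at h1
  have h2 : HasDerivAt (X.thetaPos τ a) 0 (X.lift τ e) :=
    h1.congr_of_eventuallyEq ((eventually_ne_nhds hp).mono fun t ht =>
      ((thetaQuot_spec hτ ha he).2 t ht).symm)
  exact deriv_thetaPos_ne_zero hτ ha hp
    ((thetaPos_eq_zero_iff hτ ha hp).2 (lift_mem_ellLocus hτ ha he)) h2.deriv

theorem thetaQuot_lift_eq_zero (hτ : 0 < τ.im) (ha : X.GenericParam τ a)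
    {e e' : Σ _ : Fin N, ℕ × ℂ} (he : e ∈ X.fixedIndex a) (he' : e' ∈ X.fixedIndex a)
    (hne : e' ≠ e) : X.thetaQuot τ a e (X.lift τ e') = 0 := by
  have hp := lift_ne_zero (τ := τ) ha he'
  have h := (thetaQuot_spec hτ ha he).2 _ hp
  rw [(thetaPos_eq_zero_iff hτ ha hp).2 (lift_mem_ellLocus hτ ha he'), mul_eq_zero] at h
  refine h.resolve_right fun h0 => ?_
  obtain ⟨n, hn⟩ := (qtheta_mul_inv_lift_eq_zero_iff hτ ha he hp).1 h0
  exact hne (eq_of_lift_eq_zpow_mul_lift hτ ha he' he hn).1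

theorem differentiableAt_elemSection (hτ : 0 < τ.im) (ha : X.GenericParam τ a) {z : ℂ}
    (hz : z ≠ 0) {e : Σ _ : Fin N, ℕ × ℂ} (he : e ∈ X.fixedIndex a) {s : ℂ} (hs : s ≠ 0) :
    DifferentiableAt ℂ (X.elemSection τ a z e) s := by
  have hp := lift_ne_zero (τ := τ) ha he
  have h1 := differentiableAt_qtheta_mul hτ
    (mul_ne_zero (inv_ne_zero hp) (inv_ne_zero hz)) hs
  simp only [← mul_assoc] at h1
  exact (h1.div_const _).mul (differentiableAt_thetaQuot hτ ha he hs)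

theorem elemSection_eq_kronecker_mul (hτ : 0 < τ.im) (ha : X.GenericParam τ a)
    {e : Σ _ : Fin N, ℕ × ℂ} (he : e ∈ X.fixedIndex a) (z : ℂ) {s : ℂ} (hs : s ≠ 0)
    (h0 : qtheta τ (s * (X.lift τ e)⁻¹) ≠ 0) :
    X.elemSection τ a z e s = kronecker τ z (s * (X.lift τ e)⁻¹) * X.thetaPos τ a s := by
  rw [elemSection, kronecker, ← (thetaQuot_spec hτ ha he).2 s hs]
  generalize qtheta τ (s * (X.lift τ e)⁻¹) = x at h0
  field_simp

/-- The quotient of `elemSection` by `thetaPos` has the multiplier `z`. Stated without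
denominators, this holds at the zeros of `thetaPos` as well. -/
theorem elemSection_zpow_mul (hτ : 0 < τ.im) (ha : X.GenericParam τ a) {z : ℂ} (hz : z ≠ 0)
    {e : Σ _ : Fin N, ℕ × ℂ} (he : e ∈ X.fixedIndex a) (n : ℤ) {s : ℂ} (hs : s ≠ 0) :
    X.elemSection τ a z e (nomeQ τ ^ n * s) * X.thetaPos τ a s =
      z ^ n * X.thetaPos τ a (nomeQ τ ^ n * s) * X.elemSection τ a z e s := by
  have hq := zpow_ne_zero n (nomeQ_ne_zero τ)
  have hp := inv_ne_zero (lift_ne_zero (τ := τ) ha he)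
  by_cases h0 : X.thetaPos τ a s = 0
  · rw [h0, (thetaPos_eq_zero_iff hτ ha (mul_ne_zero hq hs)).2 (zpow_mul_mem_ellLocus hτ ha
      ((thetaPos_eq_zero_iff hτ ha hs).1 h0) n)]
    ring
  · have h1 : qtheta τ (s * (X.lift τ e)⁻¹) ≠ 0 := fun h =>
      h0 (by rw [← (thetaQuot_spec hτ ha he).2 s hs, h, mul_zero])
    have h2 : qtheta τ (nomeQ τ ^ n * s * (X.lift τ e)⁻¹) ≠ 0 := by
      rw [mul_assoc, mul_comm]
      rwa [ne_eq, qtheta_mul_zpow_eq_zero_iff hτ n (mul_ne_zero hs hp)]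
    rw [elemSection_eq_kronecker_mul hτ ha he z hs h1,
      elemSection_eq_kronecker_mul hτ ha he z (mul_ne_zero hq hs) h2, mul_assoc (nomeQ τ ^ n),
      kronecker_zpow_mul hτ hz (mul_ne_zero hs hp)]
    ring

theorem isSection_elemSection (hτ : 0 < τ.im) (ha : X.GenericParam τ a) {z : ℂ} (hz : z ≠ 0)
    {e : Σ _ : Fin N, ℕ × ℂ} (he : e ∈ X.fixedIndex a) :
    X.IsSection τ a z (X.elemSection τ a z e) where
  holo _ hs := (differentiableAt_elemSection hτ ha hz he hs).differentiableWithinAt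
  quasi s hs := by
    have h1 := elemSection_zpow_mul hτ ha hz he 1 hs
    have h2 := kronecker_zpow_mul hτ hz hs 1
    simp only [zpow_one] at h1 h2
    rw [refSection_eq, refSection_eq, h2]
    linear_combination kronecker τ z s * h1

/-- The coefficients of the interpolation in the basis of the sections `elemSection`. -/
def interpCoeff (X : GLSMData N) (τ : ℂ) (a : Fin N → ℂ) (E : ℂ → ℂ) (z : ℂ)
    (e : Σ _ : Fin N, ℕ × ℂ) : ℂ :=
  E (X.lift τ e) * kahlerFactor τ z (X.lift τ e) / X.thetaQuot τ a e (X.lift τ e)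

/-- Lagrange interpolation. -/
theorem isInterpolation_sum (hτ : 0 < τ.im) (ha : X.GenericParam τ a) (E : ℂ → ℂ) {z : ℂ}
    (hz : X.GenericKahler τ a z) :
    X.IsInterpolation τ a E z fun s =>
      ∑ e ∈ X.fixedIndex a, X.interpCoeff τ a E z e * X.elemSection τ a z e s where
  isSection :=
    { holo := DifferentiableOn.fun_sum fun e he =>
        (isSection_elemSection hτ ha hz.1 he).holo.const_mul _
      quasi := fun s hs => by
        rw [Finset.sum_mul, Finset.mul_sum]
        refine Finset.sum_congr rfl fun e he => ?_
        linear_combination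
          X.interpCoeff τ a E z e * (isSection_elemSection hτ ha hz.1 he).quasi s hs }
  interp s hs := by
    obtain ⟨e, he, rfl⟩ := mem_lifts_iff.1 hs
    rw [Finset.sum_eq_single_of_mem e he fun e' he' hne => by
      rw [elemSection, thetaQuot_lift_eq_zero hτ ha he' he hne.symm, mul_zero, mul_zero]]
    have h1 := thetaQuot_lift_ne_zero hτ ha he
    have h2 := qtheta_inv_ne_zero_of_genericKahler hτ hz
    rw [elemSection, mul_inv_cancel₀ (lift_ne_zero ha he), one_mul, div_self h2, one_mul,
      interpCoeff, div_mul_cancel₀ _ h1]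

/-- The factor of automorphy of `thetaPos`. Only its continuity and nonvanishing matter, so it is
left implicit. -/
theorem exists_thetaPos_nomeQ_mul (hτ : 0 < τ.im) (ha : X.GenericParam τ a) :
    ∃ g : ℂ → ℂ, (∀ s, s ≠ 0 → g s ≠ 0 ∧ ContinuousAt g s) ∧
      ∀ s, s ≠ 0 → X.thetaPos τ a (nomeQ τ * s) = g s * X.thetaPos τ a s := by
  choose c hc h using fun i => exists_qtheta_zpow_mul hτ (-X.D i)
  refine ⟨fun s => ∏ i ∈ X.pos, c i * ((X.U a i s)⁻¹ * qpow τ (X.r i)) ^ X.D i,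
    fun s hs => ⟨?_, ?_⟩, fun s hs => ?_⟩
  · exact Finset.prod_ne_zero_iff.2 fun i _ =>
      mul_ne_zero (hc i) (zpow_ne_zero _ (inv_U_mul_qpow_ne_zero ha i hs _))
  · refine tendsto_finsetProd _ fun i _ => ?_
    exact (((differentiableAt_inv_U i hs).continuousAt.mul continuousAt_const).zpow₀ _
      (Or.inl (inv_U_mul_qpow_ne_zero ha i hs _))).const_mul _
  · rw [thetaPos, thetaPos, ← Finset.prod_mul_distrib]
    refine Finset.prod_congr rfl fun i _ => ?_
    have := h i _ (inv_U_mul_qpow_ne_zero ha i hs (X.r i))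
    rw [neg_neg] at this
    rw [← this, U_mul, mul_inv, zpow_neg, mul_assoc]

theorem eventually_thetaPos_ne_zero (hτ : 0 < τ.im) (ha : X.GenericParam τ a) {s : ℂ}
    (hs : s ≠ 0) : ∀ᶠ t in 𝓝[≠] s, X.thetaPos τ a t ≠ 0 :=
  eventually_ne_zero_of_simple_zero (differentiableAt_thetaPos hτ ha hs)
    (deriv_thetaPos_ne_zero hτ ha hs)

theorem eventually_ne_zero_punctured {s : ℂ} (hs : s ≠ 0) : ∀ᶠ t in 𝓝[≠] s, t ≠ 0 :=
  (eventually_ne_nhds hs).filter_mono nhdsWithin_le_nhds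

/-- The condition `IsSection.quasi` holds as an honest functional equation everywhere on `ℂˣ`: it
can be divided by the reference section away from the zeros and poles of the latter, and both sides
are continuous. -/
theorem IsSection.nomeQ_mul_eq (hτ : 0 < τ.im) (ha : X.GenericParam τ a) {z : ℂ}
    (hz : X.GenericKahler τ a z) {F : ℂ → ℂ} (hF : X.IsSection τ a z F) {g : ℂ → ℂ}
    (hg : ∀ s, s ≠ 0 → g s ≠ 0 ∧ ContinuousAt g s)
    (h : ∀ s, s ≠ 0 → X.thetaPos τ a (nomeQ τ * s) = g s * X.thetaPos τ a s) {s : ℂ}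
    (hs : s ≠ 0) : F (nomeQ τ * s) = z * g s * F s := by
  have hFc : ∀ s, s ≠ 0 → ContinuousAt F s := fun s hs =>
    (hF.holo.differentiableAt (isOpen_compl_singleton.mem_nhds hs)).continuousAt
  refine eq_of_eventually_eq_punctured (f := fun t => F (nomeQ τ * t))
    (g := fun t => z * g t * F t)
    (ContinuousAt.comp (f := fun t => nomeQ τ * t) (hFc _ (mul_ne_zero (nomeQ_ne_zero τ) hs))
      (continuousAt_const.mul continuousAt_id))
    ((continuousAt_const.mul (hg s hs).2).mul (hFc s hs)) ?_
  filter_upwards [eventually_thetaPos_ne_zero hτ ha hs, eventually_ne_zero_punctured hs,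
    eventually_qtheta_mul_ne_zero hτ one_ne_zero hs,
    eventually_qtheta_mul_ne_zero hτ (inv_ne_zero hz.1) hs] with t h1 h2 h3 h4
  have h5 := hF.quasi t h2
  have h6 := kronecker_zpow_mul hτ hz.1 h2 1
  rw [zpow_one, zpow_one] at h6
  rw [refSection_eq, refSection_eq, h6, h t h2] at h5
  rw [mul_one] at h3
  have h7 : kronecker τ z t * X.thetaPos τ a t ≠ 0 :=
    mul_ne_zero (div_ne_zero h4 (mul_ne_zero h3 (qtheta_inv_ne_zero_of_genericKahler hτ hz))) h1
  refine mul_right_cancel₀ h7 ?_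
  linear_combination h5

/-- The difference of two interpolations vanishes on the elliptic locus, hence it is divisible by
`thetaPos`. The quotient is a section of the degree zero line bundle with multiplier `z`, which has
no nonzero ones. -/
theorem IsInterpolation.unique (hτ : 0 < τ.im) (ha : X.GenericParam τ a) {E : ℂ → ℂ} {z : ℂ}
    (hz : X.GenericKahler τ a z) {F F' : ℂ → ℂ} (hF : X.IsInterpolation τ a E z F)
    (hF' : X.IsInterpolation τ a E z F') : Set.EqOn F F' {0}ᶜ := by
  have hq := nomeQ_ne_zero τ
  obtain ⟨g, hg, h⟩ := exists_thetaPos_nomeQ_mul hτ ha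
  set H : ℂ → ℂ := fun s => F s - F' s with hH
  have hHq : ∀ s, s ≠ 0 → H (nomeQ τ * s) = z * g s * H s := fun s hs => by
    simp only [hH, hF.isSection.nomeQ_mul_eq hτ ha hz hg h hs,
      hF'.isSection.nomeQ_mul_eq hτ ha hz hg h hs]
    ring
  have hHd : DifferentiableOn ℂ H {0}ᶜ := hF.isSection.holo.sub hF'.isSection.holo
  have hiff : ∀ s, s ≠ 0 → (H (nomeQ τ * s) = 0 ↔ H s = 0) := fun s hs => by
    rw [hHq s hs]; simp [hz.1, (hg s hs).1]
  have hzpow : ∀ (n : ℤ) (s : ℂ), s ≠ 0 → H s = 0 → H (nomeQ τ ^ n * s) = 0 := by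
    intro n s hs h0
    induction n using Int.induction_on with
    | zero => simpa using h0
    | succ n ih =>
      rw [zpow_add_one₀ hq, mul_comm _ (nomeQ τ), mul_assoc]
      exact (hiff _ (mul_ne_zero (zpow_ne_zero _ hq) hs)).2 ih
    | pred n ih =>
      refine (hiff _ (mul_ne_zero (zpow_ne_zero _ hq) hs)).1 ?_
      rwa [← mul_assoc, ← zpow_one_add₀ hq, add_sub_cancel]
  obtain ⟨f, hf, hfH⟩ := exists_differentiableOn_mul_eq isOpen_compl_singleton hHd
    (differentiableOn_thetaPos hτ ha) fun s hs h0 => ⟨by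
      obtain ⟨e, he, n, rfl⟩ := exists_eq_zpow_mul_lift hτ ha ((thetaPos_eq_zero_iff hτ ha hs).1 h0)
      refine hzpow n _ (lift_ne_zero ha he) ?_
      have hl : X.lift τ e ∈ X.lifts τ a := mem_lifts_iff.2 ⟨e, he, rfl⟩
      simp only [hH, hF.interp _ hl, hF'.interp _ hl, sub_self],
      deriv_thetaPos_ne_zero hτ ha hs h0⟩
  have hfc : ∀ s, s ≠ 0 → ContinuousAt f s := fun s hs =>
    (hf.differentiableAt (isOpen_compl_singleton.mem_nhds hs)).continuousAt
  intro s hs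
  have hfs : f s = 0 := by
    refine eq_zero_of_nomeQ_mul_eq hτ hz.1 hz.2.1 hf (fun s hs => ?_) hs
    refine eq_of_eventually_eq_punctured (f := fun t => f (nomeQ τ * t)) (g := fun t => z * f t)
      (ContinuousAt.comp (f := fun t => nomeQ τ * t) (hfc _ (mul_ne_zero hq hs))
        (continuousAt_const.mul continuousAt_id)) (continuousAt_const.mul (hfc s hs)) ?_
    filter_upwards [eventually_thetaPos_ne_zero hτ ha hs, eventually_ne_zero_punctured hs]
      with t h1 h2
    have h3 := hfH _ (mul_ne_zero hq h2)
    rw [hHq t h2, ← hfH t h2, h t h2] at h3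
    refine mul_right_cancel₀ (mul_ne_zero (hg t h2).1 h1) ?_
    linear_combination h3
  have := hfH s hs
  rw [hfs, zero_mul] at this
  exact sub_eq_zero.1 this.symm

end GLSMData

/-! ### The Gamma class integrand and its contour integrals -/

namespace GLSMData

variable {N : ℕ} (X : GLSMData N) (τ : ℂ) (a : Fin N → ℂ)

/-- The factor `∏_{i ∈ V₊} φ(Uᵢ⁻¹ q^{rᵢ})` of the denominator of `gammaQ`. -/
def phiPos (s : ℂ) : ℂ := ∏ i ∈ X.pos, qphi τ ((X.U a i s)⁻¹ * qpow τ (X.r i))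

/-- The factor `∏_{i ∈ V₋} φ(Uᵢ⁻¹ q^{rᵢ})` of the denominator of `gammaQ`. -/
def phiNeg (s : ℂ) : ℂ :=
  ∏ i ∈ Finset.univ.filter fun i => ¬ 0 < X.D i, qphi τ ((X.U a i s)⁻¹ * qpow τ (X.r i))

/-- The product of `gammaQ` and the elliptic Euler class of `V₊`. It is holomorphic in a disc about
the origin, the origin included: at `0` the junk value `0⁻¹ = 0` is the right one, as `Uᵢ` for `i`
in `V₊` and `Uᵢ⁻¹` for `i` in `V₋` tend to zero. -/
def gammaTheta (s : ℂ) : ℂ :=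
  (∏ i ∈ X.pos, qphi τ (nomeQ τ / ((X.U a i s)⁻¹ * qpow τ (X.r i)))) / X.phiNeg τ a s

variable {X τ a}

theorem gammaQ_eq (s : ℂ) : X.gammaQ τ a s = 1 / (X.phiPos τ a s * X.phiNeg τ a s) := by
  rw [gammaQ, phiPos, phiNeg, pos, Finset.prod_filter_mul_prod_filter_not]

theorem thetaPos_eq_phiPos_mul (s : ℂ) :
    X.thetaPos τ a s =
      X.phiPos τ a s * ∏ i ∈ X.pos, qphi τ (nomeQ τ / ((X.U a i s)⁻¹ * qpow τ (X.r i))) := by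
  rw [thetaPos, phiPos, ← Finset.prod_mul_distrib]
  rfl

theorem gammaQ_mul_thetaPos {s : ℂ} (h : X.phiPos τ a s ≠ 0) :
    X.gammaQ τ a s * X.thetaPos τ a s = X.gammaTheta τ a s := by
  rw [gammaQ_eq, thetaPos_eq_phiPos_mul, gammaTheta]
  field_simp

theorem phiPos_ne_zero_of_thetaPos_ne_zero {s : ℂ} (h : X.thetaPos τ a s ≠ 0) :
    X.phiPos τ a s ≠ 0 := by
  rw [thetaPos_eq_phiPos_mul] at h
  exact left_ne_zero_of_mul h

theorem phiPos_ne_zero {δ : ℝ} (hsep : X.Separates τ a δ) {s : ℂ} (hs : s ≠ 0) (h : δ ≤ ‖s‖) :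
    X.phiPos τ a s ≠ 0 :=
  Finset.prod_ne_zero_iff.2 fun i hi h0 =>
    absurd ((hsep i s hs h0).1 (mem_pos.1 hi)) (not_lt.2 h)

theorem phiNeg_ne_zero {δ : ℝ} (hsep : X.Separates τ a δ) {s : ℂ} (h : ‖s‖ ≤ δ) :
    X.phiNeg τ a s ≠ 0 := by
  refine Finset.prod_ne_zero_iff.2 fun i hi h0 => ?_
  have hD : X.D i < 0 :=
    lt_of_le_of_ne (not_lt.1 (Finset.mem_filter.1 hi).2) (X.D_ne_zero i)
  by_cases hs : s = 0
  · rw [hs, U, zero_zpow _ (X.D_ne_zero i), mul_zero, inv_zero, zero_mul, qphi_zero] at h0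
    exact one_ne_zero h0
  · exact absurd ((hsep i s hs h0).2 hD) (not_lt.2 h)

theorem differentiableAt_phiPos (hτ : 0 < τ.im) {s : ℂ} (hs : s ≠ 0) :
    DifferentiableAt ℂ (X.phiPos τ a) s :=
  DifferentiableAt.fun_finsetProd fun i _ =>
    ((differentiable_qphi hτ) _).comp s ((differentiableAt_inv_U i hs).mul_const _)

theorem differentiable_phiNeg (hτ : 0 < τ.im) : Differentiable ℂ (X.phiNeg τ a) := fun s => by
  refine DifferentiableAt.fun_finsetProd fun i hi =>
    ((differentiable_qphi hτ) _).comp s (DifferentiableAt.mul_const ?_ _)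
  have h : (fun t => (X.U a i t)⁻¹) = fun t => (a i)⁻¹ * t ^ (-X.D i) := by
    funext t
    simp only [U, mul_inv, zpow_neg]
  rw [h]
  refine (differentiableAt_zpow.2 (Or.inr ?_)).const_mul _
  have := (Finset.mem_filter.1 hi).2
  omega

theorem differentiableAt_gammaTheta (hτ : 0 < τ.im) {s : ℂ} (h : X.phiNeg τ a s ≠ 0) :
    DifferentiableAt ℂ (X.gammaTheta τ a) s := by
  refine DifferentiableAt.div (DifferentiableAt.fun_finsetProd fun i hi => ?_)
    (differentiable_phiNeg hτ s) h
  refine ((differentiable_qphi hτ) _).comp s ?_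
  have h : (fun t => nomeQ τ / ((X.U a i t)⁻¹ * qpow τ (X.r i))) =
      fun t => nomeQ τ * (a i * t ^ X.D i) / qpow τ (X.r i) := by
    funext t
    simp only [U, div_eq_mul_inv, mul_inv, inv_inv, mul_assoc]
  rw [h]
  have hz : DifferentiableAt ℂ (fun t : ℂ => t ^ X.D i) s :=
    differentiableAt_zpow.2 (Or.inr (mem_pos.1 hi).le)
  exact ((hz.const_mul _).const_mul _).div_const _

theorem differentiableAt_gammaQ (hτ : 0 < τ.im) {s : ℂ} (hs : s ≠ 0) (h1 : X.phiPos τ a s ≠ 0)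
    (h2 : X.phiNeg τ a s ≠ 0) : DifferentiableAt ℂ (X.gammaQ τ a) s := by
  have h : X.gammaQ τ a = fun t => 1 / (X.phiPos τ a t * X.phiNeg τ a t) := funext gammaQ_eq
  rw [h]
  exact (differentiableAt_const _).div
    ((differentiableAt_phiPos hτ hs).mul (differentiable_phiNeg hτ s)) (mul_ne_zero h1 h2)

/-- The substitution `s = δ exp (2πix)` turns `ds / (2πis)` into `dx`. -/
theorem contourIntegral_eq_torusTrace {δ : ℝ} (hδ : 0 < δ) (F : ℂ → ℂ) :
    X.contourIntegral τ a δ F = X.torusTrace τ a δ F := by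
  have hvol : (MeasureTheory.volume : MeasureTheory.Measure UnitAddCircle) =
      AddCircle.haarAddCircle := by
    rw [AddCircle.volume_eq_smul_haarAddCircle]
    simp
  set g : ℂ → ℂ := fun s => X.gammaQ τ a s * F s with hg
  have h1 : X.torusTrace τ a δ F =
      ∫ x in (0 : ℝ)..1, g (circleMap 0 δ (2 * Real.pi * x)) := by
    rw [torusTrace, ← hvol, ← UnitAddCircle.intervalIntegral_preimage 0, zero_add]
    refine intervalIntegral.integral_congr fun x _ => ?_
    simp only [hg, AddCircle.toCircle_apply_mk, Circle.coe_exp, circleMap_zero]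
    congr <;> simp
  have h2 : X.contourIntegral τ a δ F = (2 * Real.pi * Complex.I)⁻¹ *
      ∫ t in (0 : ℝ)..2 * Real.pi, Complex.I * g (circleMap 0 δ t) := by
    rw [contourIntegral, circleIntegral]
    congr 1
    refine intervalIntegral.integral_congr fun t _ => ?_
    have : circleMap 0 δ t ≠ 0 := by simp [hδ.ne']
    simp only [deriv_circleMap, smul_eq_mul, hg]
    field_simp
  have hpi : (2 * Real.pi : ℝ) ≠ 0 := by positivity
  rw [h1, h2, intervalIntegral.integral_const_mul,
    intervalIntegral.integral_comp_mul_left (fun t => g (circleMap 0 δ t)) hpi, mul_zero, mul_one,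
    Complex.real_smul]
  have := Complex.I_ne_zero
  push_cast
  field_simp

/-- The integrand `gammaQ * elemSection` is the product of a Kronecker function and `gammaTheta`. -/
theorem gammaQ_mul_elemSection (hτ : 0 < τ.im) (ha : X.GenericParam τ a)
    {e : Σ _ : Fin N, ℕ × ℂ} (he : e ∈ X.fixedIndex a) (z : ℂ) {s : ℂ} (hs : s ≠ 0)
    (h0 : qtheta τ (s * (X.lift τ e)⁻¹) ≠ 0) (h1 : X.phiPos τ a s ≠ 0) :
    X.gammaQ τ a s * X.elemSection τ a z e s =
      kronecker τ z (s * (X.lift τ e)⁻¹) * X.gammaTheta τ a s := by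
  rw [elemSection_eq_kronecker_mul hτ ha he z hs h0, ← gammaQ_mul_thetaPos h1]
  ring

/-- At the point `q ^ n p`, `p` the lift of the fixed point `(k, i, s₀)`, the function `gammaQ` has
a pole if and only if the degree `dₖ(n + i / Dₖ) = Dₖ n + i - rₖ` is not negative. -/
theorem phiPos_zpow_mul_lift_eq_zero_iff (hτ : 0 < τ.im) (ha : X.GenericParam τ a)
    {e : Σ _ : Fin N, ℕ × ℂ} (he : e ∈ X.fixedIndex a) (n : ℤ) :
    X.phiPos τ a (nomeQ τ ^ n * X.lift τ e) = 0 ↔ 0 ≤ X.D e.1 * n + e.2.1 - X.r e.1 := by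
  have hs := zpow_mul_lift_ne_zero (τ := τ) ha he n
  have hk := (mem_fixedIndex.1 he).1
  have key : qphi τ ((X.U a e.1 (nomeQ τ ^ n * X.lift τ e))⁻¹ * qpow τ (X.r e.1)) = 0 ↔
      0 ≤ X.D e.1 * n + e.2.1 - X.r e.1 := by
    rw [U_zpow_mul_lift ha he, qpow_intCast, ← zpow_neg, ← zpow_add₀ (nomeQ_ne_zero τ),
      qphi_nomeQ_zpow_eq_zero_iff hτ]
    constructor <;> intro <;> linarith
  rw [← key, phiPos, Finset.prod_eq_zero_iff]
  refine ⟨fun ⟨k, hk, h⟩ => ?_, fun h => ⟨e.1, hk, h⟩⟩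
  have h1 : qtheta τ (X.U a k (nomeQ τ ^ n * X.lift τ e))⁻¹ = 0 := by
    rw [← qtheta_U_shift_eq_zero_iff hτ ha k hs (X.r k), qtheta, h, zero_mul]
  obtain ⟨m, hm⟩ := (qtheta_inv_eq_zero_iff hτ (U_ne_zero ha k hs)).1 h1
  rwa [← eq_fst_of_U_zpow_mul_lift hτ ha he hm]

/-- The residue theorem for `gammaQ * elemSection`: the contour is moved to a circle of radius `ρ`
that separates the points `q ^ n p`, `n < m`, from the other ones. -/
theorem contourIntegral_elemSection (hτ : 0 < τ.im) (ha : X.GenericParam τ a) {z : ℂ}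
    (hz : X.GenericKahler τ a z) {e : Σ _ : Fin N, ℕ × ℂ} (he : e ∈ X.fixedIndex a) {δ : ℝ}
    (hsep : X.Separates τ a δ) {L m : ℤ} (hL : ∀ n, 0 ≤ X.D e.1 * n + e.2.1 - X.r e.1 → L ≤ n)
    {ρ : ℝ} (hρ0 : 0 < ρ) (hρδ : ρ ≤ δ) (hρ : ∀ n : ℤ, ρ < ‖nomeQ τ ^ n * X.lift τ e‖ ↔ n < m)
    (hρ' : ∀ n : ℤ, ‖nomeQ τ ^ n * X.lift τ e‖ ≠ ρ) (res : ℤ → ℂ)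
    (hres : ∀ n, 0 ≤ X.D e.1 * n + e.2.1 - X.r e.1 →
      Tendsto (fun s => (s - nomeQ τ ^ n * X.lift τ e) *
        (s⁻¹ * (X.gammaQ τ a s * X.elemSection τ a z e s)))
        (𝓝[≠] (nomeQ τ ^ n * X.lift τ e)) (𝓝 (res n))) :
    X.contourIntegral τ a δ (X.elemSection τ a z e) =
      (2 * Real.pi * Complex.I)⁻¹ * (∮ s in C(0, ρ),
        s⁻¹ * (kronecker τ z (s * (X.lift τ e)⁻¹) * X.gammaTheta τ a s)) +
      ∑ n ∈ (Finset.Ico L m).filter fun n => 0 ≤ X.D e.1 * n + e.2.1 - X.r e.1, res n := by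
  classical
  set p := X.lift τ e with hp
  have hp0 : p ≠ 0 := lift_ne_zero ha he
  have hδ : 0 < δ := hρ0.trans_le hρδ
  set P := (Finset.Ico L m).filter fun n => 0 ≤ X.D e.1 * n + e.2.1 - X.r e.1 with hP
  have hinj : Function.Injective fun n : ℤ => nomeQ τ ^ n * p := fun n n' h =>
    nomeQ_zpow_injective hτ (mul_right_cancel₀ hp0 h)
  set S : Finset ℂ := P.image fun n => nomeQ τ ^ n * p with hS
  -- the value where `phiPos` vanishes corrects the junk value of `gammaQ`
  set f : ℂ → ℂ := fun s => s⁻¹ * if X.phiPos τ a s ≠ 0 then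
    X.gammaQ τ a s * X.elemSection τ a z e s
    else kronecker τ z (s * p⁻¹) * X.gammaTheta τ a s with hf
  have hfpos : ∀ s, X.phiPos τ a s ≠ 0 → f s = s⁻¹ * (X.gammaQ τ a s * X.elemSection τ a z e s) :=
    fun s h => by simp only [hf, if_pos h]
  have hfθ : ∀ s, s ≠ 0 → qtheta τ (s * p⁻¹) ≠ 0 →
      f s = s⁻¹ * (kronecker τ z (s * p⁻¹) * X.gammaTheta τ a s) := fun s hs h => by
    by_cases h1 : X.phiPos τ a s ≠ 0
    · rw [hfpos s h1, gammaQ_mul_elemSection hτ ha he z hs h h1]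
    · simp only [hf, if_neg h1]
  have hkey := circleIntegral_sub_circleIntegral_eq_sum hρ0 hρδ S
    (fun s => ∑ n ∈ P, if nomeQ τ ^ n * p = s then res n else 0) f
    (by
      intro s hs
      obtain ⟨n, hn, rfl⟩ := Finset.mem_image.1 hs
      obtain ⟨hn1, hn2⟩ := Finset.mem_filter.1 hn
      refine ⟨(hρ n).2 (Finset.mem_Ico.1 hn1).2, lt_of_not_ge fun h => ?_⟩
      exact phiPos_ne_zero hsep (zpow_mul_lift_ne_zero ha he n) h
        ((phiPos_zpow_mul_lift_eq_zero_iff hτ ha he n).2 hn2))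
    (by
      intro s h1 h2 h3
      have hs : s ≠ 0 := norm_pos_iff.1 (hρ0.trans_le h1)
      have hneg := phiNeg_ne_zero hsep h2
      by_cases h4 : X.phiPos τ a s = 0
      · have h5 : qtheta τ (s * p⁻¹) ≠ 0 := by
          intro h5
          obtain ⟨n, rfl⟩ := (qtheta_mul_inv_lift_eq_zero_iff hτ ha he hs).1 h5
          refine h3 (Finset.mem_image.2 ⟨n, Finset.mem_filter.2 ⟨?_, ?_⟩, rfl⟩)
          · have h6 := (phiPos_zpow_mul_lift_eq_zero_iff hτ ha he n).1 h4
            exact Finset.mem_Ico.2 ⟨hL n h6, (hρ n).1 (lt_of_le_of_ne h1 (hρ' n).symm)⟩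
          · exact (phiPos_zpow_mul_lift_eq_zero_iff hτ ha he n).1 h4
        have h6 := differentiableAt_qtheta_mul hτ (inv_ne_zero hp0) hs
        have h7 := differentiableAt_qtheta_mul hτ
          (mul_ne_zero (inv_ne_zero hp0) (inv_ne_zero hz.1)) hs
        simp only [← mul_assoc] at h7
        have h8 : DifferentiableAt ℂ (fun t => kronecker τ z (t * p⁻¹)) s :=
          h7.div (h6.mul_const _) (mul_ne_zero h5 (qtheta_inv_ne_zero_of_genericKahler hτ hz))
        refine ((differentiableAt_inv hs).mul
          (h8.mul (differentiableAt_gammaTheta hτ hneg))).congr_of_eventuallyEq ?_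
        filter_upwards [h6.continuousAt.eventually_ne h5, eventually_ne_nhds hs] with t ht1 ht2
        exact hfθ t ht2 ht1
      · refine ((differentiableAt_inv hs).mul ((differentiableAt_gammaQ hτ hs h4 hneg).mul
          (differentiableAt_elemSection hτ ha hz.1 he hs))).congr_of_eventuallyEq ?_
        filter_upwards [(differentiableAt_phiPos hτ hs).continuousAt.eventually_ne h4] with t ht
        exact hfpos t ht)
    (by
      intro s hs
      obtain ⟨n, hn, rfl⟩ := Finset.mem_image.1 hs
      have h1 := hres n (Finset.mem_filter.1 hn).2
      simp only [hinj.eq_iff, Finset.sum_ite_eq', hn, if_true]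
      refine h1.congr' ?_
      filter_upwards [eventually_thetaPos_ne_zero hτ ha (zpow_mul_lift_ne_zero ha he n)] with t ht
      rw [hfpos t (phiPos_ne_zero_of_thetaPos_ne_zero ht)])
  have hR : (∮ s in C(0, δ), f s) =
      ∮ s in C(0, δ), s⁻¹ * (X.gammaQ τ a s * X.elemSection τ a z e s) :=
    circleIntegral.integral_congr hδ.le fun s hs => by
      have h1 := mem_sphere_zero_iff_norm.1 hs
      exact hfpos s (phiPos_ne_zero hsep (norm_pos_iff.1 (by rw [h1]; exact hδ)) h1.ge)
  have hr : (∮ s in C(0, ρ), f s) =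
      ∮ s in C(0, ρ), s⁻¹ * (kronecker τ z (s * p⁻¹) * X.gammaTheta τ a s) :=
    circleIntegral.integral_congr hρ0.le fun s hs => by
      have h1 := mem_sphere_zero_iff_norm.1 hs
      have h2 : s ≠ 0 := norm_pos_iff.1 (by rw [h1]; exact hρ0)
      refine hfθ s h2 fun h3 => ?_
      obtain ⟨n, rfl⟩ := (qtheta_mul_inv_lift_eq_zero_iff hτ ha he h2).1 h3
      exact hρ' n h1
  have hsum : ∑ s ∈ S, ∑ n ∈ P, (if nomeQ τ ^ n * p = s then res n else 0) = ∑ n ∈ P, res n := by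
    rw [hS, Finset.sum_image fun n _ n' _ h => hinj h]
    refine Finset.sum_congr rfl fun n hn => ?_
    simp only [hinj.eq_iff, Finset.sum_ite_eq', hn, if_true]
  rw [hR, hr, hsum] at hkey
  rw [contourIntegral, sub_eq_iff_eq_add.1 hkey, mul_add,
    inv_mul_cancel_left₀ Complex.two_pi_I_ne_zero, add_comm]

end GLSMData

/-! ### The terms of the central charge are residues -/

/-- Passing from `𝒪(x)` to `𝒪(x + 1)` on `ℙ¹` adds one weight to `H⁰` or removes it from `H¹`. -/
theorem detChi_add_one {τ u : ℂ} (hu : u ≠ 0) (x : ℚ) :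
    detChi τ u (x + 1) = u * qpow τ (-(x + 1)) * detChi τ u x := by
  have hne : ∀ y : ℚ, u * qpow τ y ≠ 0 := fun y => mul_ne_zero hu (qpow_ne_zero τ y)
  have hfr : Int.fract (x + 1) = Int.fract x := Int.fract_add_one x
  have hx : (⌊x⌋ : ℚ) + Int.fract x = x := Int.floor_add_fract x
  simp only [detChi, Int.floor_add_one, hfr]
  rcases le_or_gt (-1) ⌊x⌋ with h | h
  · -- one more factor in the numerator
    have h1 : (⌊x⌋ + 1 + 1).toNat = (⌊x⌋ + 1).toNat + 1 := by omega
    have h2 : (-(⌊x⌋ + 1) - 1).toNat = 0 := by omega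
    have h3 : (-⌊x⌋ - 1).toNat = 0 := by omega
    have h4 : -Int.fract x - (((⌊x⌋ + 1).toNat : ℕ) : ℚ) = -(x + 1) := by
      have h5 : (((⌊x⌋ + 1).toNat : ℕ) : ℚ) = ⌊x⌋ + 1 := by
        exact_mod_cast congrArg (Int.cast : ℤ → ℚ) (Int.toNat_of_nonneg (by omega : 0 ≤ ⌊x⌋ + 1))
      rw [h5]
      linarith
    rw [h1, h2, h3, Finset.prod_range_succ, h4]
    ring
  · -- one factor less in the denominator
    have h1 : (⌊x⌋ + 1 + 1).toNat = 0 := by omega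
    have h2 : (-⌊x⌋ - 1).toNat = (-(⌊x⌋ + 1) - 1).toNat + 1 := by omega
    have h3 : (⌊x⌋ + 1).toNat = 0 := by omega
    have h4 : (((-(⌊x⌋ + 1) - 1).toNat : ℕ) : ℚ) + 1 - Int.fract x = -(x + 1) := by
      have h5 : (((-(⌊x⌋ + 1) - 1).toNat : ℕ) : ℚ) = -(⌊x⌋ + 1) - 1 := by
        exact_mod_cast congrArg (Int.cast : ℤ → ℚ)
          (Int.toNat_of_nonneg (by omega : 0 ≤ -(⌊x⌋ + 1) - 1))
      rw [h5]
      linarith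
    rw [h1, h2, h3, Finset.prod_range_succ, h4]
    have h6 := qpow_ne_zero τ (-(x + 1))
    have h7 : ∏ k ∈ Finset.range (-(⌊x⌋ + 1) - 1).toNat, u * qpow τ (k + 1 - Int.fract x) ≠ 0 :=
      Finset.prod_ne_zero_iff.2 fun k _ => hne _
    field_simp

theorem detChi_ne_zero {τ u : ℂ} (hu : u ≠ 0) (x : ℚ) : detChi τ u x ≠ 0 :=
  div_ne_zero (Finset.prod_ne_zero_iff.2 fun _ _ => mul_ne_zero hu (qpow_ne_zero τ _))
    (Finset.prod_ne_zero_iff.2 fun _ _ => mul_ne_zero hu (qpow_ne_zero τ _))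

/-- The level factor transforms as a theta function under translation of the degree. -/
theorem detChi_add_intCast_mul_qtheta {τ u : ℂ} (hτ : 0 < τ.im) (hu : u ≠ 0) (x : ℚ) (n : ℤ) :
    (-1 : ℂ) ^ ⌊x + n⌋ * detChi τ u (x + n) * qtheta τ (u * qpow τ (-x)) =
      (-1 : ℂ) ^ ⌊x⌋ * detChi τ u x * qtheta τ (u * qpow τ (-(x + n))) := by
  have hone : (-1 : ℂ) ≠ 0 := by norm_num
  have step : ∀ y : ℚ, qtheta τ (u * qpow τ (-(y + 1))) =
      -(u * qpow τ (-(y + 1))) * qtheta τ (u * qpow τ (-y)) := fun y => by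
    have h := qtheta_div_nomeQ hτ (mul_ne_zero hu (qpow_ne_zero τ (-y)))
    have h1 : u * qpow τ (-y) / nomeQ τ = u * qpow τ (-(y + 1)) := by
      rw [nomeQ, mul_div_assoc, ← qpow_sub]
      congr 2
      ring
    rwa [h1] at h
  induction n using Int.induction_on with
  | zero => simp
  | succ n ih =>
    have h1 : x + ((n + 1 : ℤ) : ℚ) = (x + ((n : ℤ) : ℚ)) + 1 := by push_cast; ring
    rw [h1, step, detChi_add_one hu, Int.floor_add_one, zpow_add_one₀ hone]
    linear_combination -(u * qpow τ (-(x + ((n : ℤ) : ℚ) + 1))) * ih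
  | pred n ih =>
    have h1 : x + ((-(n : ℤ) : ℤ) : ℚ) = (x + ((-(n : ℤ) - 1 : ℤ) : ℚ)) + 1 := by push_cast; ring
    rw [h1, step, detChi_add_one hu, Int.floor_add_one, zpow_add_one₀ hone] at ih
    have h2 : -(u * qpow τ (-(x + ((-(n : ℤ) - 1 : ℤ) : ℚ) + 1))) ≠ 0 :=
      neg_ne_zero.2 (mul_ne_zero hu (qpow_ne_zero τ _))
    refine mul_left_cancel₀ h2 ?_
    linear_combination ih

namespace GLSMData

variable {N : ℕ} {X : GLSMData N} {τ : ℂ} {a : Fin N → ℂ}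

theorem levelDet_eq_prod (β : ℚ) (s : ℂ) :
    X.levelDet τ a β s =
      ∏ i ∈ X.pos, (-1 : ℂ) ^ ⌊X.deg i β⌋ * detChi τ (X.U a i s)⁻¹ (X.deg i β) := by
  have h : ∀ t : Finset (Fin N), (-1 : ℂ) ^ (∑ i ∈ t, ⌊X.deg i β⌋) =
      ∏ i ∈ t, (-1 : ℂ) ^ ⌊X.deg i β⌋ := fun t => by
    induction t using Finset.cons_induction with
    | empty => simp
    | cons i t hi ih => rw [Finset.sum_cons, Finset.prod_cons, zpow_add₀ (by norm_num), ih]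
  rw [levelDet, h, Finset.prod_mul_distrib]

theorem levelDet_ne_zero (ha : X.GenericParam τ a) (β : ℚ) {s : ℂ} (hs : s ≠ 0) :
    X.levelDet τ a β s ≠ 0 := by
  rw [levelDet_eq_prod]
  exact Finset.prod_ne_zero_iff.2 fun i _ => mul_ne_zero (zpow_ne_zero _ (by norm_num))
    (detChi_ne_zero (inv_ne_zero (U_ne_zero ha i hs)) _)

theorem inv_U_qpow_mul_mul (i : Fin N) (β : ℚ) (s : ℂ) :
    (X.U a i (qpow τ β * s))⁻¹ * qpow τ (X.r i) = (X.U a i s)⁻¹ * qpow τ (-X.deg i β) := by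
  have h : -X.deg i β = -(X.D i * β) + X.r i := by rw [deg]; ring
  rw [h, U_qpow_mul, mul_inv, qpow_add, qpow_neg]
  ring

/-- The level contribution and the elliptic Euler class of `V₊` have the same factor of
automorphy. -/
theorem levelDet_add_mul_thetaPos (hτ : 0 < τ.im) (ha : X.GenericParam τ a) (v : ℚ) (n : ℤ) {s : ℂ}
    (hs : s ≠ 0) :
    X.levelDet τ a (v + n) s * X.thetaPos τ a (qpow τ v * s) =
      X.levelDet τ a v s * X.thetaPos τ a (qpow τ (v + n) * s) := by
  simp only [levelDet_eq_prod, thetaPos, inv_U_qpow_mul_mul, ← Finset.prod_mul_distrib]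
  refine Finset.prod_congr rfl fun i _ => ?_
  have h : X.deg i (v + n) = X.deg i v + ((X.D i * n : ℤ) : ℚ) := by
    rw [deg, deg]
    push_cast
    ring
  rw [h]
  exact detChi_add_intCast_mul_qtheta hτ (inv_ne_zero (U_ne_zero ha i hs)) _ _

theorem fract_neg_deg (i : Fin N) (v : ℚ) (n : ℤ) :
    Int.fract (-X.deg i (v + n)) = age v (-X.D i) := by
  have h : -X.deg i (v + n) = ((-X.D i : ℤ) : ℚ) * v + ((X.r i - X.D i * n : ℤ) : ℚ) := by
    rw [deg]
    push_cast
    ring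
  rw [h, Int.fract_add_intCast, age]

theorem fract_sector_add {e : Σ _ : Fin N, ℕ × ℂ} (he : e ∈ X.fixedIndex a) (n : ℤ) :
    Int.fract (X.sector e + n) = X.sector e := by
  rw [Int.fract_add_intCast, Int.fract_eq_self.2 ⟨sector_nonneg he, sector_lt_one he⟩]

theorem floor_sector_add {e : Σ _ : Fin N, ℕ × ℂ} (he : e ∈ X.fixedIndex a) (n : ℤ) :
    ⌊X.sector e + n⌋ = n := by
  rw [Int.floor_add_intCast, Int.floor_eq_zero_iff.2 ⟨sector_nonneg he, sector_lt_one he⟩,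
    zero_add]

theorem qpow_sector_add_mul (e : Σ _ : Fin N, ℕ × ℂ) (n : ℤ) (t : ℂ) :
    qpow τ (X.sector e + n) * t = nomeQ τ ^ n * (qpow τ (X.sector e) * t) := by
  rw [qpow_add, qpow_intCast]
  ring

theorem gammaQ_qpow_mul (β : ℚ) (s : ℂ) :
    X.gammaQ τ a (qpow τ β * s) = 1 / ∏ i, qphi τ ((X.U a i s)⁻¹ * qpow τ (-X.deg i β)) := by
  simp only [gammaQ, inv_U_qpow_mul_mul]

/-- Near the point `s₀` of a fixed point, the product of the I-function and the Gamma class is the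
integrand of the contour integral up to a function without zeros and poles and the Koszul factor of
the sector. -/
theorem ITerm_mul_gammaClass_eq (hτ : 0 < τ.im) (ha : X.GenericParam τ a) {z : ℂ}
    (hz : X.GenericKahler τ a z) {e : Σ _ : Fin N, ℕ × ℂ} (he : e ∈ X.fixedIndex a) (n : ℤ) {t : ℂ}
    (ht : t ≠ 0) (h1 : X.thetaPos τ a (qpow τ (X.sector e) * t) ≠ 0)
    (h2 : ∀ i, qphi τ ((X.U a i t)⁻¹ * qpow τ (age (X.sector e) (-X.D i))) ≠ 0)
    (h3 : X.elemSection τ a z e (qpow τ (X.sector e) * t) ≠ 0) :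
    X.ITerm τ a z (X.sector e + n) t * X.gammaClass τ a (X.sector e) t =
      kahlerFactor τ z (qpow τ (X.sector e) * t) /
        X.elemSection τ a z e (qpow τ (X.sector e) * t) *
      ((∏ i ∈ X.posFixed (X.sector e), (1 - (X.U a i t)⁻¹)) *
        (X.gammaQ τ a (qpow τ (X.sector e + n) * t) *
          X.elemSection τ a z e (qpow τ (X.sector e + n) * t))) := by
  set v := X.sector e with hv
  have hvt : qpow τ v * t ≠ 0 := mul_ne_zero (qpow_ne_zero τ v) ht
  have hF := elemSection_zpow_mul hτ ha hz.1 he n hvt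
  rw [hv, ← qpow_sector_add_mul, ← hv] at hF
  have hlev := levelDet_add_mul_thetaPos hτ ha v n ht
  have hlv := levelDet_ne_zero ha v ht
  have hA : ∏ i, qphi τ ((X.U a i t)⁻¹ * qpow τ (age v (-X.D i))) ≠ 0 :=
    Finset.prod_ne_zero_iff.2 fun i _ => h2 i
  have hratio : X.elemSection τ a z e (qpow τ (v + n) * t) /
      X.elemSection τ a z e (qpow τ v * t) =
      z ^ n * (X.levelDet τ a (v + n) t * (X.levelDet τ a v t)⁻¹) := by
    rw [← div_eq_mul_inv, ← mul_div_assoc, div_eq_div_iff h3 hlv]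
    refine mul_right_cancel₀ h1 ?_
    linear_combination X.levelDet τ a v t * hF - z ^ n * X.elemSection τ a z e (qpow τ v * t) * hlev
  rw [ITerm, gammaClass, hv, fract_sector_add he, floor_sector_add he, ← hv,
    Finset.prod_div_distrib]
  simp only [fract_neg_deg]
  rw [gammaQ_qpow_mul]
  trans kahlerFactor τ z (qpow τ v * t) *
      (z ^ n * (X.levelDet τ a (v + n) t * (X.levelDet τ a v t)⁻¹)) *
      (∏ i ∈ X.posFixed v, (1 - (X.U a i t)⁻¹)) *
      (1 / ∏ i, qphi τ ((X.U a i t)⁻¹ * qpow τ (-X.deg i (v + n))))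
  · generalize ∏ i, qphi τ ((X.U a i t)⁻¹ * qpow τ (age v (-X.D i))) = A at hA
    field_simp
  · rw [← hratio]
    ring

/-- The summand of the Euler characteristic `chargeTerm` at the fixed point `e`, in the degree
`sector e + n`. -/
def chargeSummand (X : GLSMData N) (τ : ℂ) (a : Fin N → ℂ) (E : ℂ → ℂ) (z : ℂ)
    (e : Σ _ : Fin N, ℕ × ℂ) (n : ℤ) : ℂ :=
  1 / (X.D e.1 : ℂ) * (X.HTerm τ a z (X.sector e + n) e.2.2 * chOrb τ E (X.sector e) e.2.2 /
    ∏ j ∈ (X.posFixed (X.sector e)).erase e.1, (1 - (X.U a j e.2.2)⁻¹))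

theorem fst_mem_posFixed {e : Σ _ : Fin N, ℕ × ℂ} (he : e ∈ X.fixedIndex a) :
    e.1 ∈ X.posFixed (X.sector e) := by
  rw [posFixed, Finset.mem_filter, age, D_mul_sector]
  exact ⟨(mem_fixedIndex.1 he).1, Int.fract_natCast _⟩

/-- By genericity of the equivariant parameters, the denominators of the Euler characteristic do not
vanish. -/
theorem prod_erase_ne_zero (hτ : 0 < τ.im) (ha : X.GenericParam τ a)
    {e : Σ _ : Fin N, ℕ × ℂ} (he : e ∈ X.fixedIndex a) (s : Finset (Fin N)) :
    ∏ j ∈ s.erase e.1, (1 - (X.U a j e.2.2)⁻¹) ≠ 0 := by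
  refine Finset.prod_ne_zero_iff.2 fun j hj h0 => ?_
  have h1 : X.U a j e.2.2 = 1 := by rw [← inv_inv (X.U a j e.2.2), ← sub_eq_zero.1 h0, inv_one]
  exact ha.U_ne hτ (mem_fixedIndex.1 he).1 (Finset.ne_of_mem_erase hj)
    (ne_zero_of_mem_fixedIndex ha he) (n := 0) (by rw [U_point ha he, zpow_zero]) 0
    (by rw [h1, zpow_zero])

theorem phiNeg_zpow_mul_lift_ne_zero (hτ : 0 < τ.im) (ha : X.GenericParam τ a)
    {e : Σ _ : Fin N, ℕ × ℂ} (he : e ∈ X.fixedIndex a) (n : ℤ) :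
    X.phiNeg τ a (nomeQ τ ^ n * X.lift τ e) ≠ 0 := by
  have hs := zpow_mul_lift_ne_zero (τ := τ) ha he n
  have hk := (mem_fixedIndex.1 he).1
  refine Finset.prod_ne_zero_iff.2 fun j hj h0 => ?_
  have h1 : qtheta τ (X.U a j (nomeQ τ ^ n * X.lift τ e))⁻¹ = 0 := by
    rw [← qtheta_U_shift_eq_zero_iff hτ ha j hs (X.r j), qtheta, h0, zero_mul]
  obtain ⟨m, hm⟩ := (qtheta_inv_eq_zero_iff hτ (U_ne_zero ha j hs)).1 h1
  have hj' := (Finset.mem_filter.1 hj).2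
  rw [eq_fst_of_U_zpow_mul_lift hτ ha he hm] at hj'
  exact hj' (mem_pos.1 hk)

/-- The poles of `gammaQ` at the points `q ^ n p` are simple. -/
theorem exists_tendsto_mul_gammaQ (hτ : 0 < τ.im) (ha : X.GenericParam τ a)
    {e : Σ _ : Fin N, ℕ × ℂ} (he : e ∈ X.fixedIndex a) {n : ℤ}
    (hn : 0 ≤ X.D e.1 * n + e.2.1 - X.r e.1) :
    ∃ l : ℂ, Tendsto (fun s => (s - nomeQ τ ^ n * X.lift τ e) * X.gammaQ τ a s)
      (𝓝[≠] (nomeQ τ ^ n * X.lift τ e)) (𝓝 l) := by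
  set P := nomeQ τ ^ n * X.lift τ e with hP
  have hP0 : P ≠ 0 := zpow_mul_lift_ne_zero ha he n
  have hpos : X.phiPos τ a P = 0 := (phiPos_zpow_mul_lift_eq_zero_iff hτ ha he n).2 hn
  have hneg : X.phiNeg τ a P ≠ 0 := phiNeg_zpow_mul_lift_ne_zero hτ ha he n
  have hd := (differentiableAt_phiPos (X := X) (a := a) hτ hP0).hasDerivAt
  have hne : deriv (X.phiPos τ a) P ≠ 0 := fun h0 => by
    -- otherwise the zero of `thetaPos` at `P` is not simple
    have hdual : DifferentiableAt ℂ
        (fun s => ∏ i ∈ X.pos, qphi τ (nomeQ τ / ((X.U a i s)⁻¹ * qpow τ (X.r i)))) P :=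
      DifferentiableAt.fun_finsetProd fun i _ => ((differentiable_qphi hτ) _).comp P
        ((differentiableAt_const _).div ((differentiableAt_inv_U i hP0).mul_const _)
          (inv_U_mul_qpow_ne_zero ha i hP0 _))
    have h1 := hd.fun_mul hdual.hasDerivAt
    rw [h0, hpos, zero_mul, zero_mul, add_zero] at h1
    have h2 : X.thetaPos τ a = fun s => X.phiPos τ a s *
        ∏ i ∈ X.pos, qphi τ (nomeQ τ / ((X.U a i s)⁻¹ * qpow τ (X.r i))) :=
      funext thetaPos_eq_phiPos_mul
    refine deriv_thetaPos_ne_zero hτ ha hP0 (by rw [thetaPos_eq_phiPos_mul, hpos, zero_mul]) ?_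
    rw [h2]
    exact h1.deriv
  have h := hd.fun_mul (differentiable_phiNeg (X := X) (a := a) hτ P).hasDerivAt
  rw [hpos, zero_mul, add_zero] at h
  refine ⟨_, (tendsto_sub_div_of_simple_zero h (by rw [hpos, zero_mul])
    (mul_ne_zero hne hneg)).congr fun s => ?_⟩
  rw [gammaQ_eq, mul_one_div]

/-- The value of `HTerm` at the point `s₀` of a fixed point, the singularity being removed by a
limit of the corresponding expression in the integrand of the contour integral. -/
theorem HTerm_eq_of_tendsto (hτ : 0 < τ.im) (ha : X.GenericParam τ a) {z : ℂ}
    (hz : X.GenericKahler τ a z) {e : Σ _ : Fin N, ℕ × ℂ} (he : e ∈ X.fixedIndex a) (n : ℤ) {h : ℂ}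
    (hlim : Tendsto (fun t => (∏ i ∈ X.posFixed (X.sector e), (1 - (X.U a i t)⁻¹)) *
        (X.gammaQ τ a (qpow τ (X.sector e + n) * t) *
          X.elemSection τ a z e (qpow τ (X.sector e + n) * t))) (𝓝[≠] e.2.2) (𝓝 h)) :
    X.HTerm τ a z (X.sector e + n) e.2.2 =
      kahlerFactor τ z (X.lift τ e) / X.thetaQuot τ a e (X.lift τ e) * h := by
  have hs0 := ne_zero_of_mem_fixedIndex ha he
  have hp0 : X.lift τ e ≠ 0 := lift_ne_zero ha he
  set v := X.sector e with hv
  have hmul : ContinuousAt (fun t => qpow τ v * t) e.2.2 := by fun_prop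
  have hF : ContinuousAt (fun t => X.elemSection τ a z e (qpow τ v * t)) e.2.2 :=
    ContinuousAt.comp (f := fun t => qpow τ v * t)
      (differentiableAt_elemSection hτ ha hz.1 he hp0).continuousAt hmul
  have hFp : X.elemSection τ a z e (qpow τ v * e.2.2) = X.thetaQuot τ a e (X.lift τ e) := by
    change X.elemSection τ a z e (X.lift τ e) = _
    rw [elemSection, mul_inv_cancel₀ hp0, one_mul,
      div_self (qtheta_inv_ne_zero_of_genericKahler hτ hz), one_mul]
  have hW := thetaQuot_lift_ne_zero hτ ha he
  have hk : ContinuousAt (fun t => kahlerFactor τ z (qpow τ v * t)) e.2.2 := by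
    refine ContinuousAt.comp (f := fun t => qpow τ v * t) (g := kahlerFactor τ z) ?_ hmul
    have h1 : ContinuousAt (fun y : ℂ => y⁻¹ * z⁻¹) (X.lift τ e) :=
      (continuousAt_inv₀ hp0).mul_const _
    exact continuousAt_const.div (ContinuousAt.comp (g := qtheta τ) (differentiableAt_qtheta hτ
      (mul_ne_zero (inv_ne_zero hp0) (inv_ne_zero hz.1))).continuousAt h1)
      (qtheta_inv_mul_inv_ne_zero_of_genericKahler hτ ha hz (lift_mem_ellLocus hτ ha he))
  have hkF := ((hk.div hF (by rw [hFp]; exact hW)).tendsto.mono_left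
    nhdsWithin_le_nhds).mul hlim
  simp only [Pi.div_apply, hFp] at hkF
  rw [HTerm]
  refine Tendsto.limUnder_eq (hkF.congr' ?_)
  have hΘ : ∀ᶠ t in 𝓝[≠] e.2.2, X.thetaPos τ a (qpow τ v * t) ≠ 0 := by
    simp only [thetaPos, inv_U_qpow_mul_mul, Finset.prod_ne_zero_iff]
    exact (Finset.eventually_all _).2 fun i _ => eventually_ne_zero_of_simple_zero
      (differentiableAt_qtheta_U hτ ha i hs0 _) (deriv_qtheta_U_ne_zero hτ ha i hs0 _)
  have hφ : ∀ᶠ t in 𝓝[≠] e.2.2, ∀ i,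
      qphi τ ((X.U a i t)⁻¹ * qpow τ (age v (-X.D i))) ≠ 0 :=
    eventually_all.2 fun i => (eventually_ne_zero_of_simple_zero
      (differentiableAt_qtheta_U hτ ha i hs0 _) (deriv_qtheta_U_ne_zero hτ ha i hs0 _)).mono
      fun t ht => qphi_ne_zero_of_qtheta_ne_zero ht
  filter_upwards [hΘ, hφ, (hF.eventually_ne (by rw [hFp]; exact hW)).filter_mono
    nhdsWithin_le_nhds, eventually_ne_zero_punctured hs0] with t h1 h2 h3 h4
  rw [hv, fract_sector_add he]
  exact (ITerm_mul_gammaClass_eq hτ ha hz he n h4 h1 h2 h3).symm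

theorem prod_posFixed_eq {e : Σ _ : Fin N, ℕ × ℂ} (he : e ∈ X.fixedIndex a) (t : ℂ) :
    ∏ i ∈ X.posFixed (X.sector e), (1 - (X.U a i t)⁻¹) = (1 - (X.U a e.1 t)⁻¹) *
      ∏ i ∈ (X.posFixed (X.sector e)).erase e.1, (1 - (X.U a i t)⁻¹) :=
  (Finset.mul_prod_erase _ _ (fst_mem_posFixed he)).symm

theorem continuousAt_prod_one_sub_inv_U {s : ℂ} (hs : s ≠ 0) (t : Finset (Fin N)) :
    ContinuousAt (fun s => ∏ i ∈ t, (1 - (X.U a i s)⁻¹)) s :=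
  tendsto_finsetProd _ fun i _ =>
    continuousAt_const.sub (differentiableAt_inv_U (X := X) (a := a) i hs).continuousAt

/-- In the degrees with `dₖ < 0` the integrand has no pole at `q ^ n p`, and the Koszul factor
`1 - Uₖ⁻¹` of the sector vanishes at `s₀`. -/
theorem chargeSummand_eq_zero (hτ : 0 < τ.im) (ha : X.GenericParam τ a) (E : ℂ → ℂ) {z : ℂ}
    (hz : X.GenericKahler τ a z) {e : Σ _ : Fin N, ℕ × ℂ} (he : e ∈ X.fixedIndex a) {n : ℤ}
    (hn : X.D e.1 * n + e.2.1 - X.r e.1 < 0) : X.chargeSummand τ a E z e n = 0 := by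
  have hs0 := ne_zero_of_mem_fixedIndex ha he
  have hP0 : nomeQ τ ^ n * X.lift τ e ≠ 0 := zpow_mul_lift_ne_zero ha he n
  have hP : qpow τ (X.sector e + n) * e.2.2 = nomeQ τ ^ n * X.lift τ e := qpow_sector_add_mul e n _
  have hmul : ContinuousAt (fun t => qpow τ (X.sector e + n) * t) e.2.2 := by fun_prop
  have hpos : X.phiPos τ a (nomeQ τ ^ n * X.lift τ e) ≠ 0 := fun h =>
    absurd ((phiPos_zpow_mul_lift_eq_zero_iff hτ ha he n).1 h) (not_le.2 hn)
  have h1 : ContinuousAt (fun s => X.gammaQ τ a s * X.elemSection τ a z e s)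
      (qpow τ (X.sector e + n) * e.2.2) := by
    rw [hP]
    exact ((differentiableAt_gammaQ hτ hP0 hpos (phiNeg_zpow_mul_lift_ne_zero hτ ha he n)).mul
      (differentiableAt_elemSection hτ ha hz.1 he hP0)).continuousAt
  have h2 := (continuousAt_prod_one_sub_inv_U (X := X) (a := a) hs0
    (X.posFixed (X.sector e))).mul
    (ContinuousAt.comp (f := fun t => qpow τ (X.sector e + n) * t) h1 hmul)
  have h3 := HTerm_eq_of_tendsto hτ ha hz he n (h2.tendsto.mono_left nhdsWithin_le_nhds)
  simp only [Pi.mul_apply, prod_posFixed_eq he, U_point ha he, inv_one, sub_self, zero_mul,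
    mul_zero] at h3
  rw [chargeSummand, h3]
  simp

/-- The summand of the central charge at the fixed point `e` in the degree `sector e + n` is the
residue at `q ^ n p` of the corresponding term of the integrand. -/
theorem chargeSummand_eq_residue (hτ : 0 < τ.im) (ha : X.GenericParam τ a) (E : ℂ → ℂ) {z : ℂ}
    (hz : X.GenericKahler τ a z) {e : Σ _ : Fin N, ℕ × ℂ} (he : e ∈ X.fixedIndex a) {n : ℤ} {l : ℂ}
    (hl : Tendsto (fun s => (s - nomeQ τ ^ n * X.lift τ e) * X.gammaQ τ a s)
      (𝓝[≠] (nomeQ τ ^ n * X.lift τ e)) (𝓝 l)) :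
    X.chargeSummand τ a E z e n = X.interpCoeff τ a E z e *
      ((nomeQ τ ^ n * X.lift τ e)⁻¹ *
        (l * X.elemSection τ a z e (nomeQ τ ^ n * X.lift τ e))) := by
  have hs0 := ne_zero_of_mem_fixedIndex ha he
  have hP0 : nomeQ τ ^ n * X.lift τ e ≠ 0 := zpow_mul_lift_ne_zero ha he n
  have hP : qpow τ (X.sector e + n) * e.2.2 = nomeQ τ ^ n * X.lift τ e := qpow_sector_add_mul e n _
  have hβ := qpow_ne_zero τ (X.sector e + n)
  have hmul : ContinuousAt (fun t => qpow τ (X.sector e + n) * t) e.2.2 := by fun_prop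
  set Q := ∏ j ∈ (X.posFixed (X.sector e)).erase e.1, (1 - (X.U a j e.2.2)⁻¹) with hQ
  have hQ0 : Q ≠ 0 := prod_erase_ne_zero hτ ha he _
  have hD0 : (X.D e.1 : ℂ) ≠ 0 := by exact_mod_cast X.D_ne_zero e.1
  -- the pole in the variable `t = s / q ^ β`
  have h1 : Tendsto (fun t => qpow τ (X.sector e + n) * (t - e.2.2) *
      X.gammaQ τ a (qpow τ (X.sector e + n) * t)) (𝓝[≠] e.2.2) (𝓝 l) := by
    have hm : Tendsto (fun t => qpow τ (X.sector e + n) * t) (𝓝[≠] e.2.2)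
        (𝓝[≠] (nomeQ τ ^ n * X.lift τ e)) := by
      rw [← hP]
      refine tendsto_nhdsWithin_iff.2 ⟨hmul.tendsto.mono_left nhdsWithin_le_nhds, ?_⟩
      filter_upwards [self_mem_nhdsWithin] with t ht h
      exact ht (mul_left_cancel₀ hβ h)
    refine (hl.comp hm).congr fun t => ?_
    simp only [Function.comp_apply, ← hP]
    ring
  -- the Koszul factor `1 - Uₖ⁻¹` cancels it
  have h2 : Tendsto (fun t => (1 - (X.U a e.1 t)⁻¹) / (t - e.2.2)) (𝓝[≠] e.2.2)
      (𝓝 ((X.D e.1 : ℂ) / e.2.2)) := by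
    have h := hasDerivAt_iff_tendsto_slope.1
      ((hasDerivAt_inv_U (X := X) (a := a) e.1 hs0).const_sub 1)
    rw [U_point ha he, inv_one, mul_one, neg_div, neg_neg] at h
    refine h.congr fun t => ?_
    rw [slope_def_field, U_point ha he]
    simp
  have h3 : Tendsto (fun t => X.elemSection τ a z e (qpow τ (X.sector e + n) * t)) (𝓝[≠] e.2.2)
      (𝓝 (X.elemSection τ a z e (nomeQ τ ^ n * X.lift τ e))) := by
    have h : ContinuousAt (X.elemSection τ a z e) (qpow τ (X.sector e + n) * e.2.2) := by
      rw [hP]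
      exact (differentiableAt_elemSection hτ ha hz.1 he hP0).continuousAt
    rw [← hP]
    exact (ContinuousAt.comp (f := fun t => qpow τ (X.sector e + n) * t) h hmul).tendsto.mono_left
      nhdsWithin_le_nhds
  have h4 : Tendsto (fun t => ∏ j ∈ (X.posFixed (X.sector e)).erase e.1, (1 - (X.U a j t)⁻¹))
      (𝓝[≠] e.2.2) (𝓝 Q) :=
    (continuousAt_prod_one_sub_inv_U hs0 _).tendsto.mono_left nhdsWithin_le_nhds
  have h5 := HTerm_eq_of_tendsto hτ ha hz he n
    (h := (qpow τ (X.sector e + n))⁻¹ * (((X.D e.1 : ℂ) / e.2.2 * Q) *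
      (l * X.elemSection τ a z e (nomeQ τ ^ n * X.lift τ e))))
    ((((h2.mul h4).mul (h1.mul h3)).const_mul (qpow τ (X.sector e + n))⁻¹).congr' (by
      filter_upwards [self_mem_nhdsWithin] with t ht
      have ht' : t - e.2.2 ≠ 0 := sub_ne_zero.2 ht
      rw [prod_posFixed_eq he]
      field_simp))
  rw [chargeSummand, h5, interpCoeff, chOrb, ← hP]
  change 1 / (X.D e.1 : ℂ) * (_ * E (X.lift τ e) / Q) = _
  field_simp

end GLSMData

/-! ### The central charge as a sum over fixed points -/

namespace GLSMData

variable {N : ℕ} {X : GLSMData N} {τ : ℂ} {a : Fin N → ℂ}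

/-- The Euler characteristic on the sector `{β}` is a sum over the fixed points in this sector. -/
theorem chargeTerm_eq_sum (E : ℂ → ℂ) (z : ℂ) (β : ℚ) :
    X.chargeTerm τ a E z β = ∑ e ∈ X.fixedIndex a with X.sector e = Int.fract β,
      X.chargeSummand τ a E z e ⌊β⌋ := by
  set v := Int.fract β with hv
  have hroots : ∀ k ∈ X.posFixed v, ∀ s : ℂ,
      s ∈ Polynomial.nthRootsFinset (X.D k).toNat (a k)⁻¹ ↔ s ^ X.D k = (a k)⁻¹ := by
    intro k hk s
    have hD := mem_pos.1 (Finset.mem_filter.1 hk).1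
    obtain ⟨d, hd⟩ := Int.eq_ofNat_of_zero_le hD.le
    rw [hd, Int.toNat_natCast, Polynomial.mem_nthRootsFinset (by omega), zpow_natCast]
  have hfl : v + ⌊β⌋ = β := Int.fract_add_floor β
  rw [chargeTerm, eulerChar, ← hv]
  simp only [Finset.mul_sum]
  rw [Finset.sum_sigma']
  symm
  refine Finset.sum_bij (fun e _ => ⟨e.1, e.2.2⟩) (fun e he => ?_) (fun e he e' he' h => ?_)
    (fun x hx => ?_) (fun e he => ?_)
  · obtain ⟨he, hev⟩ := Finset.mem_filter.1 he
    have hk := fst_mem_posFixed he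
    rw [hev] at hk
    exact Finset.mem_sigma.2 ⟨hk, (hroots _ hk _).2 (mem_fixedIndex.1 he).2.2⟩
  · obtain ⟨-, hev⟩ := Finset.mem_filter.1 he
    obtain ⟨-, hev'⟩ := Finset.mem_filter.1 he'
    obtain ⟨k, i, s⟩ := e
    obtain ⟨k', i', s'⟩ := e'
    simp only [Sigma.mk.injEq, heq_eq_eq] at h
    obtain ⟨rfl, rfl⟩ := h
    have h1 := D_mul_sector (X := X) ⟨k, i, s⟩
    have h2 := D_mul_sector (X := X) ⟨k, i', s⟩
    rw [hev] at h1
    rw [hev', h1] at h2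
    obtain rfl : i = i' := by exact_mod_cast h2
    rfl
  · obtain ⟨k, s⟩ := x
    obtain ⟨hk, hs⟩ := Finset.mem_sigma.1 hx
    simp only at hk hs
    obtain ⟨i, hi, hi'⟩ :=
      exists_natCast_eq_of_mem_posFixed (Int.fract_nonneg β) (Int.fract_lt_one β) hk
    refine ⟨⟨k, i, s⟩, Finset.mem_filter.2 ⟨mem_fixedIndex.2
      ⟨(Finset.mem_filter.1 hk).1, hi', (hroots k hk s).1 hs⟩, ?_⟩, rfl⟩
    have hD : (X.D k : ℚ) ≠ 0 := by exact_mod_cast X.D_ne_zero k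
    rw [sector, div_eq_iff hD, hi]
    ring
  · obtain ⟨-, hev⟩ := Finset.mem_filter.1 he
    rw [chargeSummand, hev, hfl]

theorem deg_sector_add (e : Σ _ : Fin N, ℕ × ℂ) (n : ℤ) :
    X.deg e.1 (X.sector e + n) = ((X.D e.1 * n + e.2.1 - X.r e.1 : ℤ) : ℚ) := by
  rw [deg, mul_add, D_mul_sector]
  push_cast
  ring

theorem exists_of_chargeTerm_ne_zero (hτ : 0 < τ.im) (ha : X.GenericParam τ a) {E : ℂ → ℂ} {z : ℂ}
    (hz : X.GenericKahler τ a z) {β : ℚ} (h : X.chargeTerm τ a E z β ≠ 0) :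
    ∃ e ∈ X.fixedIndex a, X.sector e + ⌊β⌋ = β ∧ 0 ≤ X.D e.1 * ⌊β⌋ + e.2.1 - X.r e.1 := by
  rw [chargeTerm_eq_sum] at h
  obtain ⟨e, he, hne⟩ := Finset.exists_ne_zero_of_sum_ne_zero h
  obtain ⟨he, hev⟩ := Finset.mem_filter.1 he
  exact ⟨e, he, by rw [hev, Int.fract_add_floor],
    not_lt.1 fun hlt => hne (chargeSummand_eq_zero hτ ha E hz he hlt)⟩

theorem chargeTerm_eq_zero_of_notMem_Eff (hτ : 0 < τ.im) (ha : X.GenericParam τ a) {E : ℂ → ℂ}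
    {z : ℂ} (hz : X.GenericKahler τ a z) {β : ℚ} (h : β ∉ X.Eff) : X.chargeTerm τ a E z β = 0 := by
  by_contra hne
  obtain ⟨e, he, hβ, hd⟩ := exists_of_chargeTerm_ne_zero hτ ha hz hne
  refine h ⟨e.1, (mem_fixedIndex.1 he).1, (X.D e.1 * ⌊β⌋ + e.2.1 - X.r e.1).toNat, ?_⟩
  have h1 := deg_sector_add (X := X) e ⌊β⌋
  rw [hβ] at h1
  rw [h1, ← Int.cast_natCast (R := ℚ), Int.toNat_of_nonneg hd]

/-- The degrees `sector e + n` with `L ≤ n` that are less than `B`. -/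
def degreesBelow (X : GLSMData N) (a : Fin N → ℂ) (L : ℤ) (B : ℚ) : Finset ℚ :=
  (X.fixedIndex a).biUnion fun e =>
    (Finset.Ico L ⌈B - X.sector e⌉).image fun n : ℤ => X.sector e + n

theorem mem_degreesBelow {L : ℤ} {B β : ℚ} :
    β ∈ X.degreesBelow a L B ↔
      ∃ e ∈ X.fixedIndex a, X.sector e + ⌊β⌋ = β ∧ L ≤ ⌊β⌋ ∧ β < B := by
  simp only [degreesBelow, Finset.mem_biUnion, Finset.mem_image, Finset.mem_Ico, Int.lt_ceil]
  refine exists_congr fun e => and_congr_right fun he => ⟨?_, ?_⟩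
  · rintro ⟨n, ⟨h1, h2⟩, rfl⟩
    rw [floor_sector_add he]
    exact ⟨rfl, h1, by linarith⟩
  · rintro ⟨h1, h2, h3⟩
    exact ⟨⌊β⌋, ⟨h2, by linarith⟩, h1⟩

/-- `L` is a lower bound for the degrees with nonzero contributions. -/
def IsDegreeBound (X : GLSMData N) (a : Fin N → ℂ) (L : ℤ) : Prop :=
  ∀ e ∈ X.fixedIndex a, ∀ n, 0 ≤ X.D e.1 * n + e.2.1 - X.r e.1 → L ≤ n

theorem exists_isDegreeBound (X : GLSMData N) (a : Fin N → ℂ) : ∃ L, X.IsDegreeBound a L := by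
  obtain ⟨M, hM⟩ := ((X.fixedIndex a).image fun e => |X.r e.1| + 1).exists_le
  refine ⟨-M, fun e he n hn => (neg_le_neg (hM _ (Finset.mem_image_of_mem _ he))).trans ?_⟩
  obtain ⟨hk, hi, -⟩ := mem_fixedIndex.1 he
  have hD := mem_pos.1 hk
  by_contra hlt
  have h1 : n ≤ -|X.r e.1| - 2 := by omega
  have h2 := neg_abs_le (X.r e.1)
  have h3 := abs_nonneg (X.r e.1)
  nlinarith

/-- Only finitely many degrees less than `B` contribute. -/
theorem partialCharge_eq_sum_degreesBelow (hτ : 0 < τ.im) (ha : X.GenericParam τ a) (E : ℂ → ℂ)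
    {z : ℂ} (hz : X.GenericKahler τ a z) {L : ℤ} (hL : X.IsDegreeBound a L) (B : ℚ) :
    X.partialCharge τ a E B z = ∑ β ∈ X.degreesBelow a L B, X.chargeTerm τ a E z β := by
  refine finsum_mem_eq_sum_of_inter_support_eq _ ?_
  ext β
  refine and_congr_left fun hβ => ?_
  obtain ⟨e, he, h1, h2⟩ := exists_of_chargeTerm_ne_zero hτ ha hz hβ
  refine ⟨fun h => Finset.mem_coe.2 (mem_degreesBelow.2 ⟨e, he, h1, hL e he _ h2, h.2⟩),
    fun h => ⟨?_, ?_⟩⟩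
  · by_contra hE
    exact hβ (chargeTerm_eq_zero_of_notMem_Eff hτ ha hz hE)
  · obtain ⟨e', -, -, -, h⟩ := mem_degreesBelow.1 (Finset.mem_coe.1 h)
    exact h

theorem partialCharge_eq_sum (hτ : 0 < τ.im) (ha : X.GenericParam τ a) (E : ℂ → ℂ) {z : ℂ}
    (hz : X.GenericKahler τ a z) {L : ℤ} (hL : X.IsDegreeBound a L) (B : ℚ) :
    X.partialCharge τ a E B z = ∑ e ∈ X.fixedIndex a,
      ∑ n ∈ Finset.Ico L ⌈B - X.sector e⌉, X.chargeSummand τ a E z e n := by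
  rw [partialCharge_eq_sum_degreesBelow hτ ha E hz hL B]
  simp only [chargeTerm_eq_sum, Finset.sum_filter]
  rw [Finset.sum_comm]
  refine Finset.sum_congr rfl fun e he => ?_
  rw [← Finset.sum_filter]
  refine Finset.sum_bij' (fun β _ => ⌊β⌋) (fun n _ => X.sector e + n) (fun β hβ => ?_)
    (fun n hn => ?_) (fun β hβ => ?_) (fun n hn => floor_sector_add he n) (fun β hβ => rfl)
  · obtain ⟨h1, h2⟩ := Finset.mem_filter.1 hβ
    obtain ⟨-, -, -, h3, h4⟩ := mem_degreesBelow.1 h1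
    have := Int.fract_add_floor β
    exact Finset.mem_Ico.2 ⟨h3, Int.lt_ceil.2 (by linarith)⟩
  · obtain ⟨h1, h2⟩ := Finset.mem_Ico.1 hn
    rw [Int.lt_ceil] at h2
    refine Finset.mem_filter.2 ⟨mem_degreesBelow.2 ⟨e, he, ?_, ?_, by linarith⟩,
      (fract_sector_add he n).symm⟩
    · rw [floor_sector_add he]
    · rwa [floor_sector_add he]
  · obtain ⟨-, h2⟩ := Finset.mem_filter.1 hβ
    simp only [h2, Int.fract_add_floor]

/-- The truncations of a convergent central charge tend to it, since the finite sets of contributing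
degrees less than `m` exhaust all of them. -/
theorem tendsto_partialCharge (hτ : 0 < τ.im) (ha : X.GenericParam τ a) {E : ℂ → ℂ} {z : ℂ}
    (hz : X.GenericKahler τ a z) (hconv : X.ChargeConverges τ a E z) :
    Tendsto (fun m : ℕ => X.partialCharge τ a E m z) atTop (𝓝 (X.centralCharge τ a E z)) := by
  classical
  obtain ⟨L, hL⟩ := exists_isDegreeBound X a
  set g : ℚ → ℂ := X.chargeTerm τ a E z with hg
  have h1 : HasSum (g ∘ ((↑) : X.Eff → ℚ)) (X.centralCharge τ a E z) := hconv.hasSum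
  rw [hasSum_subtype_iff_of_support_subset fun β hβ => by_contra fun h =>
    hβ (chargeTerm_eq_zero_of_notMem_Eff hτ ha hz h)] at h1
  rw [← hasSum_subtype_support] at h1
  have hmono : Monotone fun m : ℕ =>
      (X.degreesBelow a L (m : ℚ)).subtype (· ∈ Function.support g) := by
    intro m m' hm β hβ
    rw [Finset.mem_subtype, mem_degreesBelow] at hβ ⊢
    obtain ⟨e, he, h1, h2, h3⟩ := hβ
    exact ⟨e, he, h1, h2, h3.trans_le (by exact_mod_cast hm)⟩
  have htop := tendsto_atTop_finset_of_monotone hmono fun β => by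
    obtain ⟨e, he, h1, h2⟩ := exists_of_chargeTerm_ne_zero hτ ha hz β.2
    obtain ⟨m, hm⟩ := exists_nat_gt (β : ℚ)
    exact ⟨m, Finset.mem_subtype.2 (mem_degreesBelow.2 ⟨e, he, h1, hL e he _ h2, hm⟩)⟩
  refine (h1.comp htop).congr fun m => ?_
  rw [partialCharge_eq_sum_degreesBelow hτ ha E hz hL]
  simp only [Function.comp_apply]
  rw [Finset.sum_subtype_eq_sum_filter]
  exact Finset.sum_filter_of_ne fun β _ h => h

/-! ### The remainder -/

/-- A radius between those of `q ^ m p` and `q ^ (m - 1) p`, where `p` is the lift of `e`. -/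
def midRadius (X : GLSMData N) (τ : ℂ) (e : Σ _ : Fin N, ℕ × ℂ) (m : ℤ) : ℝ :=
  ‖nomeQ τ ^ m‖ * (‖X.lift τ e‖ * (√‖nomeQ τ‖)⁻¹)

theorem midRadius_pos (ha : X.GenericParam τ a) {e : Σ _ : Fin N, ℕ × ℂ}
    (he : e ∈ X.fixedIndex a) (m : ℤ) : 0 < X.midRadius τ e m := by
  have h1 := norm_pos_iff.2 (lift_ne_zero (τ := τ) ha he)
  have h2 := Real.sqrt_pos.2 (norm_nomeQ_pos τ)
  have h3 := norm_pos_iff.2 (zpow_ne_zero m (nomeQ_ne_zero τ))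
  exact mul_pos h3 (mul_pos h1 (inv_pos.2 h2))

theorem midRadius_eq (e : Σ _ : Fin N, ℕ × ℂ) (m : ℤ) :
    X.midRadius τ e m = (√‖nomeQ τ‖) ^ (2 * m - 1) * ‖X.lift τ e‖ := by
  have h2 := Real.sqrt_pos.2 (norm_nomeQ_pos τ)
  have h3 : √‖nomeQ τ‖ ^ (2 : ℤ) = ‖nomeQ τ‖ := by
    rw [zpow_ofNat, Real.sq_sqrt (norm_nonneg _)]
  rw [midRadius, norm_zpow, zpow_sub₀ h2.ne', zpow_mul, h3, zpow_one]
  ring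

theorem norm_zpow_mul_lift (e : Σ _ : Fin N, ℕ × ℂ) (n : ℤ) :
    ‖nomeQ τ ^ n * X.lift τ e‖ = (√‖nomeQ τ‖) ^ (2 * n) * ‖X.lift τ e‖ := by
  have h3 : √‖nomeQ τ‖ ^ (2 : ℤ) = ‖nomeQ τ‖ := by
    rw [zpow_ofNat, Real.sq_sqrt (norm_nonneg _)]
  rw [norm_mul, norm_zpow, zpow_mul, h3]

theorem sqrt_norm_nomeQ_lt_one (hτ : 0 < τ.im) : √‖nomeQ τ‖ < 1 := by
  rw [Real.sqrt_lt' one_pos]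
  simpa using norm_nomeQ_lt_one hτ

theorem midRadius_lt_iff (hτ : 0 < τ.im) (ha : X.GenericParam τ a) {e : Σ _ : Fin N, ℕ × ℂ}
    (he : e ∈ X.fixedIndex a) (m n : ℤ) :
    X.midRadius τ e m < ‖nomeQ τ ^ n * X.lift τ e‖ ↔ n < m := by
  rw [midRadius_eq, norm_zpow_mul_lift,
    mul_lt_mul_iff_left₀ (norm_pos_iff.2 (lift_ne_zero ha he)),
    zpow_lt_zpow_iff_right_of_lt_one₀ (Real.sqrt_pos.2 (norm_nomeQ_pos τ))
      (sqrt_norm_nomeQ_lt_one hτ)]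
  omega

theorem norm_zpow_mul_lift_ne_midRadius (hτ : 0 < τ.im) (ha : X.GenericParam τ a)
    {e : Σ _ : Fin N, ℕ × ℂ} (he : e ∈ X.fixedIndex a) (m n : ℤ) :
    ‖nomeQ τ ^ n * X.lift τ e‖ ≠ X.midRadius τ e m := by
  rw [midRadius_eq, norm_zpow_mul_lift]
  intro h
  have h1 := zpow_right_injective₀ (Real.sqrt_pos.2 (norm_nomeQ_pos τ))
    (sqrt_norm_nomeQ_lt_one hτ).ne
    (mul_right_cancel₀ (norm_pos_iff.2 (lift_ne_zero ha he)).ne' h)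
  omega

theorem exists_midRadius_le (hτ : 0 < τ.im) (a : Fin N → ℂ) {r : ℝ} (hr : 0 < r) :
    ∃ m₀ : ℕ, ∀ e ∈ X.fixedIndex a, ∀ m : ℤ, m₀ ≤ m → X.midRadius τ e m ≤ r := by
  have hq0 := norm_nomeQ_pos τ
  have hq1 := norm_nomeQ_lt_one hτ
  have h1 : ∀ e ∈ X.fixedIndex a, ∀ᶠ m : ℕ in atTop, X.midRadius τ e m ≤ r := fun e he => by
    have h := (tendsto_pow_atTop_nhds_zero_of_lt_one hq0.le hq1).mul_const
      (‖X.lift τ e‖ * (√‖nomeQ τ‖)⁻¹)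
    rw [zero_mul] at h
    filter_upwards [h.eventually (gt_mem_nhds hr)] with m hm
    rw [midRadius, norm_zpow, zpow_natCast]
    exact hm.le
  obtain ⟨m₀, hm₀⟩ := eventually_atTop.1 ((Finset.eventually_all _).2 h1)
  refine ⟨m₀, fun e he m hm => le_trans ?_ (hm₀ m₀ le_rfl e he)⟩
  rw [midRadius, midRadius, norm_zpow, norm_zpow]
  exact mul_le_mul_of_nonneg_right (zpow_le_zpow_right_of_le_one₀ hq0 hq1.le hm) (by positivity)

/-- The contribution of a fixed point to the difference of the contour integral and the sum of the
terms of the central charge in degrees `sector e + n`, `n < m`. -/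
def remainder (X : GLSMData N) (τ : ℂ) (a : Fin N → ℂ) (z : ℂ) (e : Σ _ : Fin N, ℕ × ℂ)
    (m : ℤ) : ℂ :=
  (2 * Real.pi * Complex.I)⁻¹ * ∮ s in C(0, X.midRadius τ e m),
    s⁻¹ * (kronecker τ z (s * (X.lift τ e)⁻¹) * X.gammaTheta τ a s)

/-- The interpolation, being unique, can be replaced by the Lagrange interpolation. -/
theorem contourIntegral_eq_sum (hτ : 0 < τ.im) (ha : X.GenericParam τ a) {E : ℂ → ℂ} {z : ℂ}
    (hz : X.GenericKahler τ a z) {F : ℂ → ℂ} (hF : X.IsInterpolation τ a E z F) {δ : ℝ}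
    (hδ : 0 < δ) (hsep : X.Separates τ a δ) :
    X.contourIntegral τ a δ F = ∑ e ∈ X.fixedIndex a,
      X.interpCoeff τ a E z e * X.contourIntegral τ a δ (X.elemSection τ a z e) := by
  have hcont : ∀ e ∈ X.fixedIndex a, CircleIntegrable
      (fun s => X.interpCoeff τ a E z e * (s⁻¹ * (X.gammaQ τ a s * X.elemSection τ a z e s)))
      0 δ := fun e he => by
    refine ContinuousOn.circleIntegrable hδ.le fun s hs => ?_
    have h1 := mem_sphere_zero_iff_norm.1 hs
    have h2 : s ≠ 0 := norm_pos_iff.1 (by rw [h1]; exact hδ)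
    exact (((differentiableAt_inv h2).mul ((differentiableAt_gammaQ hτ h2
      (phiPos_ne_zero hsep h2 h1.ge) (phiNeg_ne_zero hsep h1.le)).mul
      (differentiableAt_elemSection hτ ha hz.1 he h2))).const_mul _).continuousAt.continuousWithinAt
  have heq : Set.EqOn (fun s => s⁻¹ * (X.gammaQ τ a s * F s)) (fun s => ∑ e ∈ X.fixedIndex a,
      X.interpCoeff τ a E z e * (s⁻¹ * (X.gammaQ τ a s * X.elemSection τ a z e s)))
      (Metric.sphere 0 δ) := fun s hs => by
    have h2 : s ≠ 0 := norm_pos_iff.1 (by rw [mem_sphere_zero_iff_norm.1 hs]; exact hδ)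
    have h3 := hF.unique hτ ha hz (isInterpolation_sum hτ ha E hz) h2
    simp only [h3, Finset.mul_sum]
    exact Finset.sum_congr rfl fun e _ => by ring
  rw [contourIntegral, circleIntegral.integral_congr hδ.le heq,
    circleIntegral.integral_fun_sum hcont, Finset.mul_sum]
  refine Finset.sum_congr rfl fun e _ => ?_
  rw [circleIntegral.integral_const_mul, contourIntegral]
  ring

/-- Moving the contour of each term of the Lagrange interpolation past the poles that contribute to
the degrees less than `B` leaves the remainders. -/
theorem contourIntegral_sub_partialCharge (hτ : 0 < τ.im) (ha : X.GenericParam τ a) {E : ℂ → ℂ}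
    {z : ℂ} (hz : X.GenericKahler τ a z) {F : ℂ → ℂ} (hF : X.IsInterpolation τ a E z F) {δ : ℝ}
    (hδ : 0 < δ) (hsep : X.Separates τ a δ) {B : ℚ}
    (hB : ∀ e ∈ X.fixedIndex a, X.midRadius τ e ⌈B - X.sector e⌉ ≤ δ) :
    X.contourIntegral τ a δ F - X.partialCharge τ a E B z = ∑ e ∈ X.fixedIndex a,
      X.interpCoeff τ a E z e * X.remainder τ a z e ⌈B - X.sector e⌉ := by
  obtain ⟨L, hL⟩ := exists_isDegreeBound X a
  rw [contourIntegral_eq_sum hτ ha hz hF hδ hsep, partialCharge_eq_sum hτ ha E hz hL,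
    ← Finset.sum_sub_distrib]
  refine Finset.sum_congr rfl fun e he => ?_
  have hl : ∀ n : ℤ, ∃ l : ℂ, 0 ≤ X.D e.1 * n + e.2.1 - X.r e.1 →
      Tendsto (fun s => (s - nomeQ τ ^ n * X.lift τ e) * X.gammaQ τ a s)
        (𝓝[≠] (nomeQ τ ^ n * X.lift τ e)) (𝓝 l) := fun n => by
    by_cases hn : 0 ≤ X.D e.1 * n + e.2.1 - X.r e.1
    · obtain ⟨l, h⟩ := exists_tendsto_mul_gammaQ hτ ha he hn
      exact ⟨l, fun _ => h⟩
    · exact ⟨0, fun h => absurd h hn⟩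
  choose l hl using hl
  have hcontour := contourIntegral_elemSection hτ ha hz he hsep (m := ⌈B - X.sector e⌉)
    (fun n => hL e he n) (midRadius_pos ha he _) (hB e he)
    (fun n => midRadius_lt_iff hτ ha he _ n)
    (fun n => norm_zpow_mul_lift_ne_midRadius hτ ha he _ n)
    (fun n => (nomeQ τ ^ n * X.lift τ e)⁻¹ *
      (l n * X.elemSection τ a z e (nomeQ τ ^ n * X.lift τ e)))
    (fun n hn => by
      have hP0 := zpow_mul_lift_ne_zero (τ := τ) ha he n
      have h1 := (continuousAt_inv₀ hP0).tendsto.mono_left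
        (nhdsWithin_le_nhds (s := {nomeQ τ ^ n * X.lift τ e}ᶜ))
      have h2 := (differentiableAt_elemSection hτ ha hz.1 he hP0).continuousAt.tendsto.mono_left
        (nhdsWithin_le_nhds (s := {nomeQ τ ^ n * X.lift τ e}ᶜ))
      exact (h1.mul ((hl n hn).mul h2)).congr fun s => by ring)
  have hsum : ∑ n ∈ Finset.Ico L ⌈B - X.sector e⌉, X.chargeSummand τ a E z e n =
      X.interpCoeff τ a E z e * ∑ n ∈ (Finset.Ico L ⌈B - X.sector e⌉).filter
        fun n => 0 ≤ X.D e.1 * n + e.2.1 - X.r e.1, (nomeQ τ ^ n * X.lift τ e)⁻¹ *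
          (l n * X.elemSection τ a z e (nomeQ τ ^ n * X.lift τ e)) := by
    rw [Finset.mul_sum, Finset.sum_filter]
    refine Finset.sum_congr rfl fun n _ => ?_
    split_ifs with hn
    · exact chargeSummand_eq_residue hτ ha E hz he (hl n hn)
    · exact chargeSummand_eq_zero hτ ha E hz he (not_le.1 hn)
  rw [hcontour, hsum, remainder]
  ring

end GLSMData

/-! ### Convergence and asymptotic expansion -/

/-- On a circle of radius `ρ ≤ |q| ^ M`, the quotient `θ(s w) / θ(w)` decays like `|w| ^ (-M)` as
`w → ∞` away from `q ^ ℤ`: the translation by `n` periods to a fundamental annulus produces the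
factor `s ^ n`, with `n` about `- log |w| / log |q|`. -/
theorem exists_norm_qtheta_mul_div_le {τ : ℂ} (hτ : 0 < τ.im) {ε ρ : ℝ} (hε : 0 < ε) (hρ : 0 < ρ)
    {M : ℕ} (hρM : ρ ≤ ‖nomeQ τ‖ ^ M) :
    ∃ C : ℝ, ∀ w : ℂ, 1 ≤ ‖w‖ → (∀ n : ℤ, ε ≤ ‖1 - nomeQ τ ^ n * w‖) → ∀ s : ℂ, ‖s‖ = ρ →
      ‖qtheta τ (s * w) / qtheta τ w‖ * ‖w‖ ^ M ≤ C := by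
  have hq := nomeQ_ne_zero τ
  have hq0 := norm_nomeQ_pos τ
  have hq1 := norm_nomeQ_lt_one hτ
  -- a compact fundamental annulus, with neighbourhoods of the zeros of `θ` removed
  set K : Set ℂ := (Metric.closedBall 0 ‖nomeQ τ‖⁻¹ ∩ {w | 1 ≤ ‖w‖}) ∩
    ⋂ n : ℤ, {w | ε ≤ ‖1 - nomeQ τ ^ n * w‖} with hK
  have hKc : IsCompact K := ((isCompact_closedBall _ _).inter_right
    (isClosed_le continuous_const continuous_norm)).inter_right
    (isClosed_iInter fun n => isClosed_le continuous_const (by fun_prop))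
  have hK0 : ∀ w ∈ K, w ≠ 0 := fun w hw => norm_pos_iff.1 (one_pos.trans_le hw.1.2)
  have hKθ : ∀ w ∈ K, qtheta τ w ≠ 0 := fun w hw h0 => by
    obtain ⟨n, rfl⟩ := (qtheta_eq_zero_iff hτ (hK0 w hw)).1 h0
    have h1 : ε ≤ ‖1 - nomeQ τ ^ (-n) * nomeQ τ ^ n‖ := Set.mem_iInter.1 hw.2 (-n)
    rw [zpow_neg, inv_mul_cancel₀ (zpow_ne_zero n hq), sub_self, norm_zero] at h1
    exact absurd h1 (not_le.2 hε)
  obtain ⟨C, hC⟩ := (hKc.prod (isCompact_sphere (0 : ℂ) ρ)).exists_bound_of_continuousOn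
    (f := fun x : ℂ × ℂ => qtheta τ (x.2 * x.1) / qtheta τ x.1) (by
      rintro ⟨w, s⟩ ⟨hw, hs⟩
      have hs0 : s ≠ 0 := norm_pos_iff.1 (by rw [mem_sphere_zero_iff_norm.1 hs]; exact hρ)
      refine ContinuousAt.continuousWithinAt (ContinuousAt.div ?_ ?_ (hKθ w hw))
      · exact ContinuousAt.comp (f := fun x : ℂ × ℂ => x.2 * x.1) (g := qtheta τ)
          (differentiableAt_qtheta hτ (mul_ne_zero hs0 (hK0 w hw))).continuousAt (by fun_prop)
      · exact ContinuousAt.comp (f := fun x : ℂ × ℂ => x.1) (g := qtheta τ)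
          (differentiableAt_qtheta hτ (hK0 w hw)).continuousAt (by fun_prop))
  refine ⟨C * (‖nomeQ τ‖⁻¹) ^ M, fun w hw hε' s hs => ?_⟩
  obtain ⟨n, hn1, hn2⟩ := exists_nat_pow_near hw ((one_lt_inv₀ hq0).2 hq1)
  set w₀ := nomeQ τ ^ n * w with hw₀
  have hww₀ : w = nomeQ τ ^ (-(n : ℤ)) * w₀ := by
    rw [hw₀, zpow_neg, zpow_natCast, inv_mul_cancel_left₀ (pow_ne_zero n hq)]
  have hnorm : ‖w₀‖ = ‖nomeQ τ‖ ^ n * ‖w‖ := by rw [hw₀, norm_mul, norm_pow]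
  have hqn : 0 < ‖nomeQ τ‖ ^ n := pow_pos hq0 n
  have hw₀1 : 1 ≤ ‖w₀‖ := by
    rw [inv_pow, inv_le_iff_one_le_mul₀' hqn] at hn1
    rwa [hnorm]
  have hw₀2 : ‖w₀‖ ≤ ‖nomeQ τ‖⁻¹ := by
    rw [hnorm]
    calc ‖nomeQ τ‖ ^ n * ‖w‖ ≤ ‖nomeQ τ‖ ^ n * (‖nomeQ τ‖⁻¹) ^ (n + 1) := by gcongr
      _ = ‖nomeQ τ‖⁻¹ := by rw [pow_succ, ← mul_assoc, ← mul_pow, mul_inv_cancel₀ hq0.ne', one_pow,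
        one_mul]
  have hw₀K : w₀ ∈ K := by
    refine ⟨⟨mem_closedBall_zero_iff.2 hw₀2, hw₀1⟩, Set.mem_iInter.2 fun m => ?_⟩
    change ε ≤ ‖1 - nomeQ τ ^ m * w₀‖
    rw [hw₀, ← mul_assoc, ← zpow_natCast, ← zpow_add₀ hq]
    exact hε' _
  have hs0 : s ≠ 0 := norm_pos_iff.1 (by rw [hs]; exact hρ)
  have hw₀0 := hK0 w₀ hw₀K
  obtain ⟨c, hc, h⟩ := exists_qtheta_zpow_mul hτ (-(n : ℤ))
  have hratio : qtheta τ (s * w) / qtheta τ w = s ^ n * (qtheta τ (s * w₀) / qtheta τ w₀) := by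
    have h1 : s * w = nomeQ τ ^ (-(n : ℤ)) * (s * w₀) := by rw [hww₀]; ring
    rw [h1, h _ (mul_ne_zero hs0 hw₀0), hww₀, h _ hw₀0, neg_neg, zpow_natCast, zpow_natCast,
      mul_pow]
    have := hKθ w₀ hw₀K
    field_simp
  have hb := hC (w₀, s) ⟨hw₀K, mem_sphere_zero_iff_norm.2 hs⟩
  have hC0 : 0 ≤ C := (norm_nonneg _).trans hb
  have hwle : ‖w‖ ^ M ≤ ((‖nomeQ τ‖ ^ n)⁻¹ * ‖nomeQ τ‖⁻¹) ^ M := by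
    gcongr
    rw [inv_mul_eq_div, le_div_iff₀ hqn, mul_comm, ← hnorm]
    exact hw₀2
  rw [hratio, norm_mul, norm_pow, hs]
  calc ρ ^ n * ‖qtheta τ (s * w₀) / qtheta τ w₀‖ * ‖w‖ ^ M
      ≤ (‖nomeQ τ‖ ^ M) ^ n * C * ((‖nomeQ τ‖ ^ n)⁻¹ * ‖nomeQ τ‖⁻¹) ^ M := by gcongr
    _ = C * (‖nomeQ τ‖⁻¹) ^ M := by
      rw [mul_pow, ← pow_mul, mul_comm M n, pow_mul, inv_pow]
      have := pow_ne_zero M hqn.ne'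
      field_simp

namespace GLSMData

variable {N : ℕ} {X : GLSMData N} {τ : ℂ} {a : Fin N → ℂ}

theorem qtheta_ne_zero_of_norm_eq_midRadius (hτ : 0 < τ.im) (ha : X.GenericParam τ a)
    {e : Σ _ : Fin N, ℕ × ℂ} (he : e ∈ X.fixedIndex a) {m : ℤ} {s : ℂ}
    (hs : ‖s‖ = X.midRadius τ e m) : s ≠ 0 ∧ qtheta τ (s * (X.lift τ e)⁻¹) ≠ 0 := by
  have hs0 : s ≠ 0 := norm_pos_iff.1 (by rw [hs]; exact midRadius_pos ha he m)
  refine ⟨hs0, fun h => ?_⟩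
  obtain ⟨n, rfl⟩ := (qtheta_mul_inv_lift_eq_zero_iff hτ ha he hs0).1 h
  exact norm_zpow_mul_lift_ne_midRadius hτ ha he m n hs

/-- The remainder is `O(|z| ^ M)` as soon as its contour is small. -/
theorem isBigO_interpCoeff_mul_remainder (hτ : 0 < τ.im) (ha : X.GenericParam τ a) (E : ℂ → ℂ)
    {δ : ℝ} (hsep : X.Separates τ a δ) {e : Σ _ : Fin N, ℕ × ℂ} (he : e ∈ X.fixedIndex a) {m : ℤ}
    (hδ : X.midRadius τ e m ≤ δ) {M : ℕ} (hM : X.midRadius τ e m ≤ ‖nomeQ τ‖ ^ M) {ε : ℝ}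
    (hε : 0 < ε) :
    (fun z : ℂ => X.interpCoeff τ a E z e * X.remainder τ a z e m)
      =O[𝓝[X.awayFromPoles τ a ε] (0 : ℂ)] fun z : ℂ => ‖z‖ ^ M := by
  have hρ := midRadius_pos (τ := τ) ha he m
  set ρ := X.midRadius τ e m with hρdef
  set p := X.lift τ e with hp
  have hp0 : p ≠ 0 := lift_ne_zero ha he
  have hpn : 0 < ‖p‖ := norm_pos_iff.2 hp0
  have hmem : ∀ s : ℂ, ‖s‖ = ρ → s ≠ 0 ∧ qtheta τ (s * p⁻¹) ≠ 0 := fun s hs =>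
    qtheta_ne_zero_of_norm_eq_midRadius hτ ha he hs
  obtain ⟨C₁, hC₁⟩ := exists_norm_qtheta_mul_div_le hτ hε hρ hM
  obtain ⟨C₂, hC₂⟩ := (isCompact_sphere (0 : ℂ) ρ).exists_bound_of_continuousOn
    (f := fun s => s⁻¹ * ((qtheta τ (s * p⁻¹))⁻¹ * X.gammaTheta τ a s)) (fun s hs => by
      have hs' := mem_sphere_zero_iff_norm.1 hs
      obtain ⟨h1, h2⟩ := hmem s hs'
      exact ((continuousAt_inv₀ h1).mul (((differentiableAt_qtheta_mul hτ (inv_ne_zero hp0)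
        h1).continuousAt.inv₀ h2).mul (differentiableAt_gammaTheta hτ
        (phiNeg_ne_zero hsep (hs'.le.trans hδ))).continuousAt)).continuousWithinAt)
  set A : ℂ := E p / X.thetaQuot τ a e p with hA
  refine Asymptotics.IsBigO.of_bound (ρ * (‖A‖ * (C₁ * ‖p‖ ^ M) * C₂)) ?_
  have hsmall : ∀ᶠ z : ℂ in 𝓝[X.awayFromPoles τ a ε] 0, ‖z‖ < ‖p‖⁻¹ :=
    nhdsWithin_le_nhds (continuous_norm.continuousAt.eventually (gt_mem_nhds (by simpa using hp0)))
  filter_upwards [hsmall, self_mem_nhdsWithin] with z hz1 hz2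
  obtain ⟨hz, hz3⟩ := hz2
  have hzn : 0 < ‖z‖ := norm_pos_iff.2 hz.1
  -- the condition on `z` keeps `w = 1 / (p z)` away from `q ^ ℤ`
  set w := p⁻¹ * z⁻¹ with hw
  have hwn : ‖w‖ = (‖p‖ * ‖z‖)⁻¹ := by rw [hw, norm_mul, norm_inv, norm_inv, mul_inv]
  have hw1 : 1 ≤ ‖w‖ := by
    rw [hwn]
    refine (one_le_inv₀ (mul_pos hpn hzn)).2 ?_
    rw [lt_inv_comm₀ hzn hpn, inv_eq_one_div, lt_div_iff₀ hzn] at hz1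
    exact hz1.le
  have hwε : ∀ n : ℤ, ε ≤ ‖1 - nomeQ τ ^ n * w‖ := fun n => by
    have h1 := hz3 _ (zpow_mul_lift_mem_ellLocus hτ ha he (-n))
    have h2 : z - (nomeQ τ ^ (-n) * X.lift τ e)⁻¹ = z * (1 - nomeQ τ ^ n * w) := by
      rw [hw, mul_inv, zpow_neg, inv_inv, ← hp]
      have := hz.1
      field_simp
    rw [h2, norm_mul, mul_comm] at h1
    exact le_of_mul_le_mul_left h1 hzn
  have hθz := qtheta_inv_ne_zero_of_genericKahler hτ hz
  have hθw : qtheta τ w ≠ 0 :=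
    qtheta_inv_mul_inv_ne_zero_of_genericKahler hτ ha hz (lift_mem_ellLocus hτ ha he)
  have heq : X.interpCoeff τ a E z e * X.remainder τ a z e m = (2 * Real.pi * Complex.I)⁻¹ •
      ∮ s in C(0, ρ), A * (qtheta τ (s * w) / qtheta τ w) *
        (s⁻¹ * ((qtheta τ (s * p⁻¹))⁻¹ * X.gammaTheta τ a s)) := by
    rw [remainder, smul_eq_mul, mul_left_comm, ← circleIntegral.integral_const_mul]
    congr 1
    refine circleIntegral.integral_congr hρ.le fun s hs => ?_
    obtain ⟨h1, h2⟩ := hmem s (mem_sphere_zero_iff_norm.1 hs)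
    simp only [interpCoeff, kronecker, kahlerFactor]
    rw [← hp, ← hw, mul_assoc s, ← hw, hA]
    generalize qtheta τ (s * p⁻¹) = x at h2
    generalize qtheta τ z⁻¹ = y at hθz
    field_simp
  rw [heq]
  refine (circleIntegral.norm_two_pi_i_inv_smul_integral_le_of_norm_le_const hρ.le
    (C := ‖A‖ * (C₁ * (‖p‖ * ‖z‖) ^ M) * C₂) fun s hs => ?_).trans (le_of_eq ?_)
  · have hs' := mem_sphere_zero_iff_norm.1 hs
    have h1 := hC₁ w hw1 hwε s hs'
    have h2 : ‖qtheta τ (s * w) / qtheta τ w‖ ≤ C₁ * (‖p‖ * ‖z‖) ^ M := by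
      rwa [hwn, inv_pow, ← div_eq_mul_inv, div_le_iff₀ (by positivity)] at h1
    rw [norm_mul, norm_mul]
    have h3 := hC₂ s hs
    have h4 : 0 ≤ C₁ * (‖p‖ * ‖z‖) ^ M := (norm_nonneg _).trans h2
    gcongr
  · rw [norm_pow, norm_norm, mul_pow]
    ring

/-- The remainder as an integral over a fixed circle, by the substitution `s ↦ q ^ m s`. -/
theorem remainder_natCast (hτ : 0 < τ.im) (ha : X.GenericParam τ a) {z : ℂ} (hz : z ≠ 0)
    {e : Σ _ : Fin N, ℕ × ℂ} (he : e ∈ X.fixedIndex a) (m : ℕ) :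
    X.remainder τ a z e m = (2 * Real.pi * Complex.I)⁻¹ * ∮ s in C(0, X.midRadius τ e 0),
      s⁻¹ * (z ^ m * kronecker τ z (s * (X.lift τ e)⁻¹) * X.gammaTheta τ a (nomeQ τ ^ m * s)) := by
  have hρ := midRadius_pos (τ := τ) ha he 0
  have h : X.midRadius τ e m = ‖nomeQ τ ^ m‖ * X.midRadius τ e 0 := by
    simp [midRadius]
  rw [remainder, h, circleIntegral_inv_mul_comp_mul (pow_ne_zero m (nomeQ_ne_zero τ)) hρ
    fun s => kronecker τ z (s * (X.lift τ e)⁻¹) * X.gammaTheta τ a s]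
  congr 1
  refine circleIntegral.integral_congr hρ.le fun s hs => ?_
  have hs0 : s ≠ 0 := norm_pos_iff.1 (by rw [mem_sphere_zero_iff_norm.1 hs]; exact hρ)
  have h1 := kronecker_zpow_mul hτ hz
    (mul_ne_zero hs0 (inv_ne_zero (lift_ne_zero (τ := τ) ha he))) m
  rw [zpow_natCast, zpow_natCast] at h1
  rw [mul_assoc (nomeQ τ ^ m), h1]

/-- The Taylor expansion of `gammaTheta` at the origin makes the remainder asymptotic to a sum of
geometric progressions with the ratios `z q ^ j`. -/
theorem tendsto_remainder_sub_geometric (hτ : 0 < τ.im) (ha : X.GenericParam τ a) {z : ℂ}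
    (hz : X.GenericKahler τ a z) {δ : ℝ} (hδ : 0 < δ) (hsep : X.Separates τ a δ)
    {e : Σ _ : Fin N, ℕ × ℂ} (he : e ∈ X.fixedIndex a) {J : ℕ} (hJ : ‖z‖ * ‖nomeQ τ‖ ^ J < 1)
    {c : ℕ → ℂ}
    (hc : (fun s => X.gammaTheta τ a s - ∑ j ∈ Finset.range J, s ^ j * c j) =O[𝓝 0]
      fun s => ‖s‖ ^ J) :
    ∃ t : ℕ → ℂ, Tendsto (fun m : ℕ => X.remainder τ a z e m -
      ∑ j ∈ Finset.range J, (z * nomeQ τ ^ j) ^ m * t j) atTop (𝓝 0) := by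
  have hρ := midRadius_pos (τ := τ) ha he 0
  set ρ := X.midRadius τ e 0 with hρdef
  set p := X.lift τ e with hp
  have hp0 : p ≠ 0 := lift_ne_zero ha he
  have hq0 := norm_nomeQ_pos τ
  have hq1 := norm_nomeQ_lt_one hτ
  have hkc : ContinuousOn (fun s => s⁻¹ * kronecker τ z (s * p⁻¹)) (Metric.sphere 0 ρ) :=
    fun s hs => by
      obtain ⟨h1, h2⟩ :=
        qtheta_ne_zero_of_norm_eq_midRadius hτ ha he (mem_sphere_zero_iff_norm.1 hs)
      have h3 := differentiableAt_qtheta_mul hτ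
        (mul_ne_zero (inv_ne_zero hp0) (inv_ne_zero hz.1)) h1
      simp only [← mul_assoc] at h3
      have h4 : ContinuousAt (fun t => kronecker τ z (t * p⁻¹)) s := h3.continuousAt.div
        ((differentiableAt_qtheta_mul hτ (inv_ne_zero hp0) h1).continuousAt.mul continuousAt_const)
        (mul_ne_zero h2 (qtheta_inv_ne_zero_of_genericKahler hτ hz))
      exact ((continuousAt_inv₀ h1).mul h4).continuousWithinAt
  obtain ⟨C₁, hC₁⟩ := (isCompact_sphere (0 : ℂ) ρ).exists_bound_of_continuousOn hkc
  obtain ⟨C₂, hC₂⟩ := hc.bound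
  obtain ⟨r, hr, hball⟩ := Metric.eventually_nhds_iff.1 hC₂
  refine ⟨fun j => (2 * Real.pi * Complex.I)⁻¹ * (c j * ∮ s in C(0, ρ),
    s⁻¹ * kronecker τ z (s * p⁻¹) * s ^ j), ?_⟩
  have hsmall : ∀ᶠ m : ℕ in atTop, ‖nomeQ τ‖ ^ m * ρ < min δ r := by
    have h := (tendsto_pow_atTop_nhds_zero_of_lt_one hq0.le hq1).mul_const ρ
    rw [zero_mul] at h
    exact h.eventually (gt_mem_nhds (lt_min hδ hr))
  have hmain : ∀ᶠ m : ℕ in atTop, ‖X.remainder τ a z e m - ∑ j ∈ Finset.range J,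
      (z * nomeQ τ ^ j) ^ m * ((2 * Real.pi * Complex.I)⁻¹ * (c j * ∮ s in C(0, ρ),
        s⁻¹ * kronecker τ z (s * p⁻¹) * s ^ j))‖ ≤
      (‖z‖ * ‖nomeQ τ‖ ^ J) ^ m * (ρ * (C₁ * (C₂ * ρ ^ J))) := by
    filter_upwards [hsmall] with m hm
    have hG : ContinuousOn (fun s => X.gammaTheta τ a (nomeQ τ ^ m * s)) (Metric.sphere 0 ρ) :=
      fun s hs => by
        have h1 : ‖nomeQ τ ^ m * s‖ ≤ δ := by
          rw [norm_mul, norm_pow, mem_sphere_zero_iff_norm.1 hs]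
          exact hm.le.trans (min_le_left _ _)
        exact (ContinuousAt.comp (f := fun s => nomeQ τ ^ m * s) (g := X.gammaTheta τ a)
          (differentiableAt_gammaTheta hτ (phiNeg_ne_zero hsep h1)).continuousAt
          (by fun_prop)).continuousWithinAt
    have h1 : X.remainder τ a z e m - ∑ j ∈ Finset.range J,
        (z * nomeQ τ ^ j) ^ m * ((2 * Real.pi * Complex.I)⁻¹ * (c j * ∮ s in C(0, ρ),
          s⁻¹ * kronecker τ z (s * p⁻¹) * s ^ j)) = (2 * Real.pi * Complex.I)⁻¹ •
        ∮ s in C(0, ρ), z ^ m * (s⁻¹ * kronecker τ z (s * p⁻¹)) *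
          (X.gammaTheta τ a (nomeQ τ ^ m * s) -
            ∑ j ∈ Finset.range J, (nomeQ τ ^ m * s) ^ j * c j) := by
      have h2 : ∀ j, (z * nomeQ τ ^ j) ^ m * ((2 * Real.pi * Complex.I)⁻¹ * (c j *
          ∮ s in C(0, ρ), s⁻¹ * kronecker τ z (s * p⁻¹) * s ^ j)) =
          (2 * Real.pi * Complex.I)⁻¹ * ∮ s in C(0, ρ),
            (z * nomeQ τ ^ j) ^ m * c j * (s⁻¹ * kronecker τ z (s * p⁻¹) * s ^ j) := fun j => by
        rw [circleIntegral.integral_const_mul]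
        ring
      rw [remainder_natCast hτ ha hz.1 he, Finset.sum_congr rfl fun j _ => h2 j, ← Finset.mul_sum,
        ← circleIntegral.integral_fun_sum, ← mul_sub, ← circleIntegral.integral_sub, smul_eq_mul]
      · congr 1
        refine circleIntegral.integral_congr hρ.le fun s _ => ?_
        simp only [Finset.mul_sum, mul_sub]
        congr 1
        · ring
        · exact Finset.sum_congr rfl fun j _ => by ring
      · refine ContinuousOn.circleIntegrable hρ.le ((hkc.mul (hG.const_mul (z ^ m))).congr ?_)
        intro s _
        simp only [Pi.mul_apply]
        ring
      · refine ContinuousOn.circleIntegrable hρ.le (continuousOn_finsetSum _ fun j _ => ?_)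
        exact (hkc.mul (by fun_prop)).const_mul _
      · exact fun j _ => ContinuousOn.circleIntegrable hρ.le
          ((hkc.mul (by fun_prop)).const_mul _)
    rw [h1]
    refine (circleIntegral.norm_two_pi_i_inv_smul_integral_le_of_norm_le_const hρ.le
      (C := ‖z‖ ^ m * C₁ * (C₂ * (‖nomeQ τ‖ ^ m * ρ) ^ J)) fun s hs => ?_).trans (le_of_eq ?_)
    · have hs' : ‖nomeQ τ ^ m * s‖ = ‖nomeQ τ‖ ^ m * ρ := by
        rw [norm_mul, norm_pow, mem_sphere_zero_iff_norm.1 hs]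
      have h3 := hball (y := nomeQ τ ^ m * s) (by
        rw [dist_zero_right, hs']
        exact hm.trans_le (min_le_right _ _))
      rw [norm_pow, norm_norm, hs'] at h3
      have h4 := hC₁ s hs
      rw [norm_mul, norm_mul, norm_pow]
      have : 0 ≤ C₁ := (norm_nonneg _).trans h4
      gcongr
    · ring
  refine squeeze_zero_norm' hmain ?_
  have h := (tendsto_pow_atTop_nhds_zero_of_lt_one (by positivity) hJ).mul_const
    (ρ * (C₁ * (C₂ * ρ ^ J)))
  rwa [zero_mul] at h

/-- Where the central charge converges, it is equal to the contour integral. If `|z| < 1`, the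
remainder tends to zero. In general it is asymptotic to a sum of geometric progressions, which
cannot tend to a nonzero limit since `z` is not in `q ^ ℤ`. -/
theorem centralCharge_eq_contourIntegral (hτ : 0 < τ.im) (ha : X.GenericParam τ a) {E : ℂ → ℂ}
    {z : ℂ} (hz : X.GenericKahler τ a z) {F : ℂ → ℂ} (hF : X.IsInterpolation τ a E z F) {δ : ℝ}
    (hδ : 0 < δ) (hsep : X.Separates τ a δ) (hconv : X.ChargeConverges τ a E z) :
    X.centralCharge τ a E z = X.contourIntegral τ a δ F := by
  obtain ⟨m₀, hm₀⟩ := exists_midRadius_le (X := X) hτ a hδ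
  have hq0 := norm_nomeQ_pos τ
  have hq1 := norm_nomeQ_lt_one hτ
  -- only the Taylor coefficients below the order `J` can have nondecaying progressions
  obtain ⟨J, hJ⟩ : ∃ J : ℕ, ‖z‖ * ‖nomeQ τ‖ ^ J < 1 := by
    have h := (tendsto_pow_atTop_nhds_zero_of_lt_one hq0.le hq1).const_mul ‖z‖
    rw [mul_zero] at h
    exact (h.eventually (gt_mem_nhds one_pos)).exists
  have hG : AnalyticAt ℂ (X.gammaTheta τ a) 0 := by
    have hne : X.phiNeg τ a 0 ≠ 0 := phiNeg_ne_zero hsep (by simpa using hδ.le)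
    refine Complex.analyticAt_iff_eventually_differentiableAt.2 ?_
    filter_upwards [(differentiable_phiNeg (X := X) (a := a) hτ 0).continuousAt.eventually_ne hne]
      with s hs using differentiableAt_gammaTheta hτ hs
  obtain ⟨P, hP⟩ := hG
  have hc : (fun s => X.gammaTheta τ a s - ∑ j ∈ Finset.range J, s ^ j * P.coeff j) =O[𝓝 0]
      fun s => ‖s‖ ^ J := by
    have h := hP.isBigO_sub_partialSum_pow J
    simpa [FormalMultilinearSeries.partialSum] using h
  have hex : ∀ e : Σ _ : Fin N, ℕ × ℂ, ∃ t : ℕ → ℂ, e ∈ X.fixedIndex a →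
      Tendsto (fun m : ℕ => X.remainder τ a z e m -
        ∑ j ∈ Finset.range J, (z * nomeQ τ ^ j) ^ m * t j) atTop (𝓝 0) := fun e => by
    by_cases he : e ∈ X.fixedIndex a
    · obtain ⟨t, ht⟩ := tendsto_remainder_sub_geometric hτ ha hz hδ hsep he hJ hc
      exact ⟨t, fun _ => ht⟩
    · exact ⟨0, fun h => absurd h he⟩
  choose t ht using hex
  have hlim := (tendsto_partialCharge hτ ha hz hconv).const_sub (X.contourIntegral τ a δ F)
  refine (sub_eq_zero.1 (eq_zero_of_tendsto_of_sub_geometric J (fun j => z * nomeQ τ ^ j)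
    (fun j => ∑ e ∈ X.fixedIndex a, X.interpCoeff τ a E z e * t e j) (fun j h => ?_) _ _ hlim
    ?_)).symm
  · refine hz.2.1 (-j) ?_
    rw [zpow_neg, zpow_natCast]
    exact eq_inv_of_mul_eq_one_left h
  · have hsum : Tendsto (fun m : ℕ => ∑ e ∈ X.fixedIndex a, X.interpCoeff τ a E z e *
        (X.remainder τ a z e m - ∑ j ∈ Finset.range J, (z * nomeQ τ ^ j) ^ m * t e j))
        atTop (𝓝 0) := by
      have h := tendsto_finsetSum (X.fixedIndex a) fun e he =>
        (ht e he).const_mul (X.interpCoeff τ a E z e)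
      simpa using h
    refine hsum.congr' ?_
    filter_upwards [eventually_ge_atTop m₀] with m hm
    have hceil : ∀ e ∈ X.fixedIndex a, ⌈((m : ℚ)) - X.sector e⌉ = m := fun e he => by
      have h0 := sector_nonneg he
      have h1 := sector_lt_one he
      rw [Int.ceil_eq_iff]
      push_cast
      constructor <;> linarith
    rw [contourIntegral_sub_partialCharge hτ ha hz hF hδ hsep fun e he => by
      rw [hceil e he]
      exact hm₀ e he m (by exact_mod_cast hm)]
    simp only [Finset.mul_sum, mul_sub, Finset.sum_sub_distrib]
    congr 1
    · exact Finset.sum_congr rfl fun e he => by rw [hceil e he]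
    · rw [Finset.sum_comm]
      exact Finset.sum_congr rfl fun j _ => Finset.sum_congr rfl fun e _ => by ring

/-- The terms of the central charge are an asymptotic expansion of the contour integral as
`z → 0`. -/
theorem exists_isBigO_contourIntegral_sub_partialCharge (hτ : 0 < τ.im) (ha : X.GenericParam τ a)
    {E : ℂ → ℂ} {Ez : ℂ → ℂ → ℂ}
    (hEz : ∀ z : ℂ, X.GenericKahler τ a z → X.IsInterpolation τ a E z (Ez z)) {δ : ℝ} (hδ : 0 < δ)
    (hsep : X.Separates τ a δ) {ε : ℝ} (hε : 0 < ε) (M : ℕ) :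
    ∃ B₀ : ℚ, ∀ B : ℚ, B₀ ≤ B →
      (fun z : ℂ => X.contourIntegral τ a δ (Ez z) - X.partialCharge τ a E B z)
        =O[𝓝[X.awayFromPoles τ a ε] (0 : ℂ)] fun z : ℂ => ‖z‖ ^ M := by
  obtain ⟨m₀, hm₀⟩ := exists_midRadius_le (X := X) hτ a
    (lt_min hδ (pow_pos (norm_nomeQ_pos τ) M))
  refine ⟨m₀ + 1, fun B hB => ?_⟩
  have hr : ∀ e ∈ X.fixedIndex a,
      X.midRadius τ e ⌈B - X.sector e⌉ ≤ min δ (‖nomeQ τ‖ ^ M) := fun e he => by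
    refine hm₀ e he _ ?_
    have h1 := sector_lt_one he
    have h2 : (m₀ : ℚ) ≤ ⌈B - X.sector e⌉ := le_trans (by linarith) (Int.le_ceil _)
    exact_mod_cast h2
  have h1 := Asymptotics.IsBigO.fun_sum fun e he =>
    isBigO_interpCoeff_mul_remainder hτ ha E hsep he ((hr e he).trans (min_le_left _ _))
      ((hr e he).trans (min_le_right _ _)) hε
  refine h1.congr' (eventually_mem_nhdsWithin.mono fun z hz => ?_) EventuallyEq.rfl
  exact (contourIntegral_sub_partialCharge hτ ha hz.1 (hEz z hz.1) hδ hsep fun e he =>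
    (hr e he).trans (min_le_left _ _)).symm

end GLSMData

end

theorem mainTheorem1 {N : ℕ} (X : GLSMData N) (τ : ℂ) (hτ : 0 < τ.im) (a : Fin N → ℂ)
    (ha : X.GenericParam τ a) (E : ℂ → ℂ) (hE : X.IsEllClass τ a E) :
    (∀ z : ℂ, X.GenericKahler τ a z →
      (∃ F : ℂ → ℂ, X.IsInterpolation τ a E z F) ∧
      (∀ F F' : ℂ → ℂ, X.IsInterpolation τ a E z F → X.IsInterpolation τ a E z F' →
        Set.EqOn F F' {0}ᶜ)) ∧
    ∀ Ez : ℂ → ℂ → ℂ,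
      (∀ z : ℂ, X.GenericKahler τ a z → X.IsInterpolation τ a E z (Ez z)) →
      ∀ δ : ℝ, 0 < δ → X.Separates τ a δ →
        (∀ z : ℂ, X.GenericKahler τ a z → X.ChargeConverges τ a E z →
          X.centralCharge τ a E z = X.contourIntegral τ a δ (Ez z)) ∧
        (∀ z : ℂ, X.GenericKahler τ a z →
          X.contourIntegral τ a δ (Ez z) = X.torusTrace τ a δ (Ez z)) ∧
        (∀ ε : ℝ, 0 < ε → ∀ M : ℕ, ∃ B₀ : ℚ, ∀ B : ℚ, B₀ ≤ B →
          (fun z : ℂ => X.contourIntegral τ a δ (Ez z) - X.partialCharge τ a E B z)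
            =O[𝓝[X.awayFromPoles τ a ε] (0 : ℂ)] fun z : ℂ => ‖z‖ ^ M) :=
  ⟨fun _ hz => ⟨⟨_, GLSMData.isInterpolation_sum hτ ha E hz⟩,
    fun _ _ hF hF' => hF.unique hτ ha hz hF'⟩,
  fun Ez hEz _ hδ hsep =>
    ⟨fun z hz hconv =>
      GLSMData.centralCharge_eq_contourIntegral hτ ha hz (hEz z hz) hδ hsep hconv,
    fun z _ => GLSMData.contourIntegral_eq_torusTrace hδ (Ez z),
    fun _ hε M => GLSMData.exists_isBigO_contourIntegral_sub_partialCharge hτ ha hEz hδ hsep hε M⟩⟩
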